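/- Setting. Let $n\ge 2$ be even. An annular-one surface graph is a finite connected graph $\mathcal G$ (loops and multiple edges allowed) with positive edge conductances $c_e$, embedded in an annulus so that every complementary component is either contractible or an annular neighbourhood of one of the two boundary circles, together with $n$ distinct vertices (nodes) $1,\dots,n$ such that $1,\dots,n-1$ lie in counterclockwise order on the inner boundary and $n$ lies on the outer boundary. A zipper is a simple dual path from the inner to the outer boundary which leaves the inner boundary between the nodes $n-1$ and $1$. For $z\in\mathbb C^*$, give every directed edge $v\to w$ the parallel transport $\phi_{v,w}=z$ if it crosses the zipper counterclockwise, $z^{-1}$ if it crosses it clockwise, and $1$ otherwise. Let $\Delta f(v)=\sum_{e=(v,w)} c_{e}\,(f(v)-\phi_{w,v}f(w))$ be the line bundle Laplacian, written $\Delta=\begin{pmatrix}A&B\\B^*&C\end{pmatrix}$ with the nodes first, where $B^*$ denotes the lower left block, and let $\mathscr L(z)=-A+BC^{-1}B^*$ be the response matrix. Put $L_{i,j}=\mathscr L_{i,j}(1)$ and $L'_{i,j}=\frac{d}{dz}\mathscr L_{i,j}(z)\big|_{z=1}$. A grove is a spanning forest of $\mathcal G$ each of whose components contains a node; its weight is the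 product of the conductances of its edges. For a partition $\sigma$ of $\{1,\dots,n\}$, $Z_\sigma$ is the sum of the weights of the groves whose components induce the partition $\sigma$ on the nodes. Theorem. Let $n\ge 2$ be even and let $\sigma$ be a pairing of $\{1,\dots,n\}$ (a partition into two-element sets). There is a polynomial $P_\sigma$ with rational coefficients, depending only on $n$ and $\sigma$ and homogeneous of degree $n/2$, in variables indexed by the $L_{i,j}$ $(1\le i<j\le n)$ and the $L'_{i,j}$ $(1\le i<j\le n-1)$, such that for every annular-one surface graph with $n$ nodes and every zipper as above, $C$ is invertible at $z=1$, $\mathscr L$ is differentiable at $z=1$, $Z_{1|2|\cdots|n}>0$, and $$\frac{Z_\sigma}{Z_{1|2|\cdots|n}}=P_\sigma\big(L_{i,j}\ (1\le i<j\le n),\ L'_{i,j}\ (1\le i<j\le n-1)\big).$$ If $Z_\sigma\ne0$ for some such graph, then $P_\sigma$ is nonzero, so that its degree is exactly $n/2$. In particular, neither the higher $z$-derivatives of $\mathscr L$ nor the first derivatives of the $\mathscr L_{i,n}$ are needed. -/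

import Mathlib

/-- The darts (oriented edges) of a finite multigraph with edge set `E`: each edge carries two
darts, one in each direction. Loops and parallel edges are allowed. -/
abbrev Dart (E : Type*) : Type _ := E × Bool

/-- Reversal of darts. -/
def Dart.rev {E : Type*} : Equiv.Perm (Dart E) := (Equiv.refl E).prodCongr Equiv.boolNot

/-- A graph with vertex set `V` and edge set `E`, drawn on an oriented surface, recorded by its
rotation system: `src d` is the vertex at which the dart `d` starts, and `rot d` is the dart that
follows `d` in the counterclockwise order around that vertex. -/
structure SurfaceMap (V E : Type*) where
  src : Dart E → V
  rot : Equiv.Perm (Dart E)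
  sameCycle_rot_iff : ∀ d d' : Dart E, rot.SameCycle d d' ↔ src d = src d'

namespace SurfaceMap

variable {V E : Type*} (M : SurfaceMap V E)

/-- The vertex at which a dart ends. -/
def tgt (d : Dart E) : V := M.src (Dart.rev d)

/-- The dart that follows `d` on the boundary walk of the complementary component lying to the
left of `d` (that component stays on the left along the walk). -/
def faceNext : Equiv.Perm (Dart E) := M.rot⁻¹ * Dart.rev

/-- Two darts have the same complementary component (face) on their left. -/
def SameFace (d d' : Dart E) : Prop := M.faceNext.SameCycle d d'

/-- The faces, i.e. the cycles of `faceNext`. -/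
def Face : Type _ := Quotient (Equiv.Perm.SameCycle.setoid M.faceNext)

/-- Two vertices are joined by a path that uses only edges of `F`. -/
def Joined (F : Set E) : V → V → Prop :=
  Relation.ReflTransGen fun u v => ∃ d : Dart E, d.1 ∈ F ∧ M.src d = u ∧ M.tgt d = v

/-- `F` contains no cycle: removing any edge of `F` separates the ends of that edge. -/
def IsForest (F : Set E) : Prop :=
  ∀ e ∈ F, ¬ M.Joined (F \ {e}) (M.src (e, true)) (M.tgt (e, true))

end SurfaceMap

/-- An annular-one surface graph with `m + 1` nodes, together with its zipper.

The graph is connected and cellularly embedded in the sphere (Euler's formula); the annulus is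
the sphere with a hole cut in each of two distinct faces, the inner and the outer one. The nodes
`0, …, m - 1` lie on the inner boundary in counterclockwise order, and node `m` on the outer one.

A node is given by a corner of the boundary walk, named by the dart that leaves the corner. The
zipper is a simple path in the dual graph from the inner to the outer face, given by the darts
`zipHead :: zipTail` that it crosses, each oriented so that the face that the zipper leaves is on
its left. It leaves the inner boundary between the nodes `m - 1` and `0`: the boundary walk of the
inner face that starts just after the zipper meets the nodes `0, …, m - 1` in this order. -/
structure AnnularOneGraph (m : ℕ) (V E : Type*) extends SurfaceMap V E where
  connected : ∀ u v : V, toSurfaceMap.Joined Set.univ u v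
  euler : Nat.card V + Nat.card toSurfaceMap.Face = Nat.card E + 2
  /-- the conductances -/
  c : E → ℝ
  c_pos : ∀ e, 0 < c e
  corner : Fin (m + 1) → Dart E
  corner_injective : Function.Injective fun i => src (corner i)
  zipHead : Dart E
  zipTail : List (Dart E)
  zip_chain : (zipHead :: zipTail).IsChain fun d d' => toSurfaceMap.SameFace (Dart.rev d) d'
  zip_simple : (zipHead :: zipTail).Pairwise fun d d' => ¬ toSurfaceMap.SameFace d d'
  zip_avoids_outer :
    ∀ d ∈ zipHead :: zipTail, ¬ toSurfaceMap.SameFace d (corner (Fin.last m))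
  zip_ends_outer : toSurfaceMap.SameFace
    (Dart.rev ((zipHead :: zipTail).getLast (List.cons_ne_nil _ _))) (corner (Fin.last m))
  time : Fin m → ℕ
  time_strictMono : StrictMono time
  time_lt : ∀ i, time i < Function.minimalPeriod toSurfaceMap.faceNext zipHead
  corner_inner : ∀ i : Fin m, corner i.castSucc =
    toSurfaceMap.faceNext^[time i] (toSurfaceMap.faceNext zipHead)

/-- A complete pairing: every part has exactly two elements. -/
def IsPairing {ι : Type*} (σ : Setoid ι) : Prop := ∀ i, ∃! j, j ≠ i ∧ σ i j

namespace AnnularOneGraph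

variable {m : ℕ} {V E : Type*} (G : AnnularOneGraph m V E)

/-- The nodes, as vertices. -/
def node (i : Fin (m + 1)) : V := G.src (G.corner i)

/-- `F` is a grove of type `σ`: a spanning forest, every component of which contains a node, such
that two nodes are in the same component exactly when they are in the same part of `σ`. -/
def IsGrove (σ : Setoid (Fin (m + 1))) (F : Set E) : Prop :=
  G.IsForest F ∧ (∀ v, ∃ i, G.Joined F v (G.node i)) ∧
    ∀ i j, G.Joined F (G.node i) (G.node j) ↔ σ i j

open Classical in
/-- `Z[σ]`: the sum over the groves of type `σ` of the product of the conductances of the edges. -/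
noncomputable def Z [Fintype E] (σ : Setoid (Fin (m + 1))) : ℝ :=
  ∑ F : Finset E with G.IsGrove σ (F : Set E), ∏ e ∈ F, G.c e

open Classical in
/-- The parallel transport along a dart: `z` if the dart crosses the zipper counterclockwise (with
the inner boundary on its left), `z⁻¹` if it crosses the zipper clockwise, and `1` otherwise. -/
noncomputable def transport (z : ℂ) (d : Dart E) : ℂ :=
  if d ∈ G.zipHead :: G.zipTail then z
  else if Dart.rev d ∈ G.zipHead :: G.zipTail then z⁻¹ else 1

open Classical in
/-- The line bundle Laplacian `(Δ f)(v) = ∑ c_{v,w} (f(v) - φ_{w,v} f(w))`, the sum being over the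
edges from `v` to `w` (a loop counts once in each direction), as a matrix; `φ_{w,v}` is the
parallel transport from `w` to `v`. -/
noncomputable def laplacian [Fintype E] (z : ℂ) : Matrix V V ℂ := fun v w =>
  ∑ d : Dart E with G.src d = v, (G.c d.1 : ℂ) *
    ((if w = v then 1 else 0) - (if w = G.tgt d then G.transport z (Dart.rev d) else 0))

/-- The vertices that are not nodes. -/
abbrev Interior : Type _ := {v : V // v ∉ Set.range G.node}

/-- The Laplacian with Dirichlet boundary conditions at the nodes. -/
noncomputable def dirichletLaplacian [Fintype E] (z : ℂ) : Matrix G.Interior G.Interior ℂ :=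
  (G.laplacian z).submatrix Subtype.val Subtype.val

open Classical in
/-- The determinant of the Dirichlet Laplacian; the response matrix is meaningful where it is
nonzero. -/
noncomputable def dirichletDet [Fintype V] [Fintype E] (z : ℂ) : ℂ :=
  (G.dirichletLaplacian z).det

open Classical in
/-- The response matrix `-A + B C⁻¹ B'`, where `A`, `B`, `B'`, `C` are the blocks of the Laplacian
with respect to nodes and interior vertices; entry `i j` carries the transports from `j` to `i`. -/
noncomputable def response [Fintype V] [Fintype E] (z : ℂ) :
    Matrix (Fin (m + 1)) (Fin (m + 1)) ℂ :=
  -(G.laplacian z).submatrix G.node G.node +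
    (G.laplacian z).submatrix G.node (Subtype.val : G.Interior → V) *
      (G.dirichletLaplacian z)⁻¹ *
      (G.laplacian z).submatrix (Subtype.val : G.Interior → V) G.node

end AnnularOneGraph

/-- The variables `L_{i,j}`, `i < j`, with `i, j` among all `m + 1` nodes, and `L'_{i,j}`, `i < j`,
with `i, j` among the first `m` nodes. -/
abbrev LVar (m : ℕ) : Type :=
  {p : Fin (m + 1) × Fin (m + 1) // p.1 < p.2} ⊕ {p : Fin m × Fin m // p.1 < p.2}

/-- The values of the variables: `L_{i,j}` is the entry of the response matrix at `z = 1`, and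
`L'_{i,j}` its derivative with respect to `z` at `z = 1`. -/
noncomputable def AnnularOneGraph.LVal {m : ℕ} {V E : Type*} [Fintype V] [Fintype E]
    (G : AnnularOneGraph m V E) : LVar m → ℂ :=
  Sum.elim (fun p => G.response 1 p.1.1 p.1.2)
    (fun p => deriv (fun z => G.response z p.1.1.castSucc p.1.2.castSucc) 1)

/-! ### First cohomology of the sphere, from Euler's formula -/

section SphereCohomology

/-! Split the nodes into tails and heads, listed in matching order, with the outer node among the
heads, and replace the row of the Laplacian at each head by the unit vector of its tail. A Schur
complement evaluates the determinant as `dirichletDet` times the minor of the response matrix with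
tail rows and head columns (`det_rootedLaplacian_pairing`). Multilinearity in the rows evaluates it
as a sum over choices of an outgoing dart at every other vertex. A choice contributes only if every
head is reached from some tail. Then the outer node is connected to an inner node, so any cycle
among the darts has trivial holonomy and kills the term. What survives are the groves that pair the
nodes (`dirichletDet_mul_det_response`).

Planarity enters through `exists_potential`: a flow without divergence is the coboundary of a
function on faces. It follows that, in such a grove, the transport between two paired inner nodes is
determined by where they lie relative to the mate of the outer node; only the transport to the outer
node itself depends on the grove. The same argument shows that the connections between inner nodes
do not cross.

To separate the pairings, give each inner node a vector `(e i, f i)` in the plane and the outer node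
the vector `(0, 1)`, and take a signed sum over all enumerations of pairs. A grove of type `σ` then
contributes its weight, times its transport to the outer node, times `pairingForm` of `σ`, which is
built from products of 2×2 brackets (`sum_responseBracket`). On the other side, each antisymmetrized
response entry is a combination of brackets in which one vector is turned by `0`, `1` or `-1` times
around the annulus, the coefficients being the even part and plus or minus the odd part divided by
`2 * (z - z⁻¹)` (`responseBracket_eq`). As `z` tends to `1` these tend to `L` and to plus or minus
half of `L'`, and pairs with the outer node have no odd part. This is why no other derivative
occurs.

The three-term relation rewrites every product of such turned brackets in terms of the forms of
noncrossing pairings, with coefficients that are continuous at `1` and rational there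
(`isCombination_pairProd`). These forms are linearly independent for generic `z`
(`exists_polynomial_independent`), though in general not at `z = 1`. Hence coefficients are compared
near `1`, and the resulting identity is carried to the limit (`Z_eq_mul_aeval`). For a crossing
pairing there are no groves and the polynomial is `0`. -/

@[simp] theorem Dart.rev_rev {E : Type*} (d : Dart E) : Dart.rev (Dart.rev d) = d := by
  rcases d with ⟨e, b⟩; simp [Dart.rev]

theorem Dart.eq_or_eq_rev {E : Type*} {d d' : Dart E} (h : d.1 = d'.1) :
    d = d' ∨ d = Dart.rev d' := by
  rcases d with ⟨e, b⟩
  rcases d' with ⟨e', b'⟩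
  obtain rfl : e = e' := h
  cases b <;> cases b' <;> simp [Dart.rev]

namespace SurfaceMap

variable {V E : Type*} (M : SurfaceMap V E)

@[simp] theorem tgt_rev (d : Dart E) : M.tgt (Dart.rev d) = M.src d := by simp [tgt]

theorem src_rev (d : Dart E) : M.src (Dart.rev d) = M.tgt d := rfl

theorem src_rot (d : Dart E) : M.src (M.rot d) = M.src d := by
  exact (M.sameCycle_rot_iff _ _).1 (Equiv.Perm.sameCycle_apply_left.2 (Equiv.Perm.SameCycle.refl _ _))

theorem faceNext_rev_rot (d : Dart E) : M.faceNext (Dart.rev (M.rot d)) = d := by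
  simp [faceNext]

@[simp] theorem src_faceNext (d : Dart E) : M.src (M.faceNext d) = M.tgt d := by
  rw [tgt, ← M.src_rot (M.faceNext d)]; simp [faceNext]

/-- A function on darts which is invariant under the rotation takes the same value on all darts
leaving a vertex. -/
theorem eq_of_src_eq [Finite E] {α : Type*} (g : Dart E → α) {v : V}
    (hg : ∀ d, M.src d = v → g (M.rot d) = g d) {d d' : Dart E} (hd : M.src d = v)
    (hd' : M.src d' = v) : g d = g d' := by
  have h : M.rot.SameCycle d d' := (M.sameCycle_rot_iff d d').2 (hd.trans hd'.symm)
  obtain ⟨n, rfl⟩ := h.exists_nat_pow_eq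
  have key : ∀ n : ℕ, M.src ((M.rot ^ n) d) = v ∧ g ((M.rot ^ n) d) = g d := by
    intro n
    induction n with
    | zero => simp [hd]
    | succ n ih =>
      rw [pow_succ', Equiv.Perm.mul_apply]
      exact ⟨(M.src_rot _).trans ih.1, (hg _ ih.1).trans ih.2⟩
  exact (key n).2.symm

/-- Rotation moves between the darts at one vertex, reversal moves along an edge. Both invariances
are required only at darts that start in the component, because in the applications they hold only
where a flow vanishes. -/
theorem eq_of_joined [Finite E] {α : Type*} (g : Dart E → α) {F : Set E} {u v : V}
    (huv : M.Joined F u v)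
    (hrot : ∀ d, M.Joined F u (M.src d) → g (M.rot d) = g d)
    (hrev : ∀ d, M.Joined F u (M.src d) → g (Dart.rev d) = g d)
    {d d' : Dart E} (hd : M.src d = u) (hd' : M.src d' = v) : g d = g d' := by
  induction huv generalizing d' with
  | refl => exact M.eq_of_src_eq g (fun e he => hrot e (he ▸ Relation.ReflTransGen.refl)) hd hd'
  | tail hab hbc ih =>
    obtain ⟨e, heF, he, he'⟩ := hbc
    have h1 := ih he
    have h2 := hrev e (he ▸ hab)
    have hc : M.Joined F u (M.src d') := by
      rw [hd']; exact hab.tail ⟨e, heF, he, he'⟩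
    have h3 : g (Dart.rev e) = g d' := M.eq_of_src_eq (v := M.src d') g
      (fun x hx => hrot x (hx ▸ hc)) (by rw [src_rev, he', hd']) rfl
    rw [h1, ← h2, h3]

/-- Rank and nullity when the kernel is the line of constants. This gives the ranks of both
coboundary maps, from faces and from vertices, of a connected map. -/
theorem finrank_ker_eq_one {ι κ : Type*} [Fintype ι] [Fintype κ] [Nonempty ι] (A : Matrix κ ι ℚ)
    (h1 : A.mulVec (fun _ => 1) = 0) (h2 : ∀ x, A.mulVec x = 0 → ∀ i j, x i = x j) :
    A.rank + 1 = Fintype.card ι := by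
  classical
  have hker : LinearMap.ker A.mulVecLin = Submodule.span ℚ {fun _ => (1 : ℚ)} := by
    ext x
    rw [LinearMap.mem_ker, Submodule.mem_span_singleton, Matrix.mulVecLin_apply]
    constructor
    · intro hx
      obtain ⟨i⟩ := ‹Nonempty ι›
      exact ⟨x i, by ext j; simp [h2 x hx i j]⟩
    · rintro ⟨a, rfl⟩
      rw [Matrix.mulVec_smul, h1, smul_zero]
  have := LinearMap.finrank_range_add_finrank_ker A.mulVecLin
  rw [hker, finrank_span_singleton, Module.finrank_fintype_fun_eq_card] at this
  · exact this
  · obtain ⟨i⟩ := ‹Nonempty ι›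
    exact fun h => one_ne_zero (congrFun h i)

/-- The first cohomology of the sphere vanishes: a divergence-free antisymmetric flow is the
difference of the values of a function on faces. -/
theorem exists_potential [Fintype V] [Fintype E] [DecidableEq V]
    (conn : ∀ u v : V, M.Joined Set.univ u v)
    (euler : Nat.card V + Nat.card M.Face = Nat.card E + 2) (θ : Dart E → ℚ)
    (hanti : ∀ d, θ (Dart.rev d) = -θ d)
    (hdiv : ∀ v, ∑ d : Dart E with M.src d = v, θ d = 0) :
    ∃ h : Dart E → ℚ, (∀ d, h (M.faceNext d) = h d) ∧ ∀ d, θ d = h d - h (Dart.rev d) := by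
  classical
  cases isEmpty_or_nonempty E with
  | inl hE => exact ⟨0, fun d => (hE.false d.1).elim, fun d => (hE.false d.1).elim⟩
  | inr hE =>
  obtain ⟨e0⟩ := hE
  have : Finite M.Face := Quotient.finite _
  let _ : Fintype M.Face := Fintype.ofFinite _
  let fc : Dart E → M.Face := fun d => Quotient.mk _ d
  have fc_next : ∀ d, fc (M.faceNext d) = fc d := fun d =>
    Quotient.sound (show M.faceNext.SameCycle (M.faceNext d) d from
      Equiv.Perm.sameCycle_apply_left.2 (Equiv.Perm.SameCycle.refl _ _))
  have : Nonempty M.Face := ⟨fc (e0, true)⟩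
  have : Nonempty V := ⟨M.src (e0, true)⟩
  -- `A` is the coboundary from faces to edges and `B` the one from vertices to edges, each edge
  -- being oriented by its dart `(e, true)`.
  let A : Matrix E M.Face ℚ := fun e f =>
    (if fc (e, true) = f then 1 else 0) - (if fc (e, false) = f then 1 else 0)
  let B : Matrix E V ℚ := fun e v =>
    (if M.src (e, true) = v then 1 else 0) - (if M.src (e, false) = v then 1 else 0)
  have hA : ∀ x e, A.mulVec x e = x (fc (e, true)) - x (fc (e, false)) := by
    intro x e
    simp [A, Matrix.mulVec, dotProduct, sub_mul, Finset.sum_sub_distrib]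
  have hB : ∀ x e, B.mulVec x e = x (M.src (e, true)) - x (M.src (e, false)) := by
    intro x e
    simp [B, Matrix.mulVec, dotProduct, sub_mul, Finset.sum_sub_distrib]
  have rankA : A.rank + 1 = Fintype.card M.Face := by
    refine finrank_ker_eq_one A (by ext e; simp [hA]) ?_
    intro x hx
    have hrev : ∀ d, x (fc (Dart.rev d)) = x (fc d) := by
      rintro ⟨e, b⟩
      have := congrFun hx e
      rw [hA, Pi.zero_apply, sub_eq_zero] at this
      cases b
      · exact this
      · exact this.symm
    have hrot : ∀ d, x (fc (M.rot d)) = x (fc d) := by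
      intro d
      rw [← hrev (M.rot d), ← fc_next (Dart.rev (M.rot d)), M.faceNext_rev_rot]
    intro i j
    induction i using Quotient.inductionOn with | _ d =>
    induction j using Quotient.inductionOn with | _ d' =>
    exact M.eq_of_joined (fun d => x (fc d)) (conn (M.src d) (M.src d')) (fun d _ => hrot d)
      (fun d _ => hrev d) rfl rfl
  have rankB : B.rank + 1 = Fintype.card V := by
    refine finrank_ker_eq_one B (by ext e; simp [hB]) ?_
    intro x hx i j
    have h1 : ∀ d : Dart E, x (M.src d) = x (M.tgt d) := by
      rintro ⟨e, b⟩
      have := congrFun hx e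
      rw [hB, Pi.zero_apply, sub_eq_zero] at this
      cases b
      · exact this.symm
      · exact this
    have := conn i j
    induction this with
    | refl => rfl
    | tail _ hbc ih =>
      obtain ⟨e, _, rfl, rfl⟩ := hbc
      rw [ih, h1]
  have sumdart : ∀ g : Dart E → ℚ, ∑ d, g d = ∑ e, (g (e, true) + g (e, false)) := by
    intro g
    rw [Fintype.sum_prod_type]
    simp
  have hBt : ∀ (y : E → ℚ) (v : V),
      B.transpose.mulVec y v = ∑ d : Dart E with M.src d = v, (if d.2 then y d.1 else - y d.1) := by
    intro y v
    rw [Finset.sum_filter, sumdart]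
    change ∑ e, B e v * y e = _
    refine Finset.sum_congr rfl fun e _ => ?_
    by_cases h1 : M.src (e, true) = v <;> by_cases h2 : M.src (e, false) = v <;> simp [B, h1, h2]
  have hle : LinearMap.range A.mulVecLin ≤ LinearMap.ker B.transpose.mulVecLin := by
    rintro _ ⟨x, rfl⟩
    rw [LinearMap.mem_ker, Matrix.mulVecLin_apply, Matrix.mulVecLin_apply]
    ext v
    rw [hBt]
    have : ∀ d : Dart E, (if d.2 then A.mulVec x d.1 else - A.mulVec x d.1) =
        x (fc d) - x (fc (Dart.rev d)) := by
      rintro ⟨e, b⟩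
      cases b <;> simp [hA, Dart.rev]
    simp only [this, Finset.sum_sub_distrib, Pi.zero_apply, sub_eq_zero]
    -- The face to the right of `rot d` is the face to the left of `d`, so rotation around `v`
    -- matches the two sums.
    refine Finset.sum_equiv M.rot ?_ ?_
    · intro d
      simp [M.src_rot]
    · intro d _
      rw [← fc_next (Dart.rev (M.rot d)), M.faceNext_rev_rot]
  have hker : LinearMap.range A.mulVecLin = LinearMap.ker B.transpose.mulVecLin := by
    -- Exactness by dimension: the kernel has dimension `|E| - (|V| - 1)`, the range `|F| - 1` with
    -- `F` the set of faces, and Euler's formula equates them.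
    refine Submodule.eq_of_le_of_finrank_eq hle ?_
    have h1 := LinearMap.finrank_range_add_finrank_ker B.transpose.mulVecLin
    have h2 : Module.finrank ℚ (LinearMap.range B.transpose.mulVecLin) = B.rank :=
      Matrix.rank_transpose B
    rw [Module.finrank_fintype_fun_eq_card, h2] at h1
    have h3 : Module.finrank ℚ (LinearMap.range A.mulVecLin) = A.rank := rfl
    rw [h3]
    rw [Nat.card_eq_fintype_card, Nat.card_eq_fintype_card, Nat.card_eq_fintype_card] at euler
    omega
  have hθ : (fun e => θ (e, true)) ∈ LinearMap.ker B.transpose.mulVecLin := by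
    rw [LinearMap.mem_ker, Matrix.mulVecLin_apply]
    ext v
    rw [hBt, Pi.zero_apply, ← hdiv v]
    refine Finset.sum_congr rfl ?_
    rintro ⟨e, b⟩ _
    cases b
    · simp [← hanti, Dart.rev]
    · simp
  rw [← hker] at hθ
  obtain ⟨x, hx⟩ := hθ
  refine ⟨fun d => x (fc d), fun d => by simp only [fc_next], ?_⟩
  have hx' : ∀ e, θ (e, true) = x (fc (e, true)) - x (fc (e, false)) := fun e => by
    rw [← hA, ← Matrix.mulVecLin_apply, hx]
  rintro ⟨e, b⟩
  cases b
  · have h1 := hanti (e, true)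
    rw [hx'] at h1
    change θ (e, false) = _ at h1
    rw [h1]
    simp [Dart.rev]
  · rw [hx']; simp [Dart.rev]

end SurfaceMap

end SphereCohomology

/-! ### Winding of flows between inner nodes -/

section Winding

namespace SurfaceMap

variable {V E : Type*} (M : SurfaceMap V E)

theorem SameFace.eq_of_invariant {M : SurfaceMap V E} [Finite E] {α : Type*} {g : Dart E → α}
    (hg : ∀ d, g (M.faceNext d) = g d) {d d' : Dart E} (h : M.SameFace d d') : g d = g d' := by
  obtain ⟨n, rfl⟩ := Equiv.Perm.SameCycle.exists_nat_pow_eq h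
  induction n with
  | zero => simp
  | succ n ih =>
    rw [pow_succ', Equiv.Perm.mul_apply, hg]
    exact ih ⟨n, by simp⟩

theorem SameFace.refl (d : Dart E) : M.SameFace d d := Equiv.Perm.SameCycle.refl _ _

theorem SameFace.symm {M : SurfaceMap V E} {d d' : Dart E} (h : M.SameFace d d') :
    M.SameFace d' d := Equiv.Perm.SameCycle.symm h

theorem SameFace.trans {M : SurfaceMap V E} {d d' d'' : Dart E} (h : M.SameFace d d')
    (h' : M.SameFace d' d'') : M.SameFace d d'' := Equiv.Perm.SameCycle.trans h h'

end SurfaceMap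

namespace AnnularOneGraph

open SurfaceMap

variable {m : ℕ} {V E : Type*} (G : AnnularOneGraph m V E)

/-- The dart at time `t` on the boundary walk of the inner face. -/
def walk (t : ℕ) : Dart E := G.faceNext^[t] (G.faceNext G.zipHead)

theorem walk_succ (t : ℕ) : G.walk (t + 1) = G.faceNext (G.walk t) :=
  Function.iterate_succ_apply' _ _ _

theorem walk_time (i : Fin m) : G.walk (G.time i) = G.corner i.castSucc := (G.corner_inner i).symm

theorem sameFace_walk (t : ℕ) : G.SameFace G.zipHead (G.walk t) := by
  induction t with
  | zero => exact Equiv.Perm.sameCycle_apply_right.2 (SameFace.refl _ _)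
  | succ t ih => rw [walk_succ]; exact Equiv.Perm.sameCycle_apply_right.2 ih

theorem walk_eq (t : ℕ) : G.walk t = G.faceNext^[t + 1] G.zipHead := rfl

theorem walk_injOn {s t : ℕ} (hs : s < Function.minimalPeriod G.faceNext G.zipHead)
    (ht : t < Function.minimalPeriod G.faceNext G.zipHead) (h : G.walk s = G.walk t) : s = t := by
  rw [walk_eq, walk_eq, Function.iterate_succ_apply', Function.iterate_succ_apply'] at h
  exact Function.iterate_injOn_Iio_minimalPeriod hs ht (G.faceNext.injective h)

open Classical in
/-- The number of visits of the inner boundary walk to a dart before it reaches the node `a`. -/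
noncomputable def visits (a : Fin m) (d : Dart E) : ℚ :=
  ∑ t ∈ Finset.range (G.time a), if d = G.walk t then 1 else 0

open Classical in
-- Advancing `d` by one face step shifts the times in the sum by one, so the two counts differ only
-- in the end terms, at the start of the walk and at the node `a`.
theorem visits_faceNext (a : Fin m) (d : Dart E) :
    G.visits a (G.faceNext d) = G.visits a d + (if G.faceNext d = G.walk 0 then 1 else 0)
      - (if G.faceNext d = G.corner a.castSucc then 1 else 0) := by
  have h1 := Finset.sum_range_succ (fun t => if G.faceNext d = G.walk t then (1 : ℚ) else 0)
    (G.time a)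
  have h2 := Finset.sum_range_succ' (fun t => if G.faceNext d = G.walk t then (1 : ℚ) else 0)
    (G.time a)
  simp only [walk_succ, EmbeddingLike.apply_eq_iff_eq, walk_time] at h1 h2
  rw [h1] at h2
  simp only [visits]
  linarith

/-- The walk starts one step after `zipHead` and returns to it only at the last time of its period,
whereas the visits counted come strictly before the time of a node. -/
theorem visits_zipHead (a : Fin m) : G.visits a G.zipHead = 0 := by
  refine Finset.sum_eq_zero fun t ht => if_neg fun h => ?_
  have h1 := G.time_lt a
  have h2 := Finset.mem_range.1 ht
  have h3 : Function.IsPeriodicPt G.faceNext (t + 1) G.zipHead := by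
    rw [walk_eq] at h; exact h.symm
  have := h3.minimalPeriod_le (Nat.succ_pos _)
  omega

open Classical in
theorem visits_corner (a k : Fin m) :
    G.visits a (G.corner k.castSucc) = if k < a then 1 else 0 := by
  have hk := G.time_lt k
  have ha := G.time_lt a
  rw [visits, ← walk_time]
  have : ∀ t ∈ Finset.range (G.time a), (if G.walk (G.time k) = G.walk t then (1 : ℚ) else 0) =
      if G.time k = t then 1 else 0 := by
    intro t ht
    have := Finset.mem_range.1 ht
    refine if_congr ⟨fun h => G.walk_injOn hk (by omega) h, fun h => by rw [h]⟩ rfl rfl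
  rw [Finset.sum_congr rfl this, Finset.sum_ite_eq]
  simp [G.time_strictMono.lt_iff_lt]

theorem visits_of_not_sameFace (a : Fin m) {d : Dart E} (h : ¬ G.SameFace G.zipHead d) :
    G.visits a d = 0 :=
  Finset.sum_eq_zero fun t _ => if_neg fun h' => h (by rw [h']; exact G.sameFace_walk t)

open Classical in
-- The boundary walk from its start to the node `a` is a unit flow, and its divergence telescopes.
-- Two such flows close up any flow between two inner nodes.
theorem visits_div [Fintype E] (a : Fin m) (v : V) :
    ∑ d : Dart E with G.src d = v, (G.visits a d - G.visits a (Dart.rev d)) =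
      (if G.src (G.walk 0) = v then 1 else 0) - (if G.node a.castSucc = v then 1 else 0) := by
  have h1 : ∑ d : Dart E with G.src d = v, G.visits a d =
      ∑ t ∈ Finset.range (G.time a), if G.src (G.walk t) = v then 1 else 0 := by
    simp only [visits]
    rw [Finset.sum_comm]
    refine Finset.sum_congr rfl fun t _ => ?_
    rw [Finset.sum_ite_eq']
    simp
  have h2 : ∑ d : Dart E with G.src d = v, G.visits a (Dart.rev d) =
      ∑ t ∈ Finset.range (G.time a), if G.src (G.walk (t + 1)) = v then 1 else 0 := by
    simp only [visits]
    rw [Finset.sum_comm]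
    refine Finset.sum_congr rfl fun t _ => ?_
    have : ∀ d : Dart E, (Dart.rev d = G.walk t) = (d = Dart.rev (G.walk t)) := fun d => by
      rw [eq_iff_iff]
      constructor
      · intro h; rw [← h, Dart.rev_rev]
      · rintro rfl; rw [Dart.rev_rev]
    simp only [this]
    rw [Finset.sum_ite_eq']
    simp [walk_succ, src_rev]
  rw [Finset.sum_sub_distrib, h1, h2, ← Finset.sum_sub_distrib, Finset.sum_range_sub', walk_time]
  rfl

open Classical in
/-- A flow from the inner node `i` to the inner node `j` is the difference of the values of a
function on the sectors into which the faces are cut at these two nodes. -/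
theorem exists_sector_function [Fintype V] [Fintype E] (θ : Dart E → ℚ)
    (hanti : ∀ d, θ (Dart.rev d) = -θ d) (i j : Fin m)
    (hdiv : ∀ v, ∑ d : Dart E with G.src d = v, θ d =
      (if G.node i.castSucc = v then 1 else 0) - (if G.node j.castSucc = v then 1 else 0)) :
    ∃ h : Dart E → ℚ, (∀ d, θ d = h d - h (Dart.rev d)) ∧
      (∀ d, h (G.faceNext d) = h d + (if G.faceNext d = G.corner i.castSucc then 1 else 0) -
        (if G.faceNext d = G.corner j.castSucc then 1 else 0)) ∧
      (∀ k : Fin m, h (G.corner k.castSucc) =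
        h G.zipHead + (if k < j then 1 else 0) - (if k < i then 1 else 0)) ∧
      ∀ d d', G.SameFace d d' → ¬ G.SameFace G.zipHead d → h d = h d' := by
  -- The flow is closed up along the inner boundary, from `j` back to the start of the walk and on
  -- to `i`, and so acquires a potential on faces. Taking the two walks off again makes the function
  -- jump at the corners of `i` and `j`.
  obtain ⟨h, h1, h2⟩ := G.exists_potential G.connected G.euler
    (fun d => θ d + (G.visits i d - G.visits i (Dart.rev d))
      - (G.visits j d - G.visits j (Dart.rev d)))
    (fun d => by simp only [hanti, Dart.rev_rev]; ring)
    (fun v => by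
      rw [Finset.sum_sub_distrib, Finset.sum_add_distrib, hdiv, visits_div, visits_div]; ring)
  refine ⟨fun d => h d + G.visits j d - G.visits i d, fun d => ?_, fun d => ?_, fun k => ?_,
    fun d d' hd hz => ?_⟩
  · have := h2 d
    linarith
  · beta_reduce; rw [h1, visits_faceNext, visits_faceNext]; ring
  · have : h G.zipHead = h (G.corner k.castSucc) :=
      SameFace.eq_of_invariant h1 (G.walk_time k ▸ G.sameFace_walk _)
    beta_reduce
    rw [visits_corner, visits_corner, visits_zipHead, visits_zipHead, this]; ring
  · have hz' : ¬ G.SameFace G.zipHead d' := fun h' => hz (h'.trans hd.symm)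
    simp only [visits_of_not_sameFace _ _ hz, visits_of_not_sameFace _ _ hz',
      SameFace.eq_of_invariant h1 hd]

/-- The darts crossed by the zipper. -/
def zip : List (Dart E) := G.zipHead :: G.zipTail

theorem not_sameFace_zipHead_outer : ¬ G.SameFace G.zipHead (G.corner (Fin.last m)) :=
  G.zip_avoids_outer _ List.mem_cons_self

/-- The sum telescopes because the reverse of a dart of the zipper has the same face on its left as
the next dart. Since `h` need not be constant on the inner face, all darts after the first must
avoid that face. -/
theorem sum_zip_aux (h : Dart E → ℚ) (hface : ∀ d d', G.SameFace d d' →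
      ¬ G.SameFace G.zipHead d → h d = h d') (l : List (Dart E)) (hne : l ≠ [])
    (hc : l.IsChain fun d d' => G.SameFace (Dart.rev d) d')
    (htail : ∀ d ∈ l.tail, ¬ G.SameFace G.zipHead d) :
    (l.map fun d => h d - h (Dart.rev d)).sum = h (l.head hne) - h (Dart.rev (l.getLast hne)) := by
  induction l with
  | nil => exact (hne rfl).elim
  | cons a l ih =>
    cases l with
    | nil => simp
    | cons b l =>
      rw [List.map_cons, List.sum_cons, ih (by simp) hc.tail
        fun d hd => htail d (List.mem_of_mem_tail hd)]
      have hab : G.SameFace (Dart.rev a) b := (List.isChain_cons_cons.1 hc).1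
      have : h (Dart.rev a) = h b := (hface b _ hab.symm (htail b (by simp))).symm
      simp only [List.head_cons, List.getLast_cons_cons, this]
      ring

theorem sum_zip (h : Dart E → ℚ) (hface : ∀ d d', G.SameFace d d' →
      ¬ G.SameFace G.zipHead d → h d = h d') :
    (G.zip.map fun d => h d - h (Dart.rev d)).sum = h G.zipHead - h (G.corner (Fin.last m)) := by
  rw [sum_zip_aux G h hface G.zip (by simp [zip]) G.zip_chain
    (fun d hd => (List.pairwise_cons.1 G.zip_simple).1 d hd)]
  have := hface _ _ G.zip_ends_outer.symm G.not_sameFace_zipHead_outer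
  simp only [zip, List.head_cons, this]

open Classical in
/-- A sector function is constant on a component on which the flow vanishes. -/
theorem sector_function_eq [Fintype E] {θ h : Dart E → ℚ} {i j : Fin m} {F : Set E} {u v : V}
    (h1 : ∀ d, θ d = h d - h (Dart.rev d))
    (h2 : ∀ d, h (G.faceNext d) = h d + (if G.faceNext d = G.corner i.castSucc then 1 else 0) -
        (if G.faceNext d = G.corner j.castSucc then 1 else 0))
    (hθ : ∀ d, G.Joined F u (G.src d) → θ d = 0)
    (hij : i = j ∨ (¬ G.Joined F u (G.node i.castSucc) ∧ ¬ G.Joined F u (G.node j.castSucc)))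
    (huv : G.Joined F u v) {d d' : Dart E} (hd : G.src d = u) (hd' : G.src d' = v) :
    h d = h d' := by
  refine G.eq_of_joined h huv (fun e he => ?_) (fun e he => ?_) hd hd'
  · have h3 := h2 (Dart.rev (G.rot e))
    have h4 := h1 (G.rot e)
    rw [hθ _ (by rwa [G.src_rot])] at h4
    rw [G.faceNext_rev_rot] at h3
    rcases hij with rfl | ⟨hi, hj⟩
    -- For `i = j` the two jumps cancel, so here the component may contain this node.
    · linarith
    · rw [if_neg (fun he' => hi (by rw [node, ← he']; exact he)),
        if_neg (fun he' => hj (by rw [node, ← he']; exact he))] at h3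
      linarith
  · have := h1 e
    rw [hθ e he] at this
    linarith

open Classical in
/-- The net number of times that a flow from `i` to `j` crosses the zipper, if the flow avoids a
component that joins the outer node with the inner node `k`. -/
theorem sum_zip_flow [Fintype V] [Fintype E] (θ : Dart E → ℚ)
    (hanti : ∀ d, θ (Dart.rev d) = -θ d) (i j : Fin m)
    (hdiv : ∀ v, ∑ d : Dart E with G.src d = v, θ d =
      (if G.node i.castSucc = v then 1 else 0) - (if G.node j.castSucc = v then 1 else 0))
    {F : Set E} (k : Fin m) (hk : G.Joined F (G.node (Fin.last m)) (G.node k.castSucc))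
    (hθ : ∀ d, G.Joined F (G.node (Fin.last m)) (G.src d) → θ d = 0)
    (hij : i = j ∨ (¬ G.Joined F (G.node (Fin.last m)) (G.node i.castSucc) ∧
      ¬ G.Joined F (G.node (Fin.last m)) (G.node j.castSucc))) :
    (G.zip.map θ).sum = (if k < i then 1 else 0) - (if k < j then 1 else 0) := by
  obtain ⟨h, h1, h2, h3, h4⟩ := G.exists_sector_function θ hanti i j hdiv
  have h5 : h (G.corner (Fin.last m)) = h (G.corner k.castSucc) :=
    G.sector_function_eq h1 h2 hθ hij hk rfl rfl
  have h6 := G.sum_zip h h4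
  simp only [← h1] at h6
  rw [h6, h5, h3]
  ring

open Classical in
/-- Two disjoint connections between inner nodes do not cross. -/
theorem not_cross_flow [Fintype V] [Fintype E] (θ : Dart E → ℚ)
    (hanti : ∀ d, θ (Dart.rev d) = -θ d) (i j : Fin m)
    (hdiv : ∀ v, ∑ d : Dart E with G.src d = v, θ d =
      (if G.node i.castSucc = v then 1 else 0) - (if G.node j.castSucc = v then 1 else 0))
    {F : Set E} (a b : Fin m) (hab : G.Joined F (G.node a.castSucc) (G.node b.castSucc))
    (hθ : ∀ d, G.Joined F (G.node a.castSucc) (G.src d) → θ d = 0)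
    (hi : ¬ G.Joined F (G.node a.castSucc) (G.node i.castSucc))
    (hj : ¬ G.Joined F (G.node a.castSucc) (G.node j.castSucc)) :
    (if a < j then (1 : ℚ) else 0) - (if a < i then 1 else 0) =
      (if b < j then 1 else 0) - (if b < i then 1 else 0) := by
  obtain ⟨h, h1, h2, h3, h4⟩ := G.exists_sector_function θ hanti i j hdiv
  have h5 : h (G.corner a.castSucc) = h (G.corner b.castSucc) :=
    G.sector_function_eq h1 h2 hθ (Or.inr ⟨hi, hj⟩) hab rfl rfl
  rw [h3, h3] at h5
  linarith

end AnnularOneGraph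

end Winding

/-! ### Forests as choices of outgoing darts -/

section FunctionalForests

namespace SurfaceMap

variable {V E : Type*} (M : SurfaceMap V E)

theorem Joined.symm {M : SurfaceMap V E} {F : Set E} {u v : V} (h : M.Joined F u v) :
    M.Joined F v u := by
  induction h with
  | refl => exact Relation.ReflTransGen.refl
  | tail _ hbc ih =>
    obtain ⟨d, hd, rfl, rfl⟩ := hbc
    exact Relation.ReflTransGen.head ⟨Dart.rev d, hd, rfl, M.tgt_rev d⟩ ih

theorem Joined.trans {M : SurfaceMap V E} {F : Set E} {u v w : V} (h : M.Joined F u v)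
    (h' : M.Joined F v w) : M.Joined F u w := Relation.ReflTransGen.trans h h'

theorem Joined.refl {M : SurfaceMap V E} {F : Set E} (u : V) : M.Joined F u u :=
  Relation.ReflTransGen.refl

theorem Joined.mono {M : SurfaceMap V E} {F F' : Set E} (hF : F ⊆ F') {u v : V}
    (h : M.Joined F u v) : M.Joined F' u v :=
  Relation.ReflTransGen.mono (fun _ _ ⟨d, hd, h⟩ => ⟨d, hF hd, h⟩) _ _ h

theorem Joined.dart {M : SurfaceMap V E} {F : Set E} {d : Dart E} (h : d.1 ∈ F) :
    M.Joined F (M.src d) (M.tgt d) := Relation.ReflTransGen.single ⟨d, h, rfl, rfl⟩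

variable (S : Set V) (f : V → Dart E)

open Classical in
/-- One step along the chosen darts, the elements of `S` being absorbing. -/
noncomputable def step (v : V) : V := if v ∈ S then v else M.tgt (f v)

/-- Outside the roots `S`, the dart chosen at a vertex leaves that vertex. -/
def IsChoice : Prop := ∀ v ∉ S, M.src (f v) = v

/-- The chosen darts lead from `v` to the root `s`. -/
def Leads (v s : V) : Prop := s ∈ S ∧ ∃ t, (M.step S f)^[t] v = s

/-- The chosen darts lead from every vertex to a root. -/
def IsRooted : Prop := ∀ v, ∃ s, M.Leads S f v s

/-- The edges of the chosen darts. -/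
def chosenEdges : Set E := {e | ∃ v ∉ S, (f v).1 = e}

variable {M S f}

theorem step_of_mem {v : V} (hv : v ∈ S) : M.step S f v = v := if_pos hv

theorem step_of_notMem {v : V} (hv : v ∉ S) : M.step S f v = M.tgt (f v) := if_neg hv

theorem iterate_step_of_mem {v : V} (hv : v ∈ S) (t : ℕ) : (M.step S f)^[t] v = v :=
  Function.iterate_fixed (step_of_mem hv) t

theorem Leads.eq_of_mem {v s : V} (h : M.Leads S f v s) (hv : v ∈ S) : v = s := by
  obtain ⟨_, t, ht⟩ := h
  rwa [iterate_step_of_mem hv] at ht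

theorem leads_self {s : V} (hs : s ∈ S) : M.Leads S f s s := ⟨hs, 0, rfl⟩

theorem Leads.unique {v s s' : V} (h : M.Leads S f v s) (h' : M.Leads S f v s') : s = s' := by
  obtain ⟨hs, t, rfl⟩ := h
  obtain ⟨hs', t', rfl⟩ := h'
  have h1 := iterate_step_of_mem (M := M) (f := f) hs t'
  have h2 := iterate_step_of_mem (M := M) (f := f) hs' t
  rw [← Function.iterate_add_apply] at h1 h2
  rw [← h1, ← h2, add_comm]

theorem leads_step {v s : V} : M.Leads S f (M.step S f v) s ↔ M.Leads S f v s := by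
  by_cases hv : v ∈ S
  · rw [step_of_mem hv]
  · refine and_congr_right fun hs => ⟨fun ⟨t, ht⟩ => ⟨t + 1, ht⟩, fun ⟨t, ht⟩ => ?_⟩
    cases t with
    | zero => exact (hv (by rw [show v = s from ht]; exact hs)).elim
    | succ t => exact ⟨t, ht⟩

theorem leads_iterate {v s : V} (t : ℕ) :
    M.Leads S f ((M.step S f)^[t] v) s ↔ M.Leads S f v s := by
  induction t generalizing v with
  | zero => rfl
  | succ t ih => rw [Function.iterate_succ_apply, ih, leads_step]

/-- A vertex leads to the same root as the end of its chosen dart, and a chosen edge may be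
traversed either way; so the root is an invariant of the component. -/
theorem leads_iff_of_joined (hf : M.IsChoice S f) {u w s : V}
    (h : M.Joined (chosenEdges S f) u w) : M.Leads S f u s ↔ M.Leads S f w s := by
  induction h with
  | refl => rfl
  | tail _ hbc ih =>
    obtain ⟨d, ⟨v, hv, hd⟩, rfl, rfl⟩ := hbc
    have h1 := hf v hv
    have h2 := leads_step (M := M) (S := S) (f := f) (v := v) (s := s)
    rw [step_of_notMem hv] at h2
    rw [ih]
    rcases Dart.eq_or_eq_rev hd with rfl | h'
    · rw [h1, h2]
    · obtain rfl : d = Dart.rev (f v) := by rw [h', Dart.rev_rev]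
      rw [M.tgt_rev, M.src_rev, h1, h2]

theorem joined_step (hf : M.IsChoice S f) (v : V) :
    M.Joined (chosenEdges S f) v (M.step S f v) := by
  by_cases hv : v ∈ S
  · rw [step_of_mem hv]; exact Joined.refl v
  · rw [step_of_notMem hv]
    have := Joined.dart (M := M) (F := chosenEdges S f) (d := f v) ⟨v, hv, rfl⟩
    rwa [hf v hv] at this

theorem joined_iterate (hf : M.IsChoice S f) (v : V) (t : ℕ) :
    M.Joined (chosenEdges S f) v ((M.step S f)^[t] v) := by
  induction t generalizing v with
  | zero => exact Joined.refl v
  | succ t ih => rw [Function.iterate_succ_apply]; exact (joined_step hf v).trans (ih _)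

theorem Leads.joined (hf : M.IsChoice S f) {v s : V} (h : M.Leads S f v s) :
    M.Joined (chosenEdges S f) v s := by
  obtain ⟨_, t, rfl⟩ := h
  exact joined_iterate hf v t

/-- Going round the period often enough overshoots the arrival at `s`, and roots are absorbing. -/
theorem Leads.eq_of_periodic {v s : V} (h : M.Leads S f v s) {t : ℕ} (ht : 0 < t)
    (hp : (M.step S f)^[t] v = v) : v = s := by
  obtain ⟨hs, N, hN⟩ := h
  have h1 : (M.step S f)^[t * N] v = v := by
    rw [Function.iterate_mul]; exact Function.iterate_fixed hp N
  obtain ⟨k, hk⟩ : ∃ k, t * N = k + N := ⟨t * N - N, by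
    have := Nat.le_mul_of_pos_left N ht; omega⟩
  rw [hk, Function.iterate_add_apply, hN, iterate_step_of_mem hs] at h1
  exact h1.symm

/-- An edge chosen from both ends would be an orbit of period two outside the roots. -/
theorem IsRooted.eq_of_edge_eq (hr : M.IsRooted S f) (hf : M.IsChoice S f) {v w : V} (hv : v ∉ S)
    (hw : w ∉ S) (h : (f v).1 = (f w).1) : v = w := by
  rcases Dart.eq_or_eq_rev h with h | h
  · rw [← hf v hv, h, hf w hw]
  · exfalso
    have h1 : M.step S f v = w := by rw [step_of_notMem hv, h, M.tgt_rev, hf w hw]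
    have h2 : M.step S f w = v := by rw [step_of_notMem hw, ← M.src_rev, ← h, hf v hv]
    obtain ⟨s, hs⟩ := hr v
    have h3 := hs.eq_of_periodic (t := 2) (by norm_num)
      (by rw [Function.iterate_succ_apply, Function.iterate_one, h1, h2])
    exact hv (h3 ▸ hs.1)

/-- If the end of the dart at `v` were joined to `v` without this edge, it would lead to `v` once
`v` is declared a root. Together with the removed dart this would be a periodic orbit through `v`,
which could not reach a root. -/
theorem IsRooted.isForest (hr : M.IsRooted S f) (hf : M.IsChoice S f) :
    M.IsForest (chosenEdges S f) := by
  rintro _ ⟨v, hv, rfl⟩ hj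
  have hj' : M.Joined (chosenEdges S f \ {(f v).1}) v (M.tgt (f v)) := by
    rcases Dart.eq_or_eq_rev (show ((f v).1, true).1 = (f v).1 from rfl) with h | h
    · rwa [h, hf v hv] at hj
    · rw [h, M.src_rev, M.tgt_rev, hf v hv] at hj; exact hj.symm
  have hf' : M.IsChoice (insert v S) f := fun w hw => hf w fun h => hw (Set.mem_insert_of_mem _ h)
  have hsub : chosenEdges S f \ {(f v).1} ⊆ chosenEdges (insert v S) f := by
    rintro _ ⟨⟨w, hw, rfl⟩, hne⟩
    refine ⟨w, ?_, rfl⟩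
    rintro (rfl | h)
    · exact hne rfl
    · exact hw h
  have h1 : M.Leads (insert v S) f (M.tgt (f v)) v :=
    (leads_iff_of_joined hf' (hj'.mono hsub)).1 (leads_self (Set.mem_insert _ _))
  have key : ∀ t w, (M.step (insert v S) f)^[t] w = v → ∃ t', (M.step S f)^[t'] w = v := by
    intro t
    induction t with
    | zero => exact fun w hw => ⟨0, hw⟩
    | succ t ih =>
      intro w hw
      by_cases hwS : w ∈ insert v S
      · rw [iterate_step_of_mem hwS] at hw
        exact ⟨0, hw⟩
      · rw [Function.iterate_succ_apply, step_of_notMem hwS] at hw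
        obtain ⟨t', ht'⟩ := ih _ hw
        refine ⟨t' + 1, ?_⟩
        rwa [Function.iterate_succ_apply, step_of_notMem fun h => hwS (Set.mem_insert_of_mem _ h)]
  obtain ⟨_, t, ht⟩ := h1
  obtain ⟨t', ht'⟩ := key t _ ht
  obtain ⟨s, hs⟩ := hr v
  have := hs.eq_of_periodic (t := t' + 1) (Nat.succ_pos _)
    (by rwa [Function.iterate_succ_apply, step_of_notMem hv])
  exact hv (this ▸ hs.1)

/-- The path to a common root is determined by the edges. If `f` chose the edge of `f' v` from its
other end `u`, then by induction `f'` would make the same choice at `u`, and `f'` would oscillate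
between `v` and `u`. -/
theorem IsRooted.eq_of_leads {S' : Set V} {f' : V → Dart E} (hf : M.IsChoice S f)
    (hf' : M.IsChoice S' f') (hE : chosenEdges S' f' = chosenEdges S f) {n : V}
    (hn : n ∈ S) {v : V} (hv : v ∉ S') (h : M.Leads S' f' v n) : v ∉ S ∧ f v = f' v := by
  have hn' : n ∈ S' := h.1
  obtain ⟨_, t, ht⟩ := h
  induction t generalizing v with
  | zero => exact (hv (by rw [show v = n from ht]; exact hn')).elim
  | succ t ih =>
    have hl' : M.Leads S' f' v n := ⟨hn', t + 1, ht⟩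
    have hl : M.Leads S f v n := by
      have := hl'.joined hf'
      rw [hE] at this
      exact (leads_iff_of_joined hf this).2 (leads_self hn)
    refine ⟨fun hvS => hv ((hl.eq_of_mem hvS) ▸ hn'), ?_⟩
    obtain ⟨u, hu, hue⟩ : (f' v).1 ∈ chosenEdges S f := hE ▸ ⟨v, hv, rfl⟩
    rcases Dart.eq_or_eq_rev hue with h | h
    · obtain rfl : u = v := by rw [← hf u hu, h, hf' v hv]
      exact h
    · exfalso
      have h1 : M.step S' f' v = u := by rw [step_of_notMem hv, ← M.src_rev, ← h, hf u hu]
      rw [Function.iterate_succ_apply, h1] at ht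
      have hu' : u ∉ S' := fun hu' => by
        rw [iterate_step_of_mem hu'] at ht
        exact hu (ht ▸ hn)
      have h2 := (ih hu' ht).2
      have h3 : M.step S' f' u = v := by
        rw [step_of_notMem hu', ← h2, h, M.tgt_rev, hf' v hv]
      have := hl'.eq_of_periodic (t := 2) (by norm_num)
        (by rw [Function.iterate_succ_apply, Function.iterate_one, h1, h3])
      exact hv (this ▸ hn')

/-- The value `d₀` at the roots has no meaning; fixing it allows a choice to be recovered from its
forest. -/
theorem exists_isRooted_of_joined {F : Set E} (hS : ∀ v, ∃ s, s ∈ S ∧ M.Joined F v s)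
    (d₀ : Dart E) : ∃ f : V → Dart E, (∀ v ∈ S, f v = d₀) ∧ M.IsChoice S f ∧ M.IsRooted S f ∧
      chosenEdges S f ⊆ F := by
  classical
  -- `R n v` says that a path of length `n` in `F` leads from `v` to `S`. The dart chosen at `v`
  -- decreases the least such `n`.
  let R : ℕ → V → Prop := fun n => Nat.rec (fun v => v ∈ S)
    (fun _ P v => ∃ d : Dart E, d.1 ∈ F ∧ M.src d = v ∧ P (M.tgt d)) n
  have hR : ∀ v, ∃ n, R n v := by
    intro v
    obtain ⟨s, hs, hj⟩ := hS v
    induction hj using Relation.ReflTransGen.head_induction_on with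
    | refl => exact ⟨0, hs⟩
    | head h _ ih =>
      obtain ⟨n, hn⟩ := ih
      obtain ⟨d, hd, h1, h2⟩ := h
      exact ⟨n + 1, d, hd, h1, by rw [h2]; exact hn⟩
  let dist : V → ℕ := fun v => sInf {n | R n v}
  have hdec : ∀ v, v ∉ S → ∃ d : Dart E, d.1 ∈ F ∧ M.src d = v ∧ dist (M.tgt d) < dist v := by
    intro v hv
    have h1 : R (dist v) v := Nat.sInf_mem (hR v)
    rcases hd : dist v with _ | n
    · rw [hd] at h1; exact (hv h1).elim
    · rw [hd] at h1
      obtain ⟨d, hdF, hsrc, htgt⟩ := h1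
      exact ⟨d, hdF, hsrc, Nat.lt_succ_of_le (Nat.sInf_le htgt)⟩
  have : Nonempty (Dart E) := ⟨d₀⟩
  choose! g hgF hgsrc hgdist using hdec
  refine ⟨fun v => if v ∈ S then d₀ else g v, fun v hv => if_pos hv, ?_, ?_, ?_⟩
  · intro v hv
    simp only [if_neg hv]
    exact hgsrc v hv
  · intro v
    induction hn : dist v using Nat.strong_induction_on generalizing v with
    | _ n ih =>
      by_cases hv : v ∈ S
      · exact ⟨v, leads_self hv⟩
      · obtain ⟨s, hs⟩ := ih _ (hn ▸ hgdist v hv) _ rfl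
        refine ⟨s, leads_step.1 ?_⟩
        rw [step_of_notMem hv]
        simpa only [if_neg hv] using hs
  · rintro _ ⟨v, hv, rfl⟩
    simp only [if_neg hv]
    exact hgF v hv

/-- An edge of `F` that is not chosen would have both ends joined to the same root by chosen edges
alone, against the absence of cycles. -/
theorem exists_isRooted {F : Set E} (hF : M.IsForest F) (hS : ∀ v, ∃! s, s ∈ S ∧ M.Joined F v s)
    (d₀ : Dart E) : ∃ f : V → Dart E, (∀ v ∈ S, f v = d₀) ∧ M.IsChoice S f ∧ M.IsRooted S f ∧
      chosenEdges S f = F := by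
  obtain ⟨f, h0, hch, hro, hsub⟩ := exists_isRooted_of_joined (fun v => (hS v).exists) d₀
  refine ⟨f, h0, hch, hro, hsub.antisymm fun e he => ?_⟩
  by_contra hne
  obtain ⟨s, hs⟩ := hro (M.src (e, true))
  obtain ⟨s', hs'⟩ := hro (M.tgt (e, true))
  have h1 := hs.joined hch
  have h2 := hs'.joined hch
  have h3 : M.Joined F (M.src (e, true)) (M.tgt (e, true)) := Joined.dart (d := (e, true)) he
  have h4 : s = s' := (hS (M.src (e, true))).unique ⟨hs.1, h1.mono hsub⟩
    ⟨hs'.1, h3.trans (h2.mono hsub)⟩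
  subst h4
  refine hF e he (Joined.mono (F' := F \ {e}) (fun e' he' => ⟨hsub he', ?_⟩) (h1.trans h2.symm))
  rintro rfl
  exact hne he'

theorem IsRooted.existsUnique (hr : M.IsRooted S f) (hf : M.IsChoice S f) (v : V) :
    ∃! s, s ∈ S ∧ M.Joined (chosenEdges S f) v s := by
  obtain ⟨s, hs⟩ := hr v
  refine ⟨s, ⟨hs.1, hs.joined hf⟩, fun s' ⟨hs', hj⟩ => ?_⟩
  exact Leads.unique ((leads_iff_of_joined hf hj).2 (leads_self hs')) hs

/-- The number of steps from `v` to the roots. -/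
noncomputable def height (M : SurfaceMap V E) (S : Set V) (f : V → Dart E) (v : V) : ℕ :=
  sInf {t | (M.step S f)^[t] v ∈ S}

theorem Leads.iterate_height {v s : V} (h : M.Leads S f v s) :
    (M.step S f)^[M.height S f v] v = s := by
  obtain ⟨hs, t, ht⟩ := h
  have h1 : (M.step S f)^[M.height S f v] v ∈ S :=
    Nat.sInf_mem (s := {t | (M.step S f)^[t] v ∈ S}) ⟨t, by
      rw [Set.mem_ofPred_eq, ht]; exact hs⟩
  exact Leads.unique (v := v) ⟨h1, _, rfl⟩ ⟨hs, t, ht⟩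

theorem iterate_notMem_of_lt_height {v : V} {t : ℕ} (ht : t < M.height S f v) :
    (M.step S f)^[t] v ∉ S := fun h => Nat.notMem_of_lt_sInf ht h

theorem height_of_mem {v : V} (hv : v ∈ S) : M.height S f v = 0 :=
  Nat.sInf_eq_zero.2 (Or.inl hv)

theorem Leads.height_eq {v s : V} (h : M.Leads S f v s) (hv : v ∉ S) :
    M.height S f v = M.height S f (M.step S f v) + 1 := by
  obtain ⟨hs, t, ht⟩ := h
  have hne : {t | (M.step S f)^[t] v ∈ S}.Nonempty :=
    ⟨t, by rw [Set.mem_ofPred_eq, ht]; exact hs⟩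
  have := Nat.sInf_add (n := 1) (p := fun t => (M.step S f)^[t] v ∈ S) (by
    rw [Nat.one_le_iff_ne_zero]
    intro h0
    have := Nat.sInf_mem hne
    rw [h0] at this
    exact hv this)
  rw [height, ← this]
  rfl

end SurfaceMap

end FunctionalForests

/-! ### Parallel transport along chosen paths -/

section PathTransport

namespace AnnularOneGraph

open SurfaceMap

variable {m : ℕ} {V E : Type*} (G : AnnularOneGraph m V E)

theorem zip_eq_of_sameFace {d d' : Dart E} (hd : d ∈ G.zip) (hd' : d' ∈ G.zip)
    (h : G.SameFace d d') : d = d' := by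
  by_contra hne
  have : Std.Symm fun d d' => ¬ G.SameFace d d' := ⟨fun _ _ h h' => h h'.symm⟩
  exact List.Pairwise.forall G.zip_simple hd hd' hne h

theorem zip_ne_nil : G.zip ≠ [] := List.cons_ne_nil _ _

theorem zip_nodup : G.zip.Nodup :=
  List.Pairwise.imp (fun {a b} h (h' : a = b) => h (by rw [h']; exact SameFace.refl _ _))
    G.zip_simple

theorem zip_getElem_rev {i : ℕ} (hi : i < G.zip.length) (h : Dart.rev G.zip[i] ∈ G.zip) :
    ∃ hi' : i + 1 < G.zip.length, G.zip[i + 1] = Dart.rev G.zip[i] := by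
  by_cases hi' : i + 1 < G.zip.length
  · have hc := (List.isChain_iff_getElem.1 (show G.zip.IsChain _ from G.zip_chain)) i hi'
    exact ⟨hi', (G.zip_eq_of_sameFace h (List.getElem_mem _) hc).symm⟩
  · exfalso
    have hlast : G.zip.getLast G.zip_ne_nil = G.zip[i] := by
      rw [List.getLast_eq_getElem]
      congr 1
      omega
    have := G.zip_ends_outer
    rw [show (G.zipHead :: G.zipTail).getLast (List.cons_ne_nil _ _) = G.zip[i] from hlast] at this
    exact G.zip_avoids_outer _ h this

/-- The left faces along the zipper are distinct, so if it crossed an edge both ways, each of the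
two darts would have to be the immediate successor of the other. -/
theorem rev_notMem_zip {d : Dart E} (hd : d ∈ G.zip) : Dart.rev d ∉ G.zip := by
  intro hr
  obtain ⟨i, hi, rfl⟩ := List.getElem_of_mem hd
  obtain ⟨hi', h1⟩ := G.zip_getElem_rev hi hr
  obtain ⟨hi'', h2⟩ := G.zip_getElem_rev hi' (by rw [h1, Dart.rev_rev]; exact hd)
  rw [h1, Dart.rev_rev] at h2
  have := (List.Nodup.getElem_inj_iff G.zip_nodup).1 h2
  omega

open Classical in
/-- The exponent of `z` in the transport along a dart. -/
noncomputable def cross (d : Dart E) : ℤ := G.zip.count d - G.zip.count (Dart.rev d)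

theorem cross_rev (d : Dart E) : G.cross (Dart.rev d) = -G.cross d := by
  simp [cross]

theorem transport_eq (z : ℂ) (d : Dart E) : G.transport z d = z ^ G.cross d := by
  classical
  rw [transport, cross]
  change (if d ∈ G.zip then z else if Dart.rev d ∈ G.zip then z⁻¹ else 1) = _
  by_cases h1 : d ∈ G.zip
  · rw [if_pos h1, List.count_eq_one_of_mem G.zip_nodup h1,
      List.count_eq_zero_of_not_mem (G.rev_notMem_zip h1)]
    simp
  · rw [if_neg h1, List.count_eq_zero_of_not_mem h1]
    by_cases h2 : Dart.rev d ∈ G.zip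
    · rw [if_pos h2, List.count_eq_one_of_mem G.zip_nodup h2]
      simp
    · rw [if_neg h2, List.count_eq_zero_of_not_mem h2]
      simp

theorem transport_one (d : Dart E) : G.transport 1 d = 1 := by rw [transport_eq, one_zpow]

variable (S : Set V) (f : V → Dart E)

/-- The product of the transports from `tgt` to `src` along the first `T` chosen darts after `v`. -/
noncomputable def pathTransport (z : ℂ) (v : V) (T : ℕ) : ℂ :=
  ∏ t ∈ Finset.range T, G.transport z (Dart.rev (f ((G.step S f)^[t] v)))

open Classical in
/-- The unit flow along the first `T` chosen darts after `v`. -/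
noncomputable def pathFlow (v : V) (T : ℕ) (d : Dart E) : ℚ :=
  ∑ t ∈ Finset.range T, ((if d = f ((G.step S f)^[t] v) then 1 else 0) -
    (if Dart.rev d = f ((G.step S f)^[t] v) then 1 else 0))

theorem pathFlow_rev (v : V) (T : ℕ) (d : Dart E) :
    G.pathFlow S f v T (Dart.rev d) = -G.pathFlow S f v T d := by
  rw [pathFlow, pathFlow, ← Finset.sum_neg_distrib]
  exact Finset.sum_congr rfl fun t _ => by rw [Dart.rev_rev]; ring

open Classical in
theorem list_sum_finset_sum {α β : Type*} (l : List α) (s : Finset β) (g : β → α → ℚ) :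
    (l.map fun a => ∑ b ∈ s, g b a).sum = ∑ b ∈ s, (l.map (g b)).sum := by
  induction l with
  | nil => simp
  | cons a l ih => simp [ih, Finset.sum_add_distrib]

theorem sum_zip_pathFlow (v : V) (T : ℕ) :
    (G.zip.map (G.pathFlow S f v T)).sum =
      ((∑ t ∈ Finset.range T, G.cross (f ((G.step S f)^[t] v)) : ℤ) : ℚ) := by
  classical
  have key : ∀ (l : List (Dart E)) (e : Dart E),
      (l.map fun d => (if d = e then (1 : ℚ) else 0) - (if Dart.rev d = e then 1 else 0)).sum =
        (l.count e : ℚ) - (l.count (Dart.rev e) : ℚ) := by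
    intro l e
    induction l with
    | nil => simp
    | cons a l ih =>
      have : (Dart.rev a = e) = (a = Dart.rev e) := by
        rw [eq_iff_iff]
        constructor
        · rintro rfl; rw [Dart.rev_rev]
        · rintro rfl; rw [Dart.rev_rev]
      rw [List.map_cons, List.sum_cons, ih, List.count_cons, List.count_cons]
      push_cast
      simp only [beq_iff_eq, this]
      ring
  have := list_sum_finset_sum G.zip (Finset.range T) (fun t d =>
    (if d = f ((G.step S f)^[t] v) then (1 : ℚ) else 0) -
    (if Dart.rev d = f ((G.step S f)^[t] v) then 1 else 0))
  unfold pathFlow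
  rw [this, Int.cast_sum]
  refine Finset.sum_congr rfl fun t _ => ?_
  rw [key, cross]
  push_cast
  rfl

theorem pathTransport_eq {z : ℂ} (hz : z ≠ 0) (v : V) (T : ℕ) :
    G.pathTransport S f z v T =
      z ^ (-∑ t ∈ Finset.range T, G.cross (f ((G.step S f)^[t] v))) := by
  unfold pathTransport
  induction T with
  | zero => simp
  | succ T ih =>
    rw [Finset.prod_range_succ, ih, Finset.sum_range_succ, transport_eq, cross_rev, neg_add,
      zpow_add₀ hz]

variable {S f}

open Classical in
theorem pathFlow_div [Fintype E] (hf : G.IsChoice S f) {v : V} {T : ℕ}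
    (hT : ∀ t < T, (G.step S f)^[t] v ∉ S) (u : V) :
    ∑ d : Dart E with G.src d = u, G.pathFlow S f v T d =
      (if v = u then 1 else 0) - (if (G.step S f)^[T] v = u then 1 else 0) := by
  have : ∑ d : Dart E with G.src d = u, G.pathFlow S f v T d = ∑ t ∈ Finset.range T,
      ((if (G.step S f)^[t] v = u then (1 : ℚ) else 0) -
        (if (G.step S f)^[t + 1] v = u then 1 else 0)) := by
    unfold pathFlow
    rw [Finset.sum_comm]
    refine Finset.sum_congr rfl fun t ht => ?_
    have hv := hT t (Finset.mem_range.1 ht)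
    rw [Function.iterate_succ_apply', step_of_notMem hv]
    generalize (G.step S f)^[t] v = w at hv
    have h2 : ∀ d : Dart E, (Dart.rev d = f w) = (d = Dart.rev (f w)) := fun d => by
      rw [eq_iff_iff]
      constructor
      · intro h; rw [← h, Dart.rev_rev]
      · rintro rfl; rw [Dart.rev_rev]
    simp only [h2]
    rw [Finset.sum_sub_distrib, Finset.sum_ite_eq', Finset.sum_ite_eq']
    simp [src_rev, hf w hv]
  rw [this, Finset.sum_range_sub']
  rfl

/-- Every vertex of the path leads to the same roots as `v`, hence not to `s`; so no dart of the
path, in either direction, starts in the component of `u`. -/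
theorem pathFlow_eq_zero (hf : G.IsChoice S f) {v : V} {T : ℕ}
    (hT : ∀ t < T, (G.step S f)^[t] v ∉ S) {u s : V} (hu : G.Leads S f u s)
    (hv : ¬ G.Leads S f v s) {d : Dart E} (hd : G.Joined (chosenEdges S f) u (G.src d)) :
    G.pathFlow S f v T d = 0 := by
  refine Finset.sum_eq_zero fun t ht => ?_
  have hd' := (leads_iff_of_joined hf hd).1 hu
  have hvS := hT t (Finset.mem_range.1 ht)
  rw [if_neg, if_neg, sub_zero]
  · intro h
    rw [← G.tgt_rev, h, ← step_of_notMem hvS, leads_step, leads_iterate] at hd'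
    exact hv hd'
  · intro h
    rw [h, hf _ hvS, leads_iterate] at hd'
    exact hv hd'

variable [Fintype V] [Fintype E]

open Classical in
/-- The transport between two inner nodes, along a path that avoids a component that joins the
outer node with the inner node `k`. -/
theorem pathTransport_inner {z : ℂ} (hz : z ≠ 0) (hf : G.IsChoice S f) {i j k : Fin m} {T : ℕ}
    (hT : ∀ t < T, (G.step S f)^[t] (G.node i.castSucc) ∉ S)
    (hj : (G.step S f)^[T] (G.node i.castSucc) = G.node j.castSucc)
    (hn : G.node (Fin.last m) ∈ S) (hk : G.Leads S f (G.node k.castSucc) (G.node (Fin.last m)))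
    (hi : ¬ G.Leads S f (G.node i.castSucc) (G.node (Fin.last m))) :
    G.pathTransport S f z (G.node i.castSucc) T =
      z ^ ((if k < j then 1 else 0) - (if k < i then 1 else 0) : ℤ) := by
  have h1 := G.sum_zip_flow (G.pathFlow S f (G.node i.castSucc) T) (G.pathFlow_rev S f _ T) i j
    (fun u => by rw [G.pathFlow_div hf hT, hj]) k (hk.joined hf).symm
    (fun d hd => G.pathFlow_eq_zero hf hT (leads_self hn) hi hd)
    (Or.inr ⟨fun h => hi ((leads_iff_of_joined hf h).1 (leads_self hn)), fun h => by
      have := (leads_iff_of_joined hf h).1 (leads_self hn)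
      rw [← hj, leads_iterate] at this
      exact hi this⟩)
  rw [sum_zip_pathFlow] at h1
  rw [pathTransport_eq _ _ _ hz]
  congr 1
  have h2 : (∑ t ∈ Finset.range T, G.cross (f ((G.step S f)^[t] (G.node i.castSucc))) : ℤ) =
      (if k < i then 1 else 0) - (if k < j then 1 else 0) := by exact_mod_cast h1
  rw [h2]
  ring

/-- A cycle that avoids a component that joins the two boundaries has trivial holonomy. -/
theorem pathTransport_cycle {z : ℂ} (hz : z ≠ 0) (hf : G.IsChoice S f) {v : V} {k : Fin m} {T : ℕ}
    (hT : ∀ t < T, (G.step S f)^[t] v ∉ S) (hv : (G.step S f)^[T] v = v)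
    (hn : G.node (Fin.last m) ∈ S) (hk : G.Leads S f (G.node k.castSucc) (G.node (Fin.last m)))
    (hi : ¬ G.Leads S f v (G.node (Fin.last m))) :
    G.pathTransport S f z v T = 1 := by
  -- A cycle has no divergence, so it counts as a flow from `k` to `k`; the crossing number of the
  -- zipper is then a difference of equal terms.
  have h1 := G.sum_zip_flow (G.pathFlow S f v T) (G.pathFlow_rev S f _ T) k k
    (fun u => by rw [G.pathFlow_div hf hT, hv, sub_self, sub_self]) k (hk.joined hf).symm
    (fun d hd => G.pathFlow_eq_zero hf hT (leads_self hn) hi hd) (Or.inl rfl)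
  rw [sum_zip_pathFlow, sub_self] at h1
  rw [pathTransport_eq _ _ _ hz]
  have h2 : (∑ t ∈ Finset.range T, G.cross (f ((G.step S f)^[t] v)) : ℤ) = 0 := by exact_mod_cast h1
  rw [h2]
  simp

open Classical in
-- The path from `i` to `j` is a flow that vanishes on the component of `a` and `b`, so its sector
-- function takes the same value at both.
theorem not_cross (hf : G.IsChoice S f) {i j a b : Fin m} {s : V}
    (hi : G.Leads S f (G.node i.castSucc) (G.node j.castSucc))
    (ha : G.Leads S f (G.node a.castSucc) s) (hb : G.Leads S f (G.node b.castSucc) s)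
    (hne : s ≠ G.node j.castSucc) :
    (if a < j then (1 : ℚ) else 0) - (if a < i then 1 else 0) =
      (if b < j then 1 else 0) - (if b < i then 1 else 0) := by
  have hT : ∀ t < G.height S f (G.node i.castSucc), (G.step S f)^[t] (G.node i.castSucc) ∉ S :=
    fun t ht => iterate_notMem_of_lt_height ht
  refine G.not_cross_flow (G.pathFlow S f (G.node i.castSucc) (G.height S f (G.node i.castSucc)))
    (G.pathFlow_rev S f _ _) i j (fun u => by rw [G.pathFlow_div hf hT, hi.iterate_height]) a b
    ((ha.joined hf).trans (hb.joined hf).symm)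
    (fun d hd => G.pathFlow_eq_zero hf hT ha (fun h => hne (h.unique hi)) hd)
    (fun h => hne (((leads_iff_of_joined hf h).1 ha).unique hi))
    (fun h => hne (((leads_iff_of_joined hf h).1 ha).unique (leads_self hi.1)))

end AnnularOneGraph

end PathTransport

/-! ### Determinants of choices of darts -/

section ForestDeterminant

namespace SurfaceMap

variable {V E : Type*} (M : SurfaceMap V E) (S : Set V) (ρ : V → V) (f : V → Dart E)
  (φ : Dart E → ℂ)

open Classical in
/-- The matrix whose rows at `v ∉ S` record the dart chosen at `v`, and whose row at `s ∈ S` is the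
unit vector of `ρ s`. -/
noncomputable def choiceMatrix : Matrix V V ℂ := fun v =>
  if v ∈ S then Pi.single (ρ v) 1 else Pi.single v 1 - φ (f v) • Pi.single (M.tgt (f v)) 1

open Classical in
/-- The product of the weights along the chosen darts from `v` to the root `s`. -/
noncomputable def reach (v s : V) : ℂ :=
  if M.Leads S f v s then ∏ t ∈ Finset.range (M.height S f v), φ (f ((M.step S f)^[t] v)) else 0

variable {M S ρ f φ}

theorem reach_of_mem {v s : V} (hv : v ∈ S) (hvs : v ≠ s) : M.reach S f φ v s = 0 :=
  if_neg fun h => hvs (h.eq_of_mem hv)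

theorem reach_self {s : V} (hs : s ∈ S) : M.reach S f φ s s = 1 := by
  rw [reach, if_pos (leads_self hs), height_of_mem hs, Finset.prod_range_zero]

theorem reach_of_notMem {v s : V} (hv : v ∉ S) :
    M.reach S f φ v s = φ (f v) * M.reach S f φ (M.tgt (f v)) s := by
  have h1 := leads_step (M := M) (S := S) (f := f) (v := v) (s := s)
  rw [step_of_notMem hv] at h1
  rw [reach, reach]
  by_cases h : M.Leads S f v s
  · rw [if_pos h, if_pos (h1.2 h), h.height_eq hv, Finset.prod_range_succ', mul_comm]
    simp only [Function.iterate_succ_apply, Function.iterate_zero, id, step_of_notMem hv]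
  · rw [if_neg h, if_neg (fun h' => h (h1.1 h')), mul_zero]

variable [Fintype V]

theorem choiceMatrix_dotProduct_of_mem {v : V} (hv : v ∈ S) (x : V → ℂ) :
    M.choiceMatrix S ρ f φ v ⬝ᵥ x = x (ρ v) := by
  classical
  rw [choiceMatrix, if_pos hv, single_dotProduct, one_mul]

theorem choiceMatrix_dotProduct_of_notMem {v : V} (hv : v ∉ S) (x : V → ℂ) :
    M.choiceMatrix S ρ f φ v ⬝ᵥ x = x v - φ (f v) * x (M.tgt (f v)) := by
  classical
  rw [choiceMatrix, if_neg hv, sub_dotProduct, smul_dotProduct, single_dotProduct,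
    single_dotProduct, one_mul, one_mul, smul_eq_mul]

open Classical in
-- The function `reach` towards `s` lies in the kernel: outside `S` by its recursion, in `S` because
-- no `ρ v` leads to `s`. It is `1` at `s`.
theorem det_choiceMatrix_of_not_leads {s : V} (hs : s ∈ S)
    (h : ∀ v ∈ S, ¬ M.Leads S f (ρ v) s) : (M.choiceMatrix S ρ f φ).det = 0 := by
  rw [← Matrix.exists_mulVec_eq_zero_iff]
  refine ⟨fun v => M.reach S f φ v s, fun h0 => ?_, ?_⟩
  · have := congrFun h0 s
    rw [reach_self hs] at this
    exact one_ne_zero this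
  · ext v
    change M.choiceMatrix S ρ f φ v ⬝ᵥ _ = 0
    by_cases hv : v ∈ S
    · rw [choiceMatrix_dotProduct_of_mem hv, reach, if_neg (h v hv)]
    · rw [choiceMatrix_dotProduct_of_notMem hv, reach_of_notMem hv, sub_self]

open Classical in
-- The partial products around the cycle form a left kernel vector: the combination of rows
-- telescopes, and closes up because the holonomy is `1`.
theorem det_choiceMatrix_of_cycle {v : V} (hv : v ∈ Function.periodicPts (M.step S f))
    (hS : ∀ t, (M.step S f)^[t] v ∉ S)
    (h : ∏ t ∈ Finset.range (Function.minimalPeriod (M.step S f) v),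
      φ (f ((M.step S f)^[t] v)) = 1) :
    (M.choiceMatrix S ρ f φ).det = 0 := by
  rw [← Matrix.exists_vecMul_eq_zero_iff]
  set T := Function.minimalPeriod (M.step S f) v with hT
  let q : ℕ → ℂ := fun t => ∏ t' ∈ Finset.range t, φ (f ((M.step S f)^[t'] v))
  refine ⟨∑ t ∈ Finset.range T, Pi.single ((M.step S f)^[t] v) (q t), fun h0 => ?_, ?_⟩
  · have h1 := congrFun h0 v
    have hTpos : 0 < T := Function.minimalPeriod_pos_of_mem_periodicPts hv
    rw [Finset.sum_apply, Finset.sum_eq_single 0] at h1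
    · simp [q] at h1
    · intro t ht ht0
      refine Pi.single_eq_of_ne (fun h2 => ht0 ?_) _
      have := Function.IsPeriodicPt.eq_zero_of_lt_minimalPeriod
        (show Function.IsPeriodicPt (M.step S f) t v from h2.symm) (Finset.mem_range.1 ht)
      exact this
    · intro h2
      exact (h2 (Finset.mem_range.2 hTpos)).elim
  · have hrow : ∀ t, Matrix.vecMul (Pi.single ((M.step S f)^[t] v) (q t))
          (M.choiceMatrix S ρ f φ) =
        Pi.single ((M.step S f)^[t] v) (q t) - Pi.single ((M.step S f)^[t + 1] v) (q (t + 1)) := by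
      intro t
      rw [Matrix.single_vecMul]
      ext w
      rw [Function.iterate_succ_apply', step_of_notMem (hS t)]
      simp only [q, Finset.prod_range_succ, choiceMatrix, if_neg (hS t), Pi.smul_apply,
        Pi.sub_apply, Pi.single_apply, smul_eq_mul, Matrix.row]
      split_ifs <;> ring
    rw [Matrix.sum_vecMul]
    simp only [hrow]
    rw [Finset.sum_range_sub' (fun t => (Pi.single ((M.step S f)^[t] v) (q t) : V → ℂ))]
    rw [hT, Function.iterate_minimalPeriod, ← hT]
    simp only [q, h, Finset.prod_range_zero, Function.iterate_zero, id, sub_self]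

open Classical in
-- The matrix `Y` is block unitriangular, with the functions `reach` as its columns at the roots.
-- Multiplication by it clears these columns in the rows outside `S`, where the remaining block is
-- unitriangular with respect to the height.
theorem det_choiceMatrix_of_isRooted (hr : M.IsRooted S f) :
    (M.choiceMatrix S ρ f φ).det =
      (Matrix.of fun s s' : S => M.reach S f φ (ρ s) s').det := by
  let Y : Matrix V V ℂ := fun v w =>
    if w ∈ S then M.reach S f φ v w else if v = w then 1 else 0
  have hY : Y.det = 1 := by
    rw [Matrix.twoBlockTriangular_det Y (fun v => v ∉ S)]
    · have h1 : Y.toSquareBlockProp (fun v => v ∉ S) = 1 := by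
        ext i j
        change (if (j : V) ∈ S then _ else if (i : V) = j then (1 : ℂ) else 0) = _
        simp only [if_neg j.2, Matrix.one_apply, Subtype.ext_iff]
      have h2 : Y.toSquareBlockProp (fun v => ¬ v ∉ S) = 1 := by
        ext i j
        change (if (j : V) ∈ S then M.reach S f φ i j else _) = _
        rw [if_pos (not_not.1 j.2), Matrix.one_apply]
        split_ifs with h
        · rw [h, reach_self (not_not.1 j.2)]
        · exact reach_of_mem (not_not.1 i.2) fun h' => h (Subtype.ext h')
      rw [h1, h2, Matrix.det_one, Matrix.det_one, one_mul]
    · intro i hi j hj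
      simp only [Y, if_neg hj]
      rw [if_neg]
      rintro rfl
      exact hi hj
  have hmul : ∀ v w, (M.choiceMatrix S ρ f φ * Y) v w =
      if v ∈ S then Y (ρ v) w else Y v w - φ (f v) * Y (M.tgt (f v)) w := by
    intro v w
    change M.choiceMatrix S ρ f φ v ⬝ᵥ (fun v => Y v w) = _
    split_ifs with hv
    · rw [choiceMatrix_dotProduct_of_mem hv]
    · rw [choiceMatrix_dotProduct_of_notMem hv]
  have hdet : (M.choiceMatrix S ρ f φ).det = (M.choiceMatrix S ρ f φ * Y).det := by
    rw [Matrix.det_mul, hY, mul_one]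
  rw [hdet, Matrix.twoBlockTriangular_det _ (fun v => v ∈ S)]
  · have h1 : (M.choiceMatrix S ρ f φ * Y).toSquareBlockProp (fun v => v ∈ S) =
        Matrix.of fun s s' : S => M.reach S f φ (ρ s) s' := by
      ext s s'
      rw [Matrix.toSquareBlockProp_def, Matrix.of_apply, hmul, if_pos s.2, Matrix.of_apply]
      exact if_pos s'.2
    have h2 : ((M.choiceMatrix S ρ f φ * Y).toSquareBlockProp (fun v => ¬ v ∈ S)).det = 1 := by
      have hent : ∀ i j : {v // v ∉ S},
          (M.choiceMatrix S ρ f φ * Y).toSquareBlockProp (fun v => ¬ v ∈ S) i j =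
          (if i = j then 1 else 0) - φ (f i) * (if M.tgt (f i) = j then 1 else 0) := by
        intro i j
        rw [Matrix.toSquareBlockProp_def, Matrix.of_apply, hmul, if_neg i.2]
        simp only [Y, if_neg j.2, Subtype.ext_iff]
      have hlt : ∀ i : {v // v ∉ S}, M.height S f (M.tgt (f i)) < M.height S f i := by
        intro i
        obtain ⟨s, hs⟩ := hr i
        rw [hs.height_eq i.2, step_of_notMem i.2]
        exact Nat.lt_succ_self _
      have hb : ((M.choiceMatrix S ρ f φ * Y).toSquareBlockProp (fun v => ¬ v ∈ S)).BlockTriangular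
          (fun i => OrderDual.toDual (M.height S f i)) := by
        intro i j hij
        rw [hent, if_neg, if_neg, mul_zero, sub_zero]
        · intro h
          have := hlt i
          rw [h] at this
          exact lt_asymm this hij
        · rintro rfl
          exact lt_irrefl _ hij
      rw [hb.det]
      refine Finset.prod_eq_one fun a _ => ?_
      have : ((M.choiceMatrix S ρ f φ * Y).toSquareBlockProp (fun v => ¬ v ∈ S)).toSquareBlock
          (fun i => OrderDual.toDual (M.height S f i)) a = 1 := by
        ext i j
        rw [Matrix.toSquareBlock_def, Matrix.of_apply, hent, Matrix.one_apply]
        rw [if_neg (c := M.tgt (f _) = _) (fun h => ?_), mul_zero, sub_zero]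
        · simp only [Subtype.ext_iff]
        · have h1 := hlt i
          rw [h] at h1
          have h2 := OrderDual.toDual.injective (i.2.trans j.2.symm)
          exact h1.ne' h2
      rw [this, Matrix.det_one]
    rw [h1, h2, mul_one]
  · intro i hi j hj
    rw [hmul, if_neg hi]
    simp only [Y, if_pos hj]
    rw [reach_of_notMem hi, sub_self]

open Classical in
/-- The expansion of the determinant of a weighted Laplacian, in which the rows at `S` are replaced
by unit vectors, over the choices of a dart at every other vertex. -/
theorem det_laplacian_expand [Fintype E] (c φ : Dart E → ℂ) (d₀ : Dart E) :
    (Matrix.of fun v => if v ∈ S then Pi.single (ρ v) 1 else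
      ∑ d : Dart E with M.src d = v, c d • ((Pi.single v 1 : V → ℂ) -
        φ d • Pi.single (M.tgt d) 1)).det =
    ∑ f : V → Dart E with (∀ v ∈ S, f v = d₀) ∧ M.IsChoice S f,
      (∏ v with v ∉ S, c (f v)) * (M.choiceMatrix S ρ f φ).det := by
  let A : V → Finset (Dart E) := fun v =>
    if v ∈ S then {d₀} else Finset.univ.filter fun d => M.src d = v
  let g : V → Dart E → V → ℂ := fun v d =>
    if v ∈ S then Pi.single (ρ v) 1 else c d • (Pi.single v 1 - φ d • Pi.single (M.tgt d) 1)
  have h1 : (Matrix.of fun v => if v ∈ S then Pi.single (ρ v) 1 else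
      ∑ d : Dart E with M.src d = v, c d • ((Pi.single v 1 : V → ℂ) -
        φ d • Pi.single (M.tgt d) 1)) = fun v => ∑ d ∈ A v, g v d := by
    funext v
    change (if v ∈ S then _ else _) = _
    by_cases hv : v ∈ S <;> simp [A, g, hv]
  -- Multilinearity in the rows; a row at a root has the single summand indexed by `d₀`.
  have h2 := (Matrix.detRowAlternating (R := ℂ) (n := V)).toMultilinearMap.map_sum_finset g A
  rw [h1]
  refine h2.trans ?_
  have h3 : Fintype.piFinset A =
      Finset.univ.filter fun f => (∀ v ∈ S, f v = d₀) ∧ M.IsChoice S f := by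
    ext f
    simp only [Fintype.mem_piFinset, Finset.mem_filter, Finset.mem_univ, true_and, A]
    constructor
    · intro h
      refine ⟨fun v hv => ?_, fun v hv => ?_⟩
      · simpa [hv] using h v
      · simpa [hv] using h v
    · rintro ⟨ha, hb⟩ v
      by_cases hv : v ∈ S
      · simpa [hv] using ha v hv
      · simpa [hv] using hb v hv
  rw [h3]
  refine Finset.sum_congr rfl fun f _ => ?_
  change Matrix.det (fun v => g v (f v)) = _
  have h4 : (fun v => g v (f v)) = Matrix.of fun v w =>
      (if v ∈ S then 1 else c (f v)) * M.choiceMatrix S ρ f φ v w := by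
    funext v w
    change g v (f v) w = (if v ∈ S then 1 else c (f v)) * M.choiceMatrix S ρ f φ v w
    by_cases hv : v ∈ S <;> simp only [g, choiceMatrix, hv, if_true, if_false, one_mul,
      Pi.smul_apply, smul_eq_mul]
  rw [h4, Matrix.det_mul_column]
  congr 1
  rw [Finset.prod_filter]
  exact Finset.prod_congr rfl fun v _ => by split_ifs <;> simp_all

end SurfaceMap

end ForestDeterminant

/-! ### From choices to groves, and the matrix-tree theorem -/

section GroveExpansion

namespace SurfaceMap

variable {V E : Type*} {M : SurfaceMap V E} {S : Set V} {f : V → Dart E}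

open Classical in
/-- Rooted choices of darts correspond to forests with one root in each component. -/
theorem sum_isRooted_eq_sum_forest [Fintype V] [Fintype E] (c : E → ℂ) (g : Set E → ℂ)
    (d₀ : Dart E) :
    ∑ f : V → Dart E with (∀ v ∈ S, f v = d₀) ∧ M.IsChoice S f,
      (∏ v with v ∉ S, c (f v).1) * (if M.IsRooted S f then g (chosenEdges S f) else 0) =
    ∑ F : Finset E with M.IsForest ((F : Finset E) : Set E) ∧ ∀ v, ∃! s, s ∈ S ∧ M.Joined (F : Set E) v s,
      (∏ e ∈ F, c e) * g F := by
  have h0 : ∑ f : V → Dart E with (∀ v ∈ S, f v = d₀) ∧ M.IsChoice S f,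
      (∏ v with v ∉ S, c (f v).1) * (if M.IsRooted S f then g (chosenEdges S f) else 0) =
    ∑ f : V → Dart E with ((∀ v ∈ S, f v = d₀) ∧ M.IsChoice S f) ∧ M.IsRooted S f,
      (∏ v with v ∉ S, c (f v).1) * g (chosenEdges S f) := by
    rw [← Finset.filter_filter _ (fun f => M.IsRooted S f),
      Finset.sum_filter (p := fun f => M.IsRooted S f)]
    exact Finset.sum_congr rfl fun f _ => by split_ifs <;> simp
  rw [h0]
  have hcoe : ∀ f : V → Dart E, ((Finset.image (fun v => (f v).1)
      (Finset.univ.filter fun v => v ∉ S) : Finset E) : Set E) = chosenEdges S f := by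
    intro f
    ext e
    simp [chosenEdges]
  refine Finset.sum_bij (fun f _ => Finset.image (fun v => (f v).1)
    (Finset.univ.filter fun v => v ∉ S)) ?_ ?_ ?_ ?_
  · intro f hf
    simp only [Finset.mem_filter, Finset.mem_univ, true_and] at hf ⊢
    rw [hcoe]
    exact ⟨hf.2.isForest hf.1.2, hf.2.existsUnique hf.1.2⟩
  · intro f hf f' hf' he
    simp only [Finset.mem_filter, Finset.mem_univ, true_and] at hf hf'
    have he' : chosenEdges S f' = chosenEdges S f := by rw [← hcoe, ← hcoe, he]
    funext v
    by_cases hv : v ∈ S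
    · rw [hf.1.1 v hv, hf'.1.1 v hv]
    · obtain ⟨s, hs⟩ := hf'.2 v
      exact (IsRooted.eq_of_leads hf.1.2 hf'.1.2 he' hs.1 hv hs).2
  · intro F hF
    simp only [Finset.mem_filter, Finset.mem_univ, true_and] at hF
    obtain ⟨f, h1, h2, h3, h4⟩ := exists_isRooted hF.1 hF.2 d₀
    refine ⟨f, Finset.mem_filter.2 ⟨Finset.mem_univ _, ⟨h1, h2⟩, h3⟩, ?_⟩
    rw [← Finset.coe_inj, hcoe, h4]
  · intro f hf
    simp only [Finset.mem_filter, Finset.mem_univ, true_and] at hf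
    rw [hcoe, Finset.prod_image]
    intro v hv w hw h
    simp only [Finset.coe_filter, Finset.mem_univ, true_and] at hv hw
    exact hf.2.eq_of_edge_eq hf.1.2 hv hw h

theorem exists_cycle [Finite V] (h : ¬ M.IsRooted S f) :
    ∃ v ∈ Function.periodicPts (M.step S f), ∀ t, (M.step S f)^[t] v ∉ S := by
  rw [IsRooted] at h
  push Not at h
  obtain ⟨v, hv⟩ := h
  obtain ⟨a, b, hab, h'⟩ := Finite.exists_ne_map_eq_of_infinite fun t => (M.step S f)^[t] v
  wlog hlt : a < b generalizing a b
  · exact this b a hab.symm h'.symm (by omega)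
  refine ⟨(M.step S f)^[a] v, ⟨b - a, by omega, ?_⟩, fun t ht => ?_⟩
  · rw [Function.IsPeriodicPt, Function.IsFixedPt, ← Function.iterate_add_apply,
      Nat.sub_add_cancel hlt.le]
    exact h'.symm
  · rw [← Function.iterate_add_apply] at ht
    exact hv _ ⟨ht, _, rfl⟩

/-- The path to a common root depends only on the set of chosen edges, hence so does its weight. -/
theorem reach_congr {S' : Set V} {f' : V → Dart E} {φ : Dart E → ℂ} (hf : M.IsChoice S f)
    (hf' : M.IsChoice S' f') (hE : chosenEdges S' f' = chosenEdges S f) {n : V}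
    (hn : n ∈ S) {v : V} (h : M.Leads S' f' v n) : M.reach S f φ v n = M.reach S' f' φ v n := by
  obtain ⟨hn', t, ht⟩ := h
  induction t generalizing v with
  | zero =>
    obtain rfl : v = n := ht
    rw [reach_self hn, reach_self hn']
  | succ t ih =>
    by_cases hv : v ∈ S'
    · obtain rfl : v = n := by rwa [iterate_step_of_mem hv] at ht
      rw [reach_self hn, reach_self hn']
    · obtain ⟨hvS, hfv⟩ := IsRooted.eq_of_leads hf hf' hE hn hv ⟨hn', t + 1, ht⟩
      rw [Function.iterate_succ_apply, step_of_notMem hv] at ht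
      rw [reach_of_notMem hv, reach_of_notMem hvS, hfv, ih ht]

end SurfaceMap

/-- The other element of the part of `i`, if this part has two elements. -/
noncomputable def Setoid.mate {ι : Type*} (σ : Setoid ι) (i : ι) : ι :=
  open Classical in if h : ∃ j, j ≠ i ∧ σ i j then h.choose else i

theorem IsPairing.mate_ne {ι : Type*} {σ : Setoid ι} (hσ : IsPairing σ) (i : ι) :
    σ.mate i ≠ i := by
  have h := (hσ i).exists
  rw [Setoid.mate, dif_pos h]
  exact h.choose_spec.1

theorem IsPairing.rel_mate {ι : Type*} {σ : Setoid ι} (hσ : IsPairing σ) (i : ι) :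
    σ i (σ.mate i) := by
  have h := (hσ i).exists
  rw [Setoid.mate, dif_pos h]
  exact h.choose_spec.2

theorem IsPairing.eq_mate {ι : Type*} {σ : Setoid ι} (hσ : IsPairing σ) {i j : ι} (hj : j ≠ i)
    (h : σ i j) : j = σ.mate i :=
  (hσ i).unique ⟨hj, h⟩ ⟨hσ.mate_ne i, hσ.rel_mate i⟩

/-- The transport from `j` to `i` in a grove of type `σ`, if the transport from the outer node to
its mate is `T`; it is `0` if `i` and `j` are not paired. -/
noncomputable def connection {m : ℕ} (σ : Setoid (Fin (m + 1))) (z T : ℂ) (i j : Fin (m + 1)) : ℂ :=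
  open Classical in if σ i j ∧ i ≠ j then (if j = Fin.last m then T else
    z ^ ((if i < σ.mate (Fin.last m) then 1 else 0) -
      (if j < σ.mate (Fin.last m) then 1 else 0) : ℤ)) else 0

namespace AnnularOneGraph

open SurfaceMap

variable {m : ℕ} {V E : Type*} (G : AnnularOneGraph m V E)

theorem node_injective : Function.Injective G.node := G.corner_injective

/-- The partition of the nodes induced by a set of edges. -/
def inducedPartition (F : Set E) : Setoid (Fin (m + 1)) where
  r i j := G.Joined F (G.node i) (G.node j)
  iseqv := ⟨fun _ => SurfaceMap.Joined.refl _, fun h => h.symm, fun h h' => h.trans h'⟩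

theorem isGrove_iff {F : Set E} {σ : Setoid (Fin (m + 1))} :
    G.IsGrove σ F ↔ G.IsForest F ∧ (∀ v, ∃ i, G.Joined F v (G.node i)) ∧
      G.inducedPartition F = σ := by
  refine and_congr_right fun _ => and_congr_right fun _ => ?_
  exact ⟨fun h => Setoid.ext h, fun h => by subst h; exact fun _ _ => Iff.rfl⟩

/-- The weight `transport (rev d)` of a dart, i.e. the transport from its target to its source. -/
noncomputable def backTransport (z : ℂ) (d : Dart E) : ℂ := G.transport z (Dart.rev d)

/-- A choice of darts towards roots, among which the outer node, which spans `F`. -/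
def IsThrough (F : Set E) (x : Set V × (V → Dart E) × Fin (m + 1)) : Prop :=
  G.node (Fin.last m) ∈ x.1 ∧ G.IsChoice x.1 x.2.1 ∧ chosenEdges x.1 x.2.1 = F ∧
    x.2.2 ≠ Fin.last m ∧ G.Leads x.1 x.2.1 (G.node x.2.2) (G.node (Fin.last m))

open Classical in
/-- The transport from the outer node to its mate in a grove. -/
noncomputable def through (F : Set E) (z : ℂ) : ℂ :=
  if h : ∃ x, G.IsThrough F x then
    G.reach h.choose.1 h.choose.2.1 (G.backTransport z) (G.node h.choose.2.2) (G.node (Fin.last m))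
  else 1

/-- A pairing leaves only one inner node in the component of the outer node, and the forest has one
path between them, so every orientation rooted at the outer node gives the same weight. -/
theorem through_eq {F : Set E} (hF : IsPairing (G.inducedPartition F))
    {x : Set V × (V → Dart E) × Fin (m + 1)} (hx : G.IsThrough F x) (z : ℂ) :
    G.through F z =
      G.reach x.1 x.2.1 (G.backTransport z) (G.node x.2.2) (G.node (Fin.last m)) := by
  have h : ∃ x, G.IsThrough F x := ⟨x, hx⟩
  rw [through, dif_pos h]
  obtain ⟨h1, h2, h3, h4, h5⟩ := h.choose_spec
  obtain ⟨g1, g2, g3, g4, g5⟩ := hx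
  have hk : h.choose.2.2 = x.2.2 := by
    have h6 := (h5.joined h2).symm
    have g6 := (g5.joined g2).symm
    rw [h3] at h6
    rw [g3] at g6
    rw [hF.eq_mate h4 h6, hF.eq_mate g4 g6]
  rw [hk]
  exact reach_congr h2 g2 (g3.trans h3.symm) h1 g5

theorem reach_one {S : Set V} {f : V → Dart E} {v s : V} (h : G.Leads S f v s) :
    G.reach S f (G.backTransport 1) v s = 1 := by
  rw [reach, if_pos h]
  exact Finset.prod_eq_one fun t _ => G.transport_one _

theorem through_one (F : Set E) : G.through F 1 = 1 := by
  rw [through]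
  split_ifs with h
  · exact G.reach_one h.choose_spec.2.2.2.2
  · rfl

theorem continuousAt_transport (d : Dart E) : ContinuousAt (fun z => G.transport z d) 1 := by
  simp only [transport_eq]
  exact continuousAt_zpow₀ _ _ (Or.inl one_ne_zero)

theorem continuousAt_through (F : Set E) : ContinuousAt (G.through F) 1 := by
  unfold through
  split_ifs with h
  · unfold reach
    split_ifs
    · exact tendsto_finsetProd _ fun t _ => G.continuousAt_transport _
    · exact continuousAt_const
  · exact continuousAt_const

variable [Fintype E]

open Classical in
/-- `Z` as a sum over finite sets of edges. -/
theorem Z_eq (σ : Setoid (Fin (m + 1))) :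
    G.Z σ = ∑ F : Finset E with G.IsGrove σ ((F : Finset E) : Set E), ∏ e ∈ F, G.c e := by
  symm
  rw [Z]
  refine Finset.sum_bij (fun F _ => (F : Set E)) ?_ ?_ ?_ ?_
  · intro F hF
    rw [Finset.mem_filter] at hF ⊢
    refine ⟨?_, hF.2⟩
    simp
  · intro F _ F' _ h
    exact Finset.coe_injective h
  · intro F hF
    rw [Finset.mem_filter] at hF
    exact ⟨F.toFinset, Finset.mem_filter.2 ⟨Finset.mem_univ _, by simpa using hF.2⟩, by simp⟩
  · intro F _
    simp

open Classical in
theorem laplacian_row (z : ℂ) (v : V) : G.laplacian z v =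
    ∑ d : Dart E with G.src d = v, (G.c d.1 : ℂ) • ((Pi.single v 1 : V → ℂ) -
      G.backTransport z d • Pi.single (G.tgt d) 1) := by
  ext w
  rw [laplacian, Finset.sum_apply]
  refine Finset.sum_congr rfl fun d _ => ?_
  simp [Pi.single_apply, backTransport]

open Classical in
/-- The Laplacian with the rows at `S` replaced by unit vectors. -/
noncomputable def rootedLaplacian (S : Set V) (ρ : V → V) (z : ℂ) : Matrix V V ℂ :=
  Matrix.of fun v => if v ∈ S then Pi.single (ρ v) 1 else G.laplacian z v

open Classical in
theorem rootedLaplacian_of_mem {S : Set V} (ρ : V → V) (z : ℂ) {v : V} (hv : v ∈ S) :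
    G.rootedLaplacian S ρ z v = Pi.single (ρ v) 1 := if_pos hv

theorem rootedLaplacian_of_notMem {S : Set V} (ρ : V → V) (z : ℂ) {v : V} (hv : v ∉ S) :
    G.rootedLaplacian S ρ z v = G.laplacian z v := if_neg hv

variable [Fintype V]

open Classical in
theorem det_rootedLaplacian (S : Set V) (ρ : V → V) (z : ℂ) (d₀ : Dart E) (g : Set E → ℂ)
    (hg : ∀ f : V → Dart E, G.IsChoice S f →
      (G.choiceMatrix S ρ f (G.backTransport z)).det =
        if G.IsRooted S f then g (chosenEdges S f) else 0) :
    (G.rootedLaplacian S ρ z).det =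
      ∑ F : Finset E with G.IsForest ((F : Finset E) : Set E) ∧ ∀ v, ∃! s, s ∈ S ∧ G.Joined (F : Set E) v s,
        (∏ e ∈ F, (G.c e : ℂ)) * g F := by
  rw [← sum_isRooted_eq_sum_forest (fun e => (G.c e : ℂ)) g d₀]
  have := det_laplacian_expand (M := G.toSurfaceMap) (S := S) (ρ := ρ) (fun d => (G.c d.1 : ℂ))
    (G.backTransport z) d₀
  simp only [← laplacian_row] at this
  rw [rootedLaplacian, this]
  refine Finset.sum_congr rfl fun f hf => ?_
  rw [hg f (Finset.mem_filter.1 hf).2.2]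

open Classical in
theorem det_rootedLaplacian_nodes (z : ℂ) :
    (G.rootedLaplacian (Set.range G.node) id z).det = G.dirichletDet z := by
  rw [Matrix.twoBlockTriangular_det _ (fun v => v ∉ Set.range G.node)]
  · have h2 : (G.rootedLaplacian (Set.range G.node) id z).toSquareBlockProp
        (fun v => ¬ v ∉ Set.range G.node) = 1 := by
      ext i j
      change G.rootedLaplacian (Set.range G.node) id z i j = _
      rw [rootedLaplacian_of_mem _ _ _ (not_not.1 i.2), Matrix.one_apply, Pi.single_apply]
      simp only [Subtype.ext_iff, id, eq_comm]
    have h1 : (G.rootedLaplacian (Set.range G.node) id z).toSquareBlockProp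
        (fun v => v ∉ Set.range G.node) = G.dirichletLaplacian z := by
      ext i j
      change G.rootedLaplacian (Set.range G.node) id z i j = _
      rw [rootedLaplacian_of_notMem _ _ _ i.2]
      rfl
    rw [h2, h1, Matrix.det_one, mul_one, dirichletDet]
  · intro i hi j hj
    rw [rootedLaplacian_of_mem _ _ _ (not_not.1 hi), id, Pi.single_eq_of_ne]
    rintro rfl
    exact hi hj

/-- The matrix-tree theorem: the Dirichlet determinant counts the groves all of whose components
contain a single node. -/
theorem dirichletDet_one : G.dirichletDet 1 = (G.Z ⊥ : ℝ) := by
  classical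
  rw [← det_rootedLaplacian_nodes, G.det_rootedLaplacian _ _ _ G.zipHead (fun _ => 1)]
  · rw [Z_eq]
    push_cast
    refine Finset.sum_congr ?_ fun F _ => mul_one _
    ext F
    simp only [Finset.mem_filter, Finset.mem_univ, true_and]
    refine and_congr_right fun _ => ?_
    constructor
    · intro h
      refine ⟨fun v => ?_, fun i j => ⟨fun hij => ?_, fun hij => ?_⟩⟩
      · obtain ⟨s, ⟨⟨i, rfl⟩, hs⟩, -⟩ := h v
        exact ⟨i, hs⟩
      · exact G.node_injective ((h (G.node i)).unique ⟨⟨i, rfl⟩, SurfaceMap.Joined.refl _⟩ ⟨⟨j, rfl⟩, hij⟩)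
      · obtain rfl : i = j := hij
        exact SurfaceMap.Joined.refl _
    · rintro ⟨h1, h2⟩ v
      obtain ⟨i, hi⟩ := h1 v
      refine ⟨G.node i, ⟨⟨i, rfl⟩, hi⟩, ?_⟩
      rintro _ ⟨⟨j, rfl⟩, hj⟩
      have : j = i := (h2 j i).1 (hj.symm.trans hi)
      rw [this]
  · intro f hf
    split_ifs with hr
    · rw [det_choiceMatrix_of_isRooted hr]
      convert Matrix.det_one (n := Set.range G.node) (R := ℂ)
      ext s s'
      rw [Matrix.of_apply, Matrix.one_apply, id]
      split_ifs with h
      · rw [h, reach_self s'.2]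
      · exact reach_of_mem s.2 fun h' => h (Subtype.ext h')
    · obtain ⟨v, hv, hS⟩ := exists_cycle hr
      -- At `z = 1` every cycle has trivial holonomy, so only rooted choices contribute.
      exact det_choiceMatrix_of_cycle hv hS (Finset.prod_eq_one fun t _ => G.transport_one _)

end AnnularOneGraph

end GroveExpansion

/-! ### Minors of the response matrix as determinants of a modified Laplacian -/

section PairingExpansion

/-- The three unitriangular factors multiply to the matrix that exchanges the block columns up to
sign. -/
theorem Matrix.det_fromBlocks_one_zero {ι : Type*} [Fintype ι] [DecidableEq ι]
    (A B : Matrix ι ι ℂ) : (Matrix.fromBlocks A (-B) 1 0).det = B.det := by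
  have h1 : (Matrix.fromBlocks A (-B) 1 0) * (Matrix.fromBlocks 1 1 0 1 *
      Matrix.fromBlocks 1 0 (-1) 1 * Matrix.fromBlocks 1 1 0 1) =
      Matrix.fromBlocks B A (0 : Matrix ι ι ℂ) (1 : Matrix ι ι ℂ) := by
    simp [Matrix.fromBlocks_multiply]
  have h2 := congrArg Matrix.det h1
  rw [Matrix.det_mul, Matrix.det_mul, Matrix.det_mul, Matrix.det_fromBlocks_zero₂₁,
    Matrix.det_fromBlocks_zero₁₂, Matrix.det_fromBlocks_zero₂₁] at h2
  simpa using h2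

namespace AnnularOneGraph

open SurfaceMap

variable {m h : ℕ} {V E : Type*} (G : AnnularOneGraph m V E) (β : Fin h × Bool ≃ Fin (m + 1))

/-- The vertex at the end of an oriented pair. -/
def head (a : Fin h) : V := G.node (β (a, false))

/-- The vertex at the beginning of an oriented pair. -/
def tail (a : Fin h) : V := G.node (β (a, true))

/-- The map that sends the end of an oriented pair to its beginning. -/
noncomputable def headToTail : V → V := Function.extend (G.head β) (G.tail β) id

theorem head_injective : Function.Injective (G.head β) := fun a b hab => by
  simpa using β.injective (G.node_injective hab)

theorem tail_injective : Function.Injective (G.tail β) := fun a b hab => by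
  simpa using β.injective (G.node_injective hab)

theorem tail_ne_head (a b : Fin h) : G.tail β a ≠ G.head β b := fun hab => by
  simpa using β.injective (G.node_injective hab)

theorem headToTail_head (a : Fin h) : G.headToTail β (G.head β a) = G.tail β a :=
  (G.head_injective β).extend_apply _ _ a

theorem bijective_tail_head_interior : Function.Bijective
    (Sum.elim (Sum.elim (G.tail β) (G.head β)) (Subtype.val : G.Interior → V)) := by
  constructor
  · refine Function.Injective.sumElim ((G.tail_injective β).sumElim (G.head_injective β)
      (G.tail_ne_head β)) Subtype.val_injective ?_
    rintro (a | a) v hv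
    · exact v.2 ⟨_, hv⟩
    · exact v.2 ⟨_, hv⟩
  · intro v
    by_cases hv : v ∈ Set.range G.node
    · obtain ⟨i, rfl⟩ := hv
      obtain ⟨⟨a, b⟩, rfl⟩ := β.surjective i
      cases b
      · exact ⟨Sum.inl (Sum.inr a), rfl⟩
      · exact ⟨Sum.inl (Sum.inl a), rfl⟩
    · exact ⟨Sum.inr ⟨v, hv⟩, rfl⟩

variable [Fintype V] [Fintype E]

open Classical in
-- Eliminating the interior vertices by a Schur complement leaves minus the response matrix in the
-- tail rows, and the identity at the tail columns in the head rows. Only the block of tail rows and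
-- head columns survives in the determinant.
theorem det_rootedLaplacian_pairing {z : ℂ} (hz : G.dirichletDet z ≠ 0) :
    (G.rootedLaplacian (Set.range (G.head β)) (G.headToTail β) z).det =
      G.dirichletDet z *
        (Matrix.of fun a b => G.response z (β (a, true)) (β (b, false))).det := by
  let e := Equiv.ofBijective _ (G.bijective_tail_head_interior β)
  have hunit : IsUnit (G.dirichletLaplacian z).det := by
    rw [isUnit_iff_ne_zero]
    exact hz
  let _ : Invertible (G.dirichletLaplacian z) := Matrix.invertibleOfIsUnitDet _ hunit
  let L := G.laplacian z
  let X : Matrix (Fin h ⊕ Fin h) (Fin h ⊕ Fin h) ℂ := Matrix.fromBlocks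
    (L.submatrix (G.tail β) (G.tail β)) (L.submatrix (G.tail β) (G.head β)) 1 0
  let Y : Matrix (Fin h ⊕ Fin h) G.Interior ℂ :=
    Matrix.fromRows (L.submatrix (G.tail β) Subtype.val) 0
  let Y' : Matrix G.Interior (Fin h ⊕ Fin h) ℂ :=
    Matrix.fromCols (L.submatrix Subtype.val (G.tail β)) (L.submatrix Subtype.val (G.head β))
  have hQ : (G.rootedLaplacian (Set.range (G.head β)) (G.headToTail β) z).submatrix e e =
      Matrix.fromBlocks X Y Y' (G.dirichletLaplacian z) := by
    have hL : ∀ v ∉ Set.range (G.head β), ∀ w,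
        G.rootedLaplacian (Set.range (G.head β)) (G.headToTail β) z v w = L v w :=
      fun v hv w => by rw [rootedLaplacian_of_notMem _ _ _ hv]
    have hS : ∀ a w, G.rootedLaplacian (Set.range (G.head β)) (G.headToTail β) z (G.head β a) w =
        (Pi.single (G.tail β a) 1 : V → ℂ) w :=
      fun a w => by rw [rootedLaplacian_of_mem _ _ _ (Set.mem_range_self a), headToTail_head]
    have ht : ∀ a, G.tail β a ∉ Set.range (G.head β) := fun a ⟨b, hb⟩ => G.tail_ne_head β a b hb.symm
    have hi : ∀ v : G.Interior, (v : V) ∉ Set.range (G.head β) := fun v ⟨b, hb⟩ => v.2 ⟨_, hb⟩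
    ext i j
    rcases i with (a | a) | v
    · rcases j with (b | b) | w
      · exact hL _ (ht a) _
      · exact hL _ (ht a) _
      · exact hL _ (ht a) _
    · rcases j with (b | b) | w
      · refine (hS a (G.tail β b)).trans ?_
        change _ = (1 : Matrix (Fin h) (Fin h) ℂ) a b
        rw [Pi.single_apply, Matrix.one_apply, (G.tail_injective β).eq_iff]
        simp only [eq_comm]
      · refine (hS a (G.head β b)).trans ?_
        exact Pi.single_eq_of_ne (G.tail_ne_head β a b).symm _
      · refine (hS a w).trans ?_
        exact Pi.single_eq_of_ne (fun h' => w.2 ⟨_, h'.symm⟩) _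
    · rcases j with (b | b) | w
      · exact hL _ (hi v) _
      · exact hL _ (hi v) _
      · exact hL _ (hi v) _
  rw [← Matrix.det_submatrix_equiv_self e, hQ, Matrix.det_fromBlocks₂₂]
  have hX : X - Y * ⅟(G.dirichletLaplacian z) * Y' = Matrix.fromBlocks
      (-(Matrix.of fun a b => G.response z (β (a, true)) (β (b, true))))
      (-(Matrix.of fun a b => G.response z (β (a, true)) (β (b, false)))) 1 0 := by
    rw [Matrix.invOf_eq_nonsing_inv]
    have hresp : ∀ (a : Fin h) (i : Fin (m + 1)), -G.response z (β (a, true)) i =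
        L (G.tail β a) (G.node i) - (L.submatrix (G.tail β) (Subtype.val : G.Interior → V) *
          (G.dirichletLaplacian z)⁻¹ *
            L.submatrix (Subtype.val : G.Interior → V) G.node) a i := by
      intro a i
      rw [response, Matrix.add_apply, neg_add, Matrix.neg_apply, neg_neg, sub_eq_add_neg]
      rfl
    have hY : Y * (G.dirichletLaplacian z)⁻¹ * Y' = Matrix.fromBlocks
        (L.submatrix (G.tail β) (Subtype.val : G.Interior → V) * (G.dirichletLaplacian z)⁻¹ *
          L.submatrix (Subtype.val : G.Interior → V) (G.tail β))
        (L.submatrix (G.tail β) (Subtype.val : G.Interior → V) * (G.dirichletLaplacian z)⁻¹ *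
          L.submatrix (Subtype.val : G.Interior → V) (G.head β)) 0 0 := by
      rw [Matrix.fromRows_mul, Matrix.fromRows_mul_fromCols, Matrix.zero_mul, Matrix.zero_mul,
        Matrix.zero_mul]
    rw [hY, sub_eq_add_neg, Matrix.fromBlocks_neg, Matrix.fromBlocks_add]
    congr 1
    · ext a b
      exact (sub_eq_add_neg _ _).symm.trans (hresp a (β (b, true))).symm
    · ext a b
      exact (sub_eq_add_neg _ _).symm.trans (hresp a (β (b, false))).symm
    · rw [neg_zero, add_zero]
    · rw [neg_zero, add_zero]
  rw [hX, Matrix.det_fromBlocks_one_zero]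
  rfl

end AnnularOneGraph

end PairingExpansion

/-! ### Expansion of the minors over pairing groves -/

section GroveTheorem

open Classical in
theorem SurfaceMap.det_choiceMatrix_range {V E ι : Type*} [Fintype V] [Fintype ι] [DecidableEq ι]
    {M : SurfaceMap V E} {s : ι → V} (hs : Function.Injective s) {ρ : V → V} {f : V → Dart E}
    {φ : Dart E → ℂ} (hr : M.IsRooted (Set.range s) f) :
    (M.choiceMatrix (Set.range s) ρ f φ).det =
      (Matrix.of fun a b => M.reach (Set.range s) f φ (ρ (s a)) (s b)).det := by
  rw [det_choiceMatrix_of_isRooted hr]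
  symm
  convert Matrix.det_submatrix_equiv_self (Equiv.ofInjective s hs) _
  rfl

namespace AnnularOneGraph

open SurfaceMap

variable {m h : ℕ} {V E : Type*} (G : AnnularOneGraph m V E) {β : Fin h × Bool ≃ Fin (m + 1)}
  {f : V → Dart E}

/-- A grove that induces a complete pairing of the nodes. -/
def IsPairingGrove (F : Set E) : Prop :=
  G.IsForest F ∧ (∀ v, ∃ i, G.Joined F v (G.node i)) ∧ IsPairing (G.inducedPartition F)

variable {G}

/-- Each tail leads to at most one head, and there are as many tails as heads; so if all heads are
hit, the relation is a bijection. -/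
theorem exists_leads_iff
    (hit : ∀ b, ∃ a, G.Leads (Set.range (G.head β)) f (G.tail β a) (G.head β b)) :
    ∃ π : Fin h ≃ Fin h, ∀ a b,
      G.Leads (Set.range (G.head β)) f (G.tail β a) (G.head β b) ↔ a = π b := by
  choose g hg using hit
  have hinj : Function.Injective g := fun b b' hb => by
    have h1 := hg b
    rw [hb] at h1
    exact G.head_injective β (h1.unique (hg b'))
  refine ⟨Equiv.ofBijective g (Finite.injective_iff_bijective.1 hinj), fun a b => ⟨fun hab => ?_,
    fun hab => by rw [hab]; exact hg b⟩⟩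
  obtain ⟨b', rfl⟩ := Finite.surjective_of_injective hinj a
  rw [G.head_injective β (hab.unique (hg b'))]
  rfl

theorem isPairingGrove_chosenEdges (hf : G.IsChoice (Set.range (G.head β)) f)
    (hr : G.IsRooted (Set.range (G.head β)) f)
    (hit : ∀ b, ∃ a, G.Leads (Set.range (G.head β)) f (G.tail β a) (G.head β b)) :
    G.IsPairingGrove (chosenEdges (Set.range (G.head β)) f) := by
  refine ⟨hr.isForest hf, fun v => ?_, ?_⟩
  · obtain ⟨s, hs⟩ := hr v
    obtain ⟨b, rfl⟩ := hs.1
    exact ⟨_, hs.joined hf⟩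
  · obtain ⟨π, hπ⟩ := exists_leads_iff hit
    have hself : ∀ b, G.Leads (Set.range (G.head β)) f (G.head β b) (G.head β b) :=
      fun b => leads_self ⟨b, rfl⟩
    have huniq : ∀ (a : Fin h) (c : Bool) (b : Fin h),
        G.Leads (Set.range (G.head β)) f (G.node (β (a, c))) (G.head β b) →
        (a, c) = (π b, true) ∨ (a, c) = (b, false) := by
      intro a c b hab
      cases c
      · right
        rw [G.head_injective β ((hself a).unique hab)]
      · left
        rw [(hπ a b).1 hab]
    intro i
    obtain ⟨⟨a, c⟩, rfl⟩ := β.surjective i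
    cases c
    · refine ⟨β (π a, true), ⟨by simp, (((hπ _ _).2 rfl).joined hf).symm⟩, ?_⟩
      rintro j ⟨hj, hja⟩
      obtain ⟨⟨a', c'⟩, rfl⟩ := β.surjective j
      rcases huniq a' c' a ((leads_iff_of_joined hf hja).1 (hself a)) with h1 | h1
      · rw [h1]
      · rw [h1] at hj; exact (hj rfl).elim
    · obtain ⟨b, rfl⟩ := π.surjective a
      have hb := (hπ _ b).2 rfl
      refine ⟨β (b, false), ⟨by simp, hb.joined hf⟩, ?_⟩
      rintro j ⟨hj, hja⟩
      obtain ⟨⟨a', c'⟩, rfl⟩ := β.surjective j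
      rcases huniq a' c' b ((leads_iff_of_joined hf hja).1 hb) with h1 | h1
      · rw [h1] at hj; exact (hj rfl).elim
      · rw [h1]

theorem hit_of_isPairingGrove (hf : G.IsChoice (Set.range (G.head β)) f)
    (hF : G.IsPairingGrove (chosenEdges (Set.range (G.head β)) f)) (b : Fin h) :
    ∃ a, G.Leads (Set.range (G.head β)) f (G.tail β a) (G.head β b) := by
  have h1 := hF.2.2.rel_mate (β (b, false))
  have h2 := hF.2.2.mate_ne (β (b, false))
  have hself : G.Leads (Set.range (G.head β)) f (G.head β b) (G.head β b) := leads_self ⟨b, rfl⟩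
  obtain ⟨⟨a, c⟩, ha⟩ := β.surjective ((G.inducedPartition
    (chosenEdges (Set.range (G.head β)) f)).mate (β (b, false)))
  rw [← ha] at h1 h2
  have h3 := (leads_iff_of_joined hf h1).1 hself
  cases c
  · have h4 : G.head β a = G.head β b := h3.eq_of_mem ⟨a, rfl⟩
    rw [G.head_injective β h4] at h2
    exact (h2 rfl).elim
  · exact ⟨a, h3⟩

/-- Two paired tails would give a zero row and two paired heads a zero column. So every pair
consists of a tail and a head, and the heads can serve as roots. -/
theorem existsUnique_of_det_ne_zero {F : Set E} (hF : G.IsPairingGrove F) {z T : ℂ}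
    (hdet : (Matrix.of fun a b =>
      connection (G.inducedPartition F) z T (β (a, true)) (β (b, false))).det ≠ 0) (v : V) :
    ∃! s, s ∈ Set.range (G.head β) ∧ G.Joined F v s := by
  have hσ := hF.2.2
  have htail : ∀ a, ∃ b, (G.inducedPartition F).mate (β (a, true)) = β (b, false) := by
    intro a
    obtain ⟨⟨b, c⟩, hb⟩ := β.surjective ((G.inducedPartition F).mate (β (a, true)))
    cases c
    · exact ⟨b, hb.symm⟩
    · refine (hdet (Matrix.det_eq_zero_of_row_eq_zero a fun b' => ?_)).elim
      rw [Matrix.of_apply, connection, if_neg]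
      rintro ⟨h1, h2⟩
      have := hσ.eq_mate h2.symm h1
      rw [← hb] at this
      simpa using β.injective this
  have hhead : ∀ b, ∃ a, (G.inducedPartition F).mate (β (b, false)) = β (a, true) := by
    intro b
    obtain ⟨⟨a, c⟩, ha⟩ := β.surjective ((G.inducedPartition F).mate (β (b, false)))
    cases c
    · refine (hdet (Matrix.det_eq_zero_of_column_eq_zero b fun a' => ?_)).elim
      rw [Matrix.of_apply, connection, if_neg]
      rintro ⟨h1, h2⟩
      have := hσ.eq_mate h2 ((G.inducedPartition F).symm h1)
      rw [← ha] at this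
      simpa using β.injective this
    · exact ⟨a, ha.symm⟩
  have huniq : ∀ b b', G.Joined F (G.head β b) (G.head β b') → b = b' := by
    intro b b' hbb
    by_contra hne
    obtain ⟨a, ha⟩ := hhead b
    have := hσ.eq_mate (i := β (b, false)) (j := β (b', false))
      (fun h' => hne (by simpa using (β.injective h').symm)) hbb
    rw [ha] at this
    simpa using β.injective this
  obtain ⟨i, hi⟩ := hF.2.1 v
  obtain ⟨b, hb⟩ : ∃ b, G.Joined F v (G.head β b) := by
    obtain ⟨⟨a, c⟩, rfl⟩ := β.surjective i
    cases c
    · exact ⟨a, hi⟩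
    · obtain ⟨b, hb⟩ := htail a
      have := hσ.rel_mate (β (a, true))
      rw [hb] at this
      exact ⟨b, hi.trans this⟩
  refine ⟨G.head β b, ⟨⟨b, rfl⟩, hb⟩, ?_⟩
  rintro _ ⟨⟨b', rfl⟩, hb'⟩
  rw [huniq b b' (hb.symm.trans hb')]

variable [Fintype V] [Fintype E]

/-- A path to a head other than the outer node avoids the component of the outer node, which joins
the two boundaries and so fixes the winding of the path. For the outer node the weight is `through`.
-/
theorem reach_eq_connection {z : ℂ} (hz : z ≠ 0) (hf : G.IsChoice (Set.range (G.head β)) f)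
    (hF : G.IsPairingGrove (chosenEdges (Set.range (G.head β)) f))
    {b₀ : Fin h} (hb₀ : β (b₀, false) = Fin.last m) (a b : Fin h) :
    G.reach (Set.range (G.head β)) f (G.backTransport z) (G.tail β a) (G.head β b) =
      connection (G.inducedPartition (chosenEdges (Set.range (G.head β)) f)) z
        (G.through (chosenEdges (Set.range (G.head β)) f) z) (β (a, true)) (β (b, false)) := by
  have hself : ∀ b, G.Leads (Set.range (G.head β)) f (G.head β b) (G.head β b) :=
    fun b => leads_self ⟨b, rfl⟩
  have hlast : G.head β b₀ = G.node (Fin.last m) := by rw [head, hb₀]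
  have htl : ∀ a, β (a, true) ≠ Fin.last m := fun a ha => by
    simpa using β.injective (ha.trans hb₀.symm)
  have hne : ∀ a b, β (a, true) ≠ β (b, false) := by simp
  by_cases hab : G.Leads (Set.range (G.head β)) f (G.tail β a) (G.head β b)
  swap
  · rw [reach, if_neg hab, connection, if_neg]
    rintro ⟨h1, -⟩
    exact hab ((leads_iff_of_joined hf h1).2 (hself b))
  have hthr : ∀ a, G.Leads (Set.range (G.head β)) f (G.tail β a) (G.head β b₀) →
      G.IsThrough (chosenEdges (Set.range (G.head β)) f)
        (Set.range (G.head β), f, β (a, true)) := fun a ha =>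
    ⟨⟨b₀, hlast⟩, hf, rfl, htl a, by rw [← hlast]; exact ha⟩
  rw [connection, if_pos ⟨hab.joined hf, hne a b⟩]
  by_cases hb : b = b₀
  · subst hb
    rw [if_pos hb₀, through_eq G hF.2.2 (hthr a hab), ← hlast]
    rfl
  · have hbl : β (b, false) ≠ Fin.last m := fun h' => by
      rw [← hb₀] at h'
      exact hb (by simpa using β.injective h')
    rw [if_neg hbl]
    obtain ⟨a₀, ha₀⟩ := hit_of_isPairingGrove hf hF b₀
    have hmate : β (a₀, true) =
        (G.inducedPartition (chosenEdges (Set.range (G.head β)) f)).mate (Fin.last m) := by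
      refine hF.2.2.eq_mate (htl a₀) ?_
      have := (ha₀.joined hf).symm
      rw [hlast] at this
      exact this
    rw [← hmate]
    obtain ⟨i, hi⟩ := Fin.exists_castSucc_eq.2 (htl a)
    obtain ⟨j, hj⟩ := Fin.exists_castSucc_eq.2 hbl
    obtain ⟨k, hk⟩ := Fin.exists_castSucc_eq.2 (htl a₀)
    have hti : G.tail β a = G.node i.castSucc := by rw [tail, hi]
    have hhj : G.head β b = G.node j.castSucc := by rw [head, hj]
    have htk : G.tail β a₀ = G.node k.castSucc := by rw [tail, hk]
    rw [reach, if_pos hab]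
    rw [hti, hhj] at hab
    rw [htk, hlast] at ha₀
    have hil : ¬ G.Leads (Set.range (G.head β)) f (G.node i.castSucc) (G.node (Fin.last m)) :=
      fun h' => by
        have := hab.unique h'
        exact hbl (hj.symm.trans (G.node_injective this))
    have := G.pathTransport_inner hz hf
      (fun t ht => iterate_notMem_of_lt_height ht) hab.iterate_height ⟨b₀, hlast⟩ ha₀ hil
    rw [← hi, ← hj, ← hk, hti]
    refine (show _ = G.pathTransport _ _ _ _ _ from rfl).trans (this.trans ?_)
    congr 1
    -- When both ends differ from `k`, the indicators of `k < i` and `k < j` are complementary to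
    -- those of `i < k` and `j < k`, which `connection` uses.
    have hik : i ≠ k := by
      rintro rfl
      exact hil ha₀
    have hjk : j ≠ k := by
      rintro rfl
      have h1 := ha₀.eq_of_mem ⟨b, hhj⟩
      exact hbl (hj.symm.trans (G.node_injective h1))
    simp only [Fin.castSucc_lt_castSucc_iff]
    rcases lt_or_gt_of_ne hik with h1 | h1 <;> rcases lt_or_gt_of_ne hjk with h2 | h2 <;>
      simp [h1, h2, h1.not_gt, h2.not_gt]

open Classical in
-- A head reached by no tail makes the matrix singular. If all heads are reached, the component of
-- the outer node joins the two boundaries, so a cycle disjoint from it has trivial holonomy and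
-- again makes the matrix singular.
theorem det_choiceMatrix_pairing {z : ℂ} (hz : z ≠ 0) (hf : G.IsChoice (Set.range (G.head β)) f)
    {b₀ : Fin h} (hb₀ : β (b₀, false) = Fin.last m) :
    (G.choiceMatrix (Set.range (G.head β)) (G.headToTail β) f (G.backTransport z)).det =
      if G.IsRooted (Set.range (G.head β)) f then
        (if G.IsPairingGrove (chosenEdges (Set.range (G.head β)) f) then
          (Matrix.of fun a b =>
            connection (G.inducedPartition (chosenEdges (Set.range (G.head β)) f)) z
            (G.through (chosenEdges (Set.range (G.head β)) f) z)
            (β (a, true)) (β (b, false))).det else 0) else 0 := by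
  by_cases hit : ∀ b, ∃ a, G.Leads (Set.range (G.head β)) f (G.tail β a) (G.head β b)
  · split_ifs with hr hF
    · rw [det_choiceMatrix_range (G.head_injective β) hr]
      refine congrArg Matrix.det (Matrix.ext fun a b => ?_)
      rw [Matrix.of_apply, headToTail_head, reach_eq_connection hz hf hF hb₀]
      rfl
    · exact (hF (isPairingGrove_chosenEdges hf hr hit)).elim
    · obtain ⟨v, hv, hS⟩ := exists_cycle hr
      refine det_choiceMatrix_of_cycle hv hS ?_
      have hlast : G.head β b₀ = G.node (Fin.last m) := by rw [head, hb₀]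
      obtain ⟨a₀, ha₀⟩ := hit b₀
      obtain ⟨k, hk⟩ := Fin.exists_castSucc_eq.2 (show β (a₀, true) ≠ Fin.last m from fun ha => by
        simpa using β.injective (ha.trans hb₀.symm))
      rw [hlast, tail, ← hk] at ha₀
      exact G.pathTransport_cycle hz hf (fun t _ => hS t) Function.iterate_minimalPeriod
        ⟨b₀, hlast⟩ ha₀ (fun ⟨hs, t, ht⟩ => hS t (ht ▸ hs))
  · have h0 : (G.choiceMatrix (Set.range (G.head β)) (G.headToTail β) f
        (G.backTransport z)).det = 0 := by
      push Not at hit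
      obtain ⟨b, hb⟩ := hit
      refine det_choiceMatrix_of_not_leads (s := G.head β b) ⟨b, rfl⟩ ?_
      rintro _ ⟨a, rfl⟩
      rw [headToTail_head]
      exact hb a
    rw [h0]
    split_ifs with hr hF
    · exact (hit (hit_of_isPairingGrove hf hF)).elim
    · rfl
    · rfl

open Classical in
/-- The expansion of the minors of the response matrix over groves. -/
theorem dirichletDet_mul_det_response {z : ℂ} (hz : z ≠ 0) (hdet : G.dirichletDet z ≠ 0)
    {b₀ : Fin h} (hb₀ : β (b₀, false) = Fin.last m) :
    G.dirichletDet z *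
        (Matrix.of fun a b => G.response z (β (a, true)) (β (b, false))).det =
      ∑ F : Finset E with G.IsPairingGrove ((F : Finset E) : Set E), (∏ e ∈ F, (G.c e : ℂ)) *
        (Matrix.of fun a b => connection (G.inducedPartition (F : Set E)) z
          (G.through F z) (β (a, true)) (β (b, false))).det := by
  rw [← det_rootedLaplacian_pairing G β hdet, G.det_rootedLaplacian _ _ _ G.zipHead
    (fun F => if G.IsPairingGrove F then (Matrix.of fun a b =>
      connection (G.inducedPartition F) z (G.through F z) (β (a, true)) (β (b, false))).det else 0)
    (fun f hf => det_choiceMatrix_pairing hz hf hb₀)]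
  rw [Finset.sum_filter, Finset.sum_filter]
  refine Finset.sum_congr rfl fun F _ => ?_
  by_cases hF : G.IsPairingGrove (F : Set E)
  · rw [if_pos hF]
    split_ifs with h1
    · rfl
    · symm
      rw [mul_eq_zero]
      right
      by_contra hne
      exact h1 ⟨hF.1, fun v => existsUnique_of_det_ne_zero hF hne v⟩
  · rw [if_neg hF, if_neg hF, mul_zero, ite_self]

/-- Groves do not induce crossing connections between inner nodes. -/
theorem IsPairingGrove.not_cross {F : Set E} (hF : G.IsPairingGrove F) {i j a b : Fin m}
    (hij : G.inducedPartition F i.castSucc j.castSucc)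
    (hab : G.inducedPartition F a.castSucc b.castSucc)
    (hia : ¬ G.inducedPartition F i.castSucc a.castSucc) :
    (if a < j then (1 : ℚ) else 0) - (if a < i then 1 else 0) =
      (if b < j then 1 else 0) - (if b < i then 1 else 0) := by
  classical
  let σ := G.inducedPartition F
  -- One representative for each class, with `j` representing the class of `i`, so that the path
  -- from `i` ends at `j`.
  let r : Fin (m + 1) → Fin (m + 1) := fun x =>
    if σ x j.castSucc then j.castSucc else Quotient.out (Quotient.mk σ x)
  have hr : ∀ x, σ x (r x) := by
    intro x
    simp only [r]
    split_ifs with hx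
    · exact hx
    · exact Setoid.symm (Quotient.mk_out (s := σ) x)
  have hr' : ∀ x y, σ x y → r x = r y := by
    intro x y hxy
    have h1 : σ x j.castSucc ↔ σ y j.castSucc := ⟨σ.trans (σ.symm hxy), σ.trans hxy⟩
    have h2 : Quotient.mk σ x = Quotient.mk σ y := Quotient.sound hxy
    simp only [r, h1, h2]
  let S : Set V := Set.range fun x => G.node (r x)
  have hS : ∀ v, ∃! s, s ∈ S ∧ G.Joined F v s := by
    intro v
    obtain ⟨x, hx⟩ := hF.2.1 v
    refine ⟨G.node (r x), ⟨⟨x, rfl⟩, hx.trans (hr x)⟩, ?_⟩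
    rintro _ ⟨⟨y, rfl⟩, hy⟩
    have hxy : σ x y := hx.symm.trans (hy.trans (SurfaceMap.Joined.symm (hr y)))
    simp only [hr' x y hxy]
  obtain ⟨f, -, hf, -, hE⟩ := exists_isRooted hF.1 hS G.zipHead
  have hlead : ∀ x, G.Leads S f (G.node x) (G.node (r x)) := fun x =>
    (leads_iff_of_joined hf (by rw [hE]; exact hr x)).2 (leads_self ⟨x, rfl⟩)
  have hri : r i.castSucc = j.castSucc := if_pos hij
  have h1 := hlead i.castSucc
  rw [hri] at h1
  have h2 := hlead b.castSucc
  rw [← hr' _ _ hab] at h2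
  refine G.not_cross hf h1 (hlead a.castSucc) h2 fun h3 => hia ?_
  have h4 := hr a.castSucc
  rw [G.node_injective h3] at h4
  exact σ.trans hij (σ.symm h4)

end AnnularOneGraph

end GroveTheorem

/-! ### Signs of enumerations and products of brackets -/

section PairingBrackets

variable {m h : ℕ}

/-- The sign of an enumeration of oriented pairs, relative to a reference enumeration. -/
def pairSign (β₀ β : Fin h × Bool ≃ Fin (m + 1)) : ℤˣ :=
  Equiv.Perm.sign (β₀.symm.trans β)

theorem pairSign_trans (β₀ β : Fin h × Bool ≃ Fin (m + 1)) (γ : Equiv.Perm (Fin h × Bool)) :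
    pairSign β₀ (γ.trans β) = Equiv.Perm.sign γ * pairSign β₀ β := by
  have : β₀.symm.trans (γ.trans β) = ((β.symm.trans γ).trans β) * (β₀.symm.trans β) := by
    ext i; simp
  rw [pairSign, this, Equiv.Perm.sign_mul, Equiv.Perm.sign_symm_trans_trans]
  rfl

/-- The partition into the pairs of an enumeration. -/
def pairSetoid (β : Fin h × Bool ≃ Fin (m + 1)) : Setoid (Fin (m + 1)) :=
  Setoid.ker fun i => (β.symm i).1

theorem pairSetoid_iff {β : Fin h × Bool ≃ Fin (m + 1)} {i j : Fin (m + 1)} :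
    pairSetoid β i j ↔ (β.symm i).1 = (β.symm j).1 := Iff.rfl

theorem pairSetoid_apply {β : Fin h × Bool ≃ Fin (m + 1)} {a b : Fin h} {c d : Bool} :
    pairSetoid β (β (a, c)) (β (b, d)) ↔ a = b := by simp [pairSetoid_iff]

theorem isPairing_pairSetoid (β : Fin h × Bool ≃ Fin (m + 1)) : IsPairing (pairSetoid β) := by
  intro i
  obtain ⟨⟨a, c⟩, rfl⟩ := β.surjective i
  refine ⟨β (a, !c), ⟨by simp, by simp [pairSetoid_apply]⟩, ?_⟩
  rintro j ⟨hj, hij⟩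
  obtain ⟨⟨b, d⟩, rfl⟩ := β.surjective j
  rw [pairSetoid_apply] at hij
  subst hij
  cases c <;> cases d <;> simp_all

theorem mate_pairSetoid (β : Fin h × Bool ≃ Fin (m + 1)) (a : Fin h) (c : Bool) :
    (pairSetoid β).mate (β (a, c)) = β (a, !c) :=
  ((isPairing_pairSetoid β).eq_mate (by simp) (pairSetoid_apply.2 rfl)).symm

theorem Fin.prod_univ_two_slots {M : Type*} [CommMonoid M] (g : Fin h → M) {a b : Fin h}
    (hab : a ≠ b) : ∏ c, g c = g a * (g b * ∏ c ∈ (Finset.univ.erase a).erase b, g c) := by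
  rw [← Finset.mul_prod_erase Finset.univ g (Finset.mem_univ a),
    ← Finset.mul_prod_erase (Finset.univ.erase a) g
      (Finset.mem_erase.2 ⟨hab.symm, Finset.mem_univ b⟩)]

/-- Exchange of the end of the pair `a` with the beginning or the end of the pair `b`. -/
def exchange (β : Fin h × Bool ≃ Fin (m + 1)) (a b : Fin h) (c : Bool) :
    Fin h × Bool ≃ Fin (m + 1) := (Equiv.swap (a, false) (b, c)).trans β

theorem exchange_of_ne (β : Fin h × Bool ≃ Fin (m + 1)) {a b d : Fin h} (c : Bool)
    (ha : d ≠ a) (hb : d ≠ b) (e : Bool) : exchange β a b c (d, e) = β (d, e) := by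
  rw [exchange, Equiv.trans_apply, Equiv.swap_apply_of_ne_of_ne] <;> simp [ha, hb]

theorem exchange_left_true (β : Fin h × Bool ≃ Fin (m + 1)) {a b : Fin h} (hab : a ≠ b)
    (c : Bool) : exchange β a b c (a, true) = β (a, true) := by
  rw [exchange, Equiv.trans_apply, Equiv.swap_apply_of_ne_of_ne] <;> simp [hab]

theorem exchange_left_false (β : Fin h × Bool ≃ Fin (m + 1)) (a b : Fin h)
    (c : Bool) : exchange β a b c (a, false) = β (b, c) := by
  rw [exchange, Equiv.trans_apply, Equiv.swap_apply_left]

theorem exchange_right (β : Fin h × Bool ≃ Fin (m + 1)) (a b : Fin h)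
    (c : Bool) : exchange β a b c (b, c) = β (a, false) := by
  rw [exchange, Equiv.trans_apply, Equiv.swap_apply_right]

theorem exchange_right_not (β : Fin h × Bool ≃ Fin (m + 1)) {a b : Fin h} (hab : a ≠ b)
    (c : Bool) : exchange β a b c (b, !c) = β (b, !c) := by
  rw [exchange, Equiv.trans_apply, Equiv.swap_apply_of_ne_of_ne] <;> simp [hab.symm]

theorem prod_exchange_true {M : Type*} [CommMonoid M] (q : Fin (m + 1) → Fin (m + 1) → M)
    (β : Fin h × Bool ≃ Fin (m + 1)) {a b : Fin h} (hab : a ≠ b) :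
    ∏ c, q (exchange β a b true (c, true)) (exchange β a b true (c, false)) =
      q (β (a, true)) (β (b, true)) * (q (β (a, false)) (β (b, false)) *
        ∏ c ∈ (Finset.univ.erase a).erase b, q (β (c, true)) (β (c, false))) := by
  rw [Fin.prod_univ_two_slots _ hab, exchange_left_true _ hab, exchange_left_false, exchange_right,
    show exchange β a b true (b, false) = β (b, false) from exchange_right_not β hab true]
  congr 2
  refine Finset.prod_congr rfl fun c hc => ?_
  simp only [Finset.mem_erase, Finset.mem_univ, and_true] at hc
  rw [exchange_of_ne _ _ hc.2 hc.1, exchange_of_ne _ _ hc.2 hc.1]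

theorem prod_exchange_false {M : Type*} [CommMonoid M] (q : Fin (m + 1) → Fin (m + 1) → M)
    (β : Fin h × Bool ≃ Fin (m + 1)) {a b : Fin h} (hab : a ≠ b) :
    ∏ c, q (exchange β a b false (c, true)) (exchange β a b false (c, false)) =
      q (β (a, true)) (β (b, false)) * (q (β (b, true)) (β (a, false)) *
        ∏ c ∈ (Finset.univ.erase a).erase b, q (β (c, true)) (β (c, false))) := by
  rw [Fin.prod_univ_two_slots _ hab, exchange_left_true _ hab, exchange_left_false, exchange_right,
    show exchange β a b false (b, true) = β (b, true) from exchange_right_not β hab false]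
  congr 2
  refine Finset.prod_congr rfl fun c hc => ?_
  simp only [Finset.mem_erase, Finset.mem_univ, and_true] at hc
  rw [exchange_of_ne _ _ hc.2 hc.1, exchange_of_ne _ _ hc.2 hc.1]

/-- The bracket of the vectors `(z ^ ω i * e i, z ^ (-ω i) * f i)`, where the vector of the last
index is `(0, 1)`. -/
noncomputable def bracket (z : ℂ) (e f : Fin (m + 1) → ℂ) (ω : Fin (m + 1) → ℤ)
    (i j : Fin (m + 1)) : ℂ :=
  (if i = Fin.last m then 0 else z ^ ω i * e i) * (if j = Fin.last m then 1 else z ^ (-ω j) * f j) -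
  (if j = Fin.last m then 0 else z ^ ω j * e j) * (if i = Fin.last m then 1 else z ^ (-ω i) * f i)

theorem bracket_swap (z : ℂ) (e f : Fin (m + 1) → ℂ) (ω : Fin (m + 1) → ℤ) (i j : Fin (m + 1)) :
    bracket z e f ω j i = -bracket z e f ω i j := by
  simp only [bracket]; ring

/-- The product of the brackets of the pairs. -/
noncomputable def pairProd (z : ℂ) (e f : Fin (m + 1) → ℂ) (ω : Fin (m + 1) → ℤ)
    (β : Fin h × Bool ≃ Fin (m + 1)) : ℂ :=
  ∏ a, bracket z e f ω (β (a, true)) (β (a, false))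

/-- The three-term relation. -/
theorem pairProd_exchange (z : ℂ) (e f : Fin (m + 1) → ℂ) (ω : Fin (m + 1) → ℤ)
    (β : Fin h × Bool ≃ Fin (m + 1)) {a b : Fin h} (hab : a ≠ b) :
    pairProd z e f ω β = pairProd z e f ω (exchange β a b true) +
      pairProd z e f ω (exchange β a b false) := by
  rw [pairProd, pairProd, pairProd, prod_exchange_true _ _ hab, prod_exchange_false _ _ hab,
    Fin.prod_univ_two_slots _ hab]
  have : ∀ x y u v : Fin (m + 1), bracket z e f ω x y * bracket z e f ω u v =
      bracket z e f ω x u * bracket z e f ω y v + bracket z e f ω x v * bracket z e f ω u y := by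
    intro x y u v
    simp only [bracket]; ring
  linear_combination (∏ c ∈ (Finset.univ.erase a).erase b,
    bracket z e f ω (β (c, true)) (β (c, false))) *
      this (β (a, true)) (β (a, false)) (β (b, true)) (β (b, false))

theorem Equiv.Perm.bool_cases (φ : Equiv.Perm Bool) : φ = 1 ∨ φ = Equiv.swap true false := by
  revert φ; decide

/-- A permutation of slots that preserves the pairs changes sign and product in the same way. -/
theorem sign_mul_prod_of_preserves (q : Fin (m + 1) → Fin (m + 1) → ℂ)
    (hq : ∀ i j, q j i = -q i j) (β₀ β β' : Fin h × Bool ≃ Fin (m + 1))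
    (hβ : pairSetoid β' = pairSetoid β) :
    ((pairSign β₀ β' : ℤˣ) : ℂ) * ∏ a, q (β' (a, true)) (β' (a, false)) =
      ((pairSign β₀ β : ℤˣ) : ℂ) * ∏ a, q (β (a, true)) (β (a, false)) := by
  obtain ⟨γ, rfl⟩ : ∃ γ : Equiv.Perm (Fin h × Bool), β' = γ.trans β :=
    ⟨β'.trans β.symm, by ext; simp⟩
  have hγ : ∀ x y, (γ x).1 = (γ y).1 ↔ x.1 = y.1 := by
    intro x y
    have := Setoid.ext_iff.1 hβ (β (γ x)) (β (γ y))
    simpa [pairSetoid_iff] using this.symm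
  let π : Equiv.Perm (Fin h) := Equiv.ofBijective (fun a => (γ (a, true)).1)
    (Finite.injective_iff_bijective.1 fun a b hab => (hγ _ _).1 hab)
  let φ : Fin h → Equiv.Perm Bool := fun a => Equiv.ofBijective (fun c => (γ (a, c)).2)
    (Finite.injective_iff_bijective.1 fun c d hcd => by
      have h1 : (γ (a, c)).1 = (γ (a, d)).1 := (hγ _ _).2 rfl
      simpa using γ.injective (Prod.ext h1 hcd))
  -- Such a permutation permutes the pairs and flips some of them. Permuting the pairs acts equally
  -- on both ends, hence is even; each flip changes the sign, and so does the corresponding factor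
  -- `q`.
  have hγ' : γ = (Equiv.prodCongrLeft fun _ : Bool => π) * Equiv.prodCongrRight φ := by
    ext ⟨a, c⟩ : 1
    exact Prod.ext ((hγ (a, c) (a, true)).2 rfl) rfl
  have hsign : Equiv.Perm.sign γ = ∏ a, Equiv.Perm.sign (φ a) := by
    rw [hγ', Equiv.Perm.sign_mul, Equiv.Perm.sign_prodCongrLeft, Equiv.Perm.sign_prodCongrRight]
    simp
  have hval : ∀ a c, γ (a, c) = (π a, φ a c) := fun a c =>
    Prod.ext ((hγ (a, c) (a, true)).2 rfl) rfl
  have hprod : ∏ a, q (β (γ (a, true))) (β (γ (a, false))) =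
      (∏ a, ((Equiv.Perm.sign (φ a) : ℤˣ) : ℂ)) * ∏ a, q (β (a, true)) (β (a, false)) := by
    rw [← Equiv.prod_comp π (fun a => q (β (a, true)) (β (a, false))), ← Finset.prod_mul_distrib]
    refine Finset.prod_congr rfl fun a _ => ?_
    rw [hval, hval]
    rcases (φ a).bool_cases with h1 | h1
    · rw [h1]; simp
    · rw [h1, hq, Equiv.Perm.sign_swap (by decide)]; simp
  rw [pairSign_trans, hsign]
  simp only [Equiv.trans_apply]
  rw [hprod]
  have hsq : ∀ u : ℤˣ, (((u : ℤ) : ℂ)) * ((u : ℤ) : ℂ) = 1 := by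
    intro u
    rcases Int.units_eq_one_or u with rfl | rfl <;> simp
  have hsq' : (∏ a, (((Equiv.Perm.sign (φ a) : ℤˣ) : ℤ) : ℂ)) *
      ∏ a, (((Equiv.Perm.sign (φ a) : ℤˣ) : ℤ) : ℂ) = 1 := by
    rw [← Finset.prod_mul_distrib]
    exact Finset.prod_eq_one fun a _ => hsq _
  push_cast
  linear_combination (((pairSign β₀ β : ℤˣ) : ℤ) : ℂ) *
    (∏ a, q (β (a, true)) (β (a, false))) * hsq'

instance Setoid.finite_of_finite {ι : Type*} [Finite ι] : Finite (Setoid ι) :=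
  Finite.of_injective (fun s : Setoid ι => (s : ι → ι → Prop)) fun s t hst => by
    ext i j; exact iff_of_eq (congrFun (congrFun hst i) j)

end PairingBrackets

/-! ### Reduction to noncrossing pairings -/

section Spanning

variable {m h : ℕ}

/-- The position of `i` on the line covering the circle, shifted by `ω i` turns. -/
def position (ω : Fin (m + 1) → ℤ) (i : Fin (m + 1)) : ℤ := (i : ℕ) + m * ω i

/-- The shifts which put all nodes of the circle in one turn, starting at the mate of the outer
node. -/
noncomputable def windowShift (σ : Setoid (Fin (m + 1))) (i : Fin (m + 1)) : ℤ :=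
  open Classical in if i < σ.mate (Fin.last m) then 1 else 0

/-- The chords of the pairs not containing the outer node do not cross, and do not separate its
mate from the outer boundary. -/
def NonCrossing (σ : Setoid (Fin (m + 1))) : Prop :=
  ∀ i j a b, i ≠ Fin.last m → j ≠ Fin.last m → a ≠ Fin.last m → b ≠ Fin.last m → σ i j → σ a b →
    position (windowShift σ) i < position (windowShift σ) a →
    position (windowShift σ) a < position (windowShift σ) j →
    position (windowShift σ) i < position (windowShift σ) b ∧
      position (windowShift σ) b < position (windowShift σ) j

/-- The noncrossing pairings. -/
abbrev NonCrossingPairing (m : ℕ) : Type :=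
  {σ : Setoid (Fin (m + 1)) // IsPairing σ ∧ NonCrossing σ}

noncomputable instance : Fintype (NonCrossingPairing m) := Fintype.ofFinite _

open Classical in
/-- The signed sum of the products of brackets over the enumerations of a pairing. -/
noncomputable def pairingForm (β₀ : Fin h × Bool ≃ Fin (m + 1)) (σ : Setoid (Fin (m + 1))) (z : ℂ)
    (e f : Fin (m + 1) → ℂ) : ℂ :=
  ∑ β : Fin h × Bool ≃ Fin (m + 1) with pairSetoid β = σ,
    ((pairSign β₀ β : ℤˣ) : ℂ) * pairProd z e f (windowShift σ) β

/-- The functions which are combinations of the forms of noncrossing pairings, with coefficients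
that are continuous and rational at `1`. -/
def IsCombination (β₀ : Fin h × Bool ≃ Fin (m + 1))
    (Ψ : ℂ → (Fin (m + 1) → ℂ) → (Fin (m + 1) → ℂ) → ℂ) : Prop :=
  ∃ c : NonCrossingPairing m → ℂ → ℂ,
    (∀ σ, ContinuousAt (c σ) 1 ∧ ∃ q : ℚ, c σ 1 = q) ∧
    ∀ z, z ≠ 0 → ∀ e f, Ψ z e f = ∑ σ, c σ z * pairingForm β₀ σ z e f

theorem IsCombination.add {β₀ : Fin h × Bool ≃ Fin (m + 1)}
    {Ψ Ψ' : ℂ → (Fin (m + 1) → ℂ) → (Fin (m + 1) → ℂ) → ℂ} (hΨ : IsCombination β₀ Ψ)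
    (hΨ' : IsCombination β₀ Ψ') : IsCombination β₀ fun z e f => Ψ z e f + Ψ' z e f := by
  obtain ⟨c, hc, hs⟩ := hΨ
  obtain ⟨c', hc', hs'⟩ := hΨ'
  refine ⟨fun σ z => c σ z + c' σ z, fun σ => ⟨(hc σ).1.add (hc' σ).1, ?_⟩, fun z hz e f => ?_⟩
  · obtain ⟨q, hq⟩ := (hc σ).2
    obtain ⟨q', hq'⟩ := (hc' σ).2
    exact ⟨q + q', by push_cast; rw [← hq, ← hq']⟩
  · dsimp only
    rw [hs z hz, hs' z hz, ← Finset.sum_add_distrib]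
    exact Finset.sum_congr rfl fun σ _ => by ring

theorem IsCombination.zpow_mul {β₀ : Fin h × Bool ≃ Fin (m + 1)}
    {Ψ Ψ' : ℂ → (Fin (m + 1) → ℂ) → (Fin (m + 1) → ℂ) → ℂ} (hΨ : IsCombination β₀ Ψ) (t : ℤ)
    (h : ∀ z, z ≠ 0 → ∀ e f, Ψ' z e f = z ^ t * Ψ z e f) : IsCombination β₀ Ψ' := by
  obtain ⟨c, hc, hs⟩ := hΨ
  refine ⟨fun σ z => z ^ t * c σ z, fun σ =>
    ⟨(continuousAt_zpow₀ _ _ (Or.inl one_ne_zero)).mul (hc σ).1, ?_⟩, fun z hz e f => ?_⟩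
  · obtain ⟨q, hq⟩ := (hc σ).2
    exact ⟨q, by simp [hq]⟩
  · rw [h z hz, hs z hz, Finset.mul_sum]
    exact Finset.sum_congr rfl fun σ _ => by ring

/-- The cost of a pair of positions. -/
def chordCost (m : ℕ) (x : ℤ) : ℤ := |x| * (4 * m - |x|)

theorem chordCost_nonneg {x : ℤ} (hx : |x| ≤ 2 * m) : 0 ≤ chordCost m x :=
  mul_nonneg (abs_nonneg x) (by linarith)

theorem chordCost_neg (x : ℤ) : chordCost m (-x) = chordCost m x := by
  simp [chordCost]

/-- The function `t * (4 * m - t)` is strictly increasing for `0 ≤ t ≤ 2 * m`; this is why short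
pairs have to stay short throughout the reduction. -/
theorem chordCost_lt {x y : ℤ} (h : |x| < |y|) (hy : |y| ≤ 2 * m) :
    chordCost m x < chordCost m y := by
  unfold chordCost
  have := abs_nonneg x
  nlinarith

/-- The cost is increasing and strictly concave in the length of the chord. Uncrossing into disjoint
chords shortens both lengths; uncrossing into nested chords keeps the sum of the lengths and spreads
them apart. -/
theorem chordCost_cross_aux {x y u v : ℤ} (h1 : x < u) (h2 : u < y) (h3 : y < v) (h4 : v - x < m) :
    chordCost m (x - u) + chordCost m (y - v) < chordCost m (x - y) + chordCost m (u - v) ∧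
    chordCost m (x - v) + chordCost m (y - u) < chordCost m (x - y) + chordCost m (u - v) := by
  unfold chordCost
  rw [abs_of_neg (by linarith : x - u < 0), abs_of_neg (by linarith : y - v < 0),
    abs_of_neg (by linarith : x - y < 0), abs_of_neg (by linarith : u - v < 0),
    abs_of_neg (by linarith : x - v < 0), abs_of_pos (by linarith : 0 < y - u)]
  constructor
  · nlinarith [mul_pos (sub_pos.2 h2) (by linarith : (0 : ℤ) < 4 * m - (v - x))]
  · nlinarith [mul_pos (sub_pos.2 h1) (sub_pos.2 h3)]

theorem chordCost_cross {x y u v : ℤ} (h1 : x < u) (h2 : u < y) (h3 : v < x ∨ y < v)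
    (h4 : v - x < m) (h5 : y - v < m) :
    chordCost m (x - u) + chordCost m (y - v) < chordCost m (x - y) + chordCost m (u - v) ∧
    chordCost m (x - v) + chordCost m (y - u) < chordCost m (x - y) + chordCost m (u - v) := by
  rcases h3 with h3 | h3
  · have := chordCost_cross_aux h3 h1 h2 h5
    rw [← chordCost_neg (v - u), ← chordCost_neg (v - x), ← chordCost_neg (v - y),
      ← chordCost_neg (u - x)] at this
    simp only [neg_sub] at this
    rw [← chordCost_neg (y - u), neg_sub]
    constructor <;> linarith [this.1, this.2]
  · exact chordCost_cross_aux h1 h2 h3 h4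

open Classical in
/-- The cost of a pair; those of the outer node cost nothing. -/
noncomputable def pairCost (ω : Fin (m + 1) → ℤ) (i j : Fin (m + 1)) : ℤ :=
  if i = Fin.last m ∨ j = Fin.last m then 0 else chordCost m (position ω i - position ω j)

/-- The cost of an enumeration of pairs. -/
noncomputable def totalCost (ω : Fin (m + 1) → ℤ) (β : Fin h × Bool ≃ Fin (m + 1)) : ℤ :=
  ∑ a, pairCost ω (β (a, true)) (β (a, false))

/-- All pairs not containing the outer node have length at most two turns. -/
def IsShort (ω : Fin (m + 1) → ℤ) (i j : Fin (m + 1)) : Prop :=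
  i ≠ Fin.last m → j ≠ Fin.last m → |position ω i - position ω j| ≤ 2 * m

theorem pairCost_swap (ω : Fin (m + 1) → ℤ) (i j : Fin (m + 1)) :
    pairCost ω i j = pairCost ω j i := by
  rw [pairCost, pairCost, ← chordCost_neg, neg_sub]
  simp only [or_comm]

theorem IsShort.swap {ω : Fin (m + 1) → ℤ} {i j : Fin (m + 1)} (hs : IsShort ω i j) :
    IsShort ω j i := fun hj hi => by rw [abs_sub_comm]; exact hs hi hj

theorem pairCost_last_right (ω : Fin (m + 1) → ℤ) (i : Fin (m + 1)) :
    pairCost ω i (Fin.last m) = 0 := by simp [pairCost]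

theorem pairCost_of_ne {ω : Fin (m + 1) → ℤ} {i j : Fin (m + 1)} (hi : i ≠ Fin.last m)
    (hj : j ≠ Fin.last m) : pairCost ω i j = chordCost m (position ω i - position ω j) := by
  simp [pairCost, hi, hj]

theorem sum_two_slots (g : Fin h → ℤ) {a b : Fin h}
    (hab : a ≠ b) : ∑ c, g c = g a + (g b + ∑ c ∈ (Finset.univ.erase a).erase b, g c) :=
  Fin.prod_univ_two_slots (M := Multiplicative ℤ) g hab

theorem totalCost_exchange_true (ω : Fin (m + 1) → ℤ) (β : Fin h × Bool ≃ Fin (m + 1)) {a b : Fin h}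
    (hab : a ≠ b) : totalCost ω (exchange β a b true) + (pairCost ω (β (a, true)) (β (a, false)) +
      pairCost ω (β (b, true)) (β (b, false))) = totalCost ω β +
      (pairCost ω (β (a, true)) (β (b, true)) + pairCost ω (β (a, false)) (β (b, false))) := by
  have h1 : totalCost ω (exchange β a b true) = pairCost ω (β (a, true)) (β (b, true)) + (pairCost ω (β (a, false)) (β (b, false)) +
      ∑ c ∈ (Finset.univ.erase a).erase b, pairCost ω (β (c, true)) (β (c, false))) :=
    prod_exchange_true (M := Multiplicative ℤ) (pairCost ω) β hab
  have h2 := sum_two_slots (fun a => pairCost ω (β (a, true)) (β (a, false))) hab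
  change totalCost ω β = _ at h2
  rw [h1, h2]
  ring

theorem totalCost_exchange_false (ω : Fin (m + 1) → ℤ) (β : Fin h × Bool ≃ Fin (m + 1))
    {a b : Fin h} (hab : a ≠ b) :
    totalCost ω (exchange β a b false) + (pairCost ω (β (a, true)) (β (a, false)) +
      pairCost ω (β (b, true)) (β (b, false))) = totalCost ω β +
      (pairCost ω (β (a, true)) (β (b, false)) + pairCost ω (β (b, true)) (β (a, false))) := by
  have h1 : totalCost ω (exchange β a b false) = pairCost ω (β (a, true)) (β (b, false)) + (pairCost ω (β (b, true)) (β (a, false)) +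
      ∑ c ∈ (Finset.univ.erase a).erase b, pairCost ω (β (c, true)) (β (c, false))) :=
    prod_exchange_false (M := Multiplicative ℤ) (pairCost ω) β hab
  have h2 := sum_two_slots (fun a => pairCost ω (β (a, true)) (β (a, false))) hab
  change totalCost ω β = _ at h2
  rw [h1, h2]
  ring

theorem isShort_exchange_true {ω : Fin (m + 1) → ℤ} {β : Fin h × Bool ≃ Fin (m + 1)} {a b : Fin h}
    (hab : a ≠ b) (hs : ∀ c, IsShort ω (β (c, true)) (β (c, false)))
    (h1 : IsShort ω (β (a, true)) (β (b, true))) (h2 : IsShort ω (β (a, false)) (β (b, false)))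
    (c : Fin h) : IsShort ω (exchange β a b true (c, true)) (exchange β a b true (c, false)) := by
  rcases eq_or_ne c a with rfl | ha
  · rwa [exchange_left_true _ hab, exchange_left_false]
  rcases eq_or_ne c b with rfl | hb
  · rwa [exchange_right, show exchange β a c true (c, false) = β (c, false) from
      exchange_right_not β hab true]
  · rw [exchange_of_ne _ _ ha hb, exchange_of_ne _ _ ha hb]
    exact hs c

theorem isShort_exchange_false {ω : Fin (m + 1) → ℤ} {β : Fin h × Bool ≃ Fin (m + 1)} {a b : Fin h}
    (hab : a ≠ b) (hs : ∀ c, IsShort ω (β (c, true)) (β (c, false)))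
    (h1 : IsShort ω (β (a, true)) (β (b, false))) (h2 : IsShort ω (β (b, true)) (β (a, false)))
    (c : Fin h) : IsShort ω (exchange β a b false (c, true)) (exchange β a b false (c, false)) := by
  rcases eq_or_ne c a with rfl | ha
  · rwa [exchange_left_true _ hab, exchange_left_false]
  rcases eq_or_ne c b with rfl | hb
  · rwa [exchange_right, show exchange β a c false (c, true) = β (c, true) from
      exchange_right_not β hab false]
  · rw [exchange_of_ne _ _ ha hb, exchange_of_ne _ _ ha hb]
    exact hs c

/-- Induction step: an exchange in which the four new pairs are short and cheaper. -/
theorem isCombination_of_exchange {β₀ : Fin h × Bool ≃ Fin (m + 1)} {ω : Fin (m + 1) → ℤ}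
    {β : Fin h × Bool ≃ Fin (m + 1)} {N : ℕ}
    (ih : ∀ β : Fin h × Bool ≃ Fin (m + 1), (∀ c, IsShort ω (β (c, true)) (β (c, false))) →
      totalCost ω β < N → IsCombination β₀ fun z e f => pairProd z e f ω β) {a b : Fin h}
    (hab : a ≠ b) (hs : ∀ c, IsShort ω (β (c, true)) (β (c, false)))
    (hN : totalCost ω β < N + 1)
    (h1 : ∀ c, IsShort ω (β (a, true)) (β (b, c)) ∧ IsShort ω (β (a, false)) (β (b, !c)))
    (h2 : ∀ c, pairCost ω (β (a, true)) (β (b, c)) + pairCost ω (β (a, false)) (β (b, !c)) <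
      pairCost ω (β (a, true)) (β (a, false)) + pairCost ω (β (b, true)) (β (b, false))) :
    IsCombination β₀ fun z e f => pairProd z e f ω β := by
  have h3 := totalCost_exchange_true ω β hab
  have h4 := totalCost_exchange_false ω β hab
  have h5 := h2 true
  have h6 := h2 false
  simp only [Bool.not_true, Bool.not_false] at h5 h6
  rw [pairCost_swap ω (β (b, true)) (β (a, false))] at h4
  have e1 := ih (exchange β a b true) (isShort_exchange_true hab hs (h1 true).1 (h1 true).2)
    (by linarith)
  have e2 := ih (exchange β a b false) (isShort_exchange_false hab hs (h1 false).1
    (h1 false).2.swap) (by linarith)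
  convert e1.add e2 using 1
  funext z e f
  exact pairProd_exchange z e f ω β hab

theorem pairSign_mul_self (β₀ β : Fin h × Bool ≃ Fin (m + 1)) :
    ((pairSign β₀ β : ℤˣ) : ℂ) * ((pairSign β₀ β : ℤˣ) : ℂ) = 1 := by
  rcases Int.units_eq_one_or (pairSign β₀ β) with h | h <;> simp [h]

open Classical in
theorem pairingForm_eq (β₀ β : Fin h × Bool ≃ Fin (m + 1)) (z : ℂ) (e f : Fin (m + 1) → ℂ) :
    pairingForm β₀ (pairSetoid β) z e f =
      (Finset.univ.filter fun β' : Fin h × Bool ≃ Fin (m + 1) => pairSetoid β' = pairSetoid β).card *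
        (((pairSign β₀ β : ℤˣ) : ℂ) * pairProd z e f (windowShift (pairSetoid β)) β) := by
  rw [pairingForm, ← nsmul_eq_mul, ← Finset.sum_const]
  refine Finset.sum_congr rfl fun β' hβ' => ?_
  exact sign_mul_prod_of_preserves _ (bracket_swap z e f _) β₀ β β' (Finset.mem_filter.1 hβ').2

/-- All enumerations of one pairing contribute the same term to its form, so dividing by their
number isolates a single product, up to sign. -/
theorem isCombination_of_nonCrossing (β₀ β : Fin h × Bool ≃ Fin (m + 1))
    (hβ : NonCrossing (pairSetoid β)) :
    IsCombination β₀ fun z e f => pairProd z e f (windowShift (pairSetoid β)) β := by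
  classical
  let σ : NonCrossingPairing m := ⟨pairSetoid β, isPairing_pairSetoid β, hβ⟩
  set n := (Finset.univ.filter fun β' : Fin h × Bool ≃ Fin (m + 1) =>
    pairSetoid β' = pairSetoid β).card with hn
  have hn0 : (n : ℂ) ≠ 0 := by
    rw [Nat.cast_ne_zero, hn, ← Nat.pos_iff_ne_zero, Finset.card_pos]
    exact ⟨β, by simp⟩
  refine ⟨fun σ' _ => if σ' = σ then ((pairSign β₀ β : ℤˣ) : ℂ) * (n : ℂ)⁻¹ else 0,
    fun σ' => ⟨continuousAt_const, if σ' = σ then ((pairSign β₀ β : ℤˣ) : ℚ) * (n : ℚ)⁻¹ else 0, ?_⟩,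
    fun z _ e f => ?_⟩
  · dsimp only
    split_ifs <;> simp
  · simp only [ite_mul, zero_mul, Finset.sum_ite_eq', Finset.mem_univ, if_true]
    rw [show (σ : Setoid (Fin (m + 1))) = pairSetoid β from rfl, pairingForm_eq, ← hn]
    have := pairSign_mul_self β₀ β
    field_simp
    linear_combination -(pairProd z e f (windowShift (pairSetoid β)) β) * this

/-- Turning both vectors equally is the action of a diagonal matrix of determinant `1`. -/
theorem bracket_congr {z : ℂ} (hz : z ≠ 0) (e f : Fin (m + 1) → ℂ) {ω ω' : Fin (m + 1) → ℤ}
    {i j : Fin (m + 1)} (hi : i ≠ Fin.last m) (hj : j ≠ Fin.last m)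
    (hω : ω i - ω j = ω' i - ω' j) : bracket z e f ω i j = bracket z e f ω' i j := by
  have h1 : ∀ x y : ℤ, z ^ x * z ^ (-y) = z ^ (x - y) := fun x y => by
    rw [← zpow_add₀ hz, sub_eq_add_neg]
  have h2 : ω j - ω i = ω' j - ω' i := by linarith
  have h3 : z ^ ω i * z ^ (-ω j) = z ^ ω' i * z ^ (-ω' j) := by rw [h1, h1, hω]
  have h4 : z ^ ω j * z ^ (-ω i) = z ^ ω' j * z ^ (-ω' i) := by rw [h1, h1, h2]
  simp only [bracket, hi, hj, if_false]
  linear_combination e i * f j * h3 - e j * f i * h4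

/-- The outer vector is `(0, 1)` for every `ω`, so a turn of its partner costs a power of `z`. -/
theorem bracket_last {z : ℂ} (hz : z ≠ 0) (e f : Fin (m + 1) → ℂ) (ω ω' : Fin (m + 1) → ℤ)
    {k : Fin (m + 1)} (hk : k ≠ Fin.last m) :
    bracket z e f ω k (Fin.last m) = z ^ (ω k - ω' k) * bracket z e f ω' k (Fin.last m) := by
  have h1 : z ^ ω k = z ^ (ω k - ω' k) * z ^ ω' k := by
    rw [← zpow_add₀ hz, sub_add_cancel]
  simp only [bracket, hk, if_false, if_true]
  rw [h1]
  ring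

/-- Only the relative shifts of the pairs and the shift of the mate of the outer node matter. -/
theorem pairProd_congr {z : ℂ} (hz : z ≠ 0) (e f : Fin (m + 1) → ℂ) {ω ω' : Fin (m + 1) → ℤ}
    {β : Fin h × Bool ≃ Fin (m + 1)}
    (hω : ∀ a, β (a, true) ≠ Fin.last m → β (a, false) ≠ Fin.last m →
      ω (β (a, true)) - ω (β (a, false)) = ω' (β (a, true)) - ω' (β (a, false)))
    {b : Fin h} {c : Bool} (hb : β (b, c) = Fin.last m) :
    pairProd z e f ω β = z ^ (ω (β (b, !c)) - ω' (β (b, !c))) * pairProd z e f ω' β := by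
  have hne : ∀ a, a ≠ b → ∀ d, β (a, d) ≠ Fin.last m := fun a ha d h => ha
    (congrArg Prod.fst (β.injective (h.trans hb.symm)))
  have hk : β (b, !c) ≠ Fin.last m := fun h => by
    simpa using congrArg Prod.snd (β.injective (h.trans hb.symm))
  have : ∀ a, bracket z e f ω (β (a, true)) (β (a, false)) =
      (if a = b then z ^ (ω (β (b, !c)) - ω' (β (b, !c))) else 1) *
        bracket z e f ω' (β (a, true)) (β (a, false)) := by
    intro a
    split_ifs with hab
    · subst hab
      have := bracket_last hz e f ω ω' hk
      rw [← hb] at this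
      cases c
      · exact this
      · rw [bracket_swap, bracket_swap z e f ω']
        simp only [Bool.not_true] at this ⊢
        linear_combination -this
    · rw [one_mul, bracket_congr hz e f (hne a hab _) (hne a hab _)
        (hω a (hne a hab _) (hne a hab _))]
  rw [pairProd, Finset.prod_congr rfl fun a _ => this a, Finset.prod_mul_distrib]
  simp [pairProd]

theorem position_sub_congr {ω ω' : Fin (m + 1) → ℤ} {i j : Fin (m + 1)}
    (hω : ω i - ω j = ω' i - ω' j) :
    position ω i - position ω j = position ω' i - position ω' j := by
  unfold position
  linear_combination (m : ℤ) * hω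

theorem totalCost_congr {ω ω' : Fin (m + 1) → ℤ} {β : Fin h × Bool ≃ Fin (m + 1)}
    (hω : ∀ a, β (a, true) ≠ Fin.last m → β (a, false) ≠ Fin.last m →
      ω (β (a, true)) - ω (β (a, false)) = ω' (β (a, true)) - ω' (β (a, false))) :
    totalCost ω β = totalCost ω' β := by
  refine Finset.sum_congr rfl fun a _ => ?_
  unfold pairCost
  split_ifs with h
  · rfl
  · push Not at h
    rw [position_sub_congr (hω a h.1 h.2)]

theorem totalCost_nonneg {ω : Fin (m + 1) → ℤ} {β : Fin h × Bool ≃ Fin (m + 1)}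
    (hs : ∀ c, IsShort ω (β (c, true)) (β (c, false))) : 0 ≤ totalCost ω β := by
  refine Finset.sum_nonneg fun a _ => ?_
  unfold pairCost
  split_ifs with h
  · exact le_rfl
  · push Not at h
    exact chordCost_nonneg (hs a h.1 h.2)

theorem position_window {σ : Setoid (Fin (m + 1))} {i : Fin (m + 1)} (hi : i ≠ Fin.last m)
    (hk : σ.mate (Fin.last m) ≠ Fin.last m) :
    ((σ.mate (Fin.last m) : ℕ) : ℤ) ≤ position (windowShift σ) i ∧
      position (windowShift σ) i < (σ.mate (Fin.last m) : ℕ) + m ∧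
      (i ≠ σ.mate (Fin.last m) →
        ((σ.mate (Fin.last m) : ℕ) : ℤ) < position (windowShift σ) i) := by
  unfold position windowShift
  simp only [Fin.lt_def, ne_eq, Fin.ext_iff, Fin.val_last] at *
  split_ifs <;> omega

theorem position_window_inj {σ : Setoid (Fin (m + 1))} {i j : Fin (m + 1)} (hi : i ≠ Fin.last m)
    (hj : j ≠ Fin.last m) (h : position (windowShift σ) i = position (windowShift σ) j) : i = j := by
  unfold position windowShift at h
  simp only [Fin.lt_def, ne_eq, Fin.ext_iff, Fin.val_last] at *
  split_ifs at h <;> omega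

theorem pairSetoid_eq_not {β : Fin h × Bool ≃ Fin (m + 1)} {a : Fin h} {c : Bool} {j : Fin (m + 1)}
    (hj : j ≠ β (a, c)) (h : pairSetoid β (β (a, c)) j) : j = β (a, !c) := by
  rw [← mate_pairSetoid]
  exact (isPairing_pairSetoid β).eq_mate hj h

/-- Products of brackets of short pairs are combinations of the forms of noncrossing pairings. -/
theorem isCombination_pairProd (β₀ : Fin h × Bool ≃ Fin (m + 1)) (ω : Fin (m + 1) → ℤ)
    (β : Fin h × Bool ≃ Fin (m + 1)) (hs : ∀ c, IsShort ω (β (c, true)) (β (c, false))) :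
    IsCombination β₀ fun z e f => pairProd z e f ω β := by
  -- Induction on the cost, a nonnegative integer as long as the pairs are short.
  obtain ⟨N, hN⟩ : ∃ N : ℕ, totalCost ω β < N :=
    ⟨(totalCost ω β + 1).toNat, by have := totalCost_nonneg hs; omega⟩
  induction N generalizing ω β with
  | zero =>
    have := totalCost_nonneg hs
    simp only [Nat.cast_zero] at hN
    omega
  | succ N ih =>
    obtain ⟨⟨b, c⟩, hb⟩ := β.surjective (Fin.last m)
    have hne : ∀ a, a ≠ b → ∀ d, β (a, d) ≠ Fin.last m := fun a ha d h => ha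
      (congrArg Prod.fst (β.injective (h.trans hb.symm)))
    have hk : (pairSetoid β).mate (Fin.last m) = β (b, !c) := by rw [← hb, mate_pairSetoid]
    have hk' : β (b, !c) ≠ Fin.last m := fun h => by
      simpa using congrArg Prod.snd (β.injective (h.trans hb.symm))
    have hwin := fun i (hi : i ≠ Fin.last m) => position_window (σ := pairSetoid β) hi (hk ▸ hk')
    rw [hk] at hwin
    push_cast at hN
    -- Either each chord between inner nodes has its ends in one common turn of the window that
    -- starts at the mate of the outer node, or some chord passes over a lift of that mate.
    by_cases hw : ∀ a, β (a, true) ≠ Fin.last m → β (a, false) ≠ Fin.last m →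
        ω (β (a, true)) - ω (β (a, false)) =
          windowShift (pairSetoid β) (β (a, true)) - windowShift (pairSetoid β) (β (a, false))
    · suffices IsCombination β₀ fun z e f => pairProd z e f (windowShift (pairSetoid β)) β from
        this.zpow_mul _ fun z hz e f => pairProd_congr hz e f hw hb
      by_cases hnc : NonCrossing (pairSetoid β)
      · exact isCombination_of_nonCrossing β₀ β hnc
      have hshort : ∀ i j, IsShort (windowShift (pairSetoid β)) i j := fun i j hi hj => by
        have := hwin i hi
        have := hwin j hj
        rw [abs_le]
        constructor <;> linarith [this.1, this.2.1]
      rw [totalCost_congr hw] at hN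
      unfold NonCrossing at hnc
      push Not at hnc
      obtain ⟨i, j, p, q, hi, hj, hp, hq, hij, hpq, h1, h2, h3⟩ := hnc
      -- `q` is neither `i` nor `j`, since these belong to another pair than `p`; so the chords
      -- properly cross.
      have h4 : position (windowShift (pairSetoid β)) q < position (windowShift (pairSetoid β)) i ∨
          position (windowShift (pairSetoid β)) j < position (windowShift (pairSetoid β)) q := by
        by_contra! h4
        have h5 : j = q := position_window_inj hj hq (le_antisymm (h3 ?_) h4.2)
        · subst h5
          have : i = p := by
            rw [(isPairing_pairSetoid β).eq_mate (fun h => by subst h; exact lt_asymm h1 h2)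
              ((pairSetoid β).symm hij)]
            exact ((isPairing_pairSetoid β).eq_mate (fun h => by subst h; exact lt_irrefl _ h2)
              ((pairSetoid β).symm hpq)).symm
          subst this
          exact lt_irrefl _ h1
        · refine lt_of_le_of_ne h4.1 fun h5 => ?_
          have := position_window_inj hi hq h5
          subst this
          have : j = p := by
            rw [(isPairing_pairSetoid β).eq_mate (fun h => by subst h; exact lt_asymm h1 h2) hij]
            exact ((isPairing_pairSetoid β).eq_mate (fun h => by subst h; exact lt_irrefl _ h1)
              ((pairSetoid β).symm hpq)).symm
          subst this
          exact lt_irrefl _ h2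
      have h5 := chordCost_cross (m := m) h1 h2 h4 (by linarith [hwin i hi, hwin q hq])
        (by linarith [hwin j hj, hwin q hq])
      rw [← pairCost_of_ne hi hp, ← pairCost_of_ne hj hq, ← pairCost_of_ne hi hj,
        ← pairCost_of_ne hp hq, ← pairCost_of_ne hi hq, ← pairCost_of_ne hj hp] at h5
      obtain ⟨⟨A, ca⟩, rfl⟩ := β.surjective i
      obtain ⟨⟨B, cb⟩, rfl⟩ := β.surjective p
      obtain rfl := pairSetoid_eq_not (fun h => by rw [h] at h2; exact lt_asymm h1 h2) hij
      have hAB : A ≠ B := by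
        rintro rfl
        obtain h | h := Bool.eq_or_eq_not cb ca
        · subst h; exact lt_irrefl _ h1
        · subst h; exact lt_irrefl _ h2
      obtain rfl := pairSetoid_eq_not (fun h => by
        rw [h] at h4; exact h4.elim (lt_asymm h1) (lt_asymm h2)) hpq
      refine isCombination_of_exchange (fun β' hβ' hc' => ih _ β' hβ' hc') hAB
        (fun _ => hshort _ _) hN (fun _ => ⟨hshort _ _, hshort _ _⟩) fun d => ?_
      have e1 := pairCost_swap (windowShift (pairSetoid β)) (β (A, true)) (β (A, false))
      have e2 := pairCost_swap (windowShift (pairSetoid β)) (β (B, true)) (β (B, false))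
      cases ca <;> cases cb <;> cases d <;> simp only [Bool.not_true, Bool.not_false] at h5 ⊢ <;>
        linarith [h5.1, h5.2]
    · push Not at hw
      obtain ⟨a, hx, hy, hxy⟩ := hw
      have hab : a ≠ b := by
        rintro rfl
        cases c
        · exact hy hb
        · exact hx hb
      set σ := pairSetoid β with hσ
      have hp : ∀ i, position ω i = position (windowShift σ) i + m * (ω i - windowShift σ i) :=
        fun i => by unfold position; ring
      obtain ⟨x1, x2, x3⟩ := hwin _ hx
      obtain ⟨y1, y2, y3⟩ := hwin _ hy
      have hne' : ∀ d, β (a, d) ≠ β (b, !c) := fun d h =>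
        hab (congrArg Prod.fst (β.injective h))
      have x3 := x3 (hne' _)
      have y3 := y3 (hne' _)
      -- A lift of the mate strictly between the two ends of the chord: the start of the turn of the
      -- window that contains the right end.
      obtain ⟨s, hs1, hs2⟩ : ∃ s : ℤ,
          |position ω (β (a, true)) - ((β (b, !c) : ℕ) + m * s)| <
            |position ω (β (a, true)) - position ω (β (a, false))| ∧
          |position ω (β (a, false)) - ((β (b, !c) : ℕ) + m * s)| <
            |position ω (β (a, true)) - position ω (β (a, false))| := by
        rw [hp (β (a, true)), hp (β (a, false))]
        set p := ω (β (a, true)) - windowShift σ (β (a, true)) with hpd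
        set q := ω (β (a, false)) - windowShift σ (β (a, false)) with hqd
        have hpq : p ≠ q := fun h => hxy (by linarith)
        have hm0 : (0 : ℤ) ≤ m := Int.natCast_nonneg m
        rcases lt_or_gt_of_ne hpq with h | h
        · refine ⟨q, ?_⟩
          have : (m : ℤ) * (p + 1) ≤ m * q := mul_le_mul_of_nonneg_left h hm0
          rw [abs_of_neg, abs_of_neg, abs_of_pos] <;> first | linarith | (constructor <;> linarith)
        · refine ⟨p, ?_⟩
          have : (m : ℤ) * (q + 1) ≤ m * p := mul_le_mul_of_nonneg_left h hm0
          rw [abs_of_pos, abs_of_pos, abs_of_neg] <;> first | linarith | (constructor <;> linarith)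
      -- Moving the mate to that lift only costs a power of `z`. Either exchange with the pair of
      -- the outer node then replaces the chord by a shorter one that ends at the mate, and a pair
      -- with the outer node, which is free.
      set ω' := Function.update ω (β (b, !c)) s with hω'
      have hω : ∀ i, i ≠ β (b, !c) → ω' i = ω i := fun i hi => Function.update_of_ne hi _ _
      have hωk : ω' (β (b, !c)) = s := Function.update_self _ _ _
      have hwω : ∀ a, β (a, true) ≠ Fin.last m → β (a, false) ≠ Fin.last m →
          ω (β (a, true)) - ω (β (a, false)) = ω' (β (a, true)) - ω' (β (a, false)) := by
        intro a' h1 h2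
        have : a' ≠ b := by
          rintro rfl
          cases c
          · exact h2 hb
          · exact h1 hb
        rw [hω _ fun h => this (congrArg Prod.fst (β.injective h)),
          hω _ fun h => this (congrArg Prod.fst (β.injective h))]
      have hpk : position ω' (β (b, !c)) = (β (b, !c) : ℕ) + m * s := by rw [position, hωk]
      have hpa : ∀ d, position ω' (β (a, d)) = position ω (β (a, d)) := fun d => by
        rw [position, position, hω _ (hne' d)]
      suffices IsCombination β₀ fun z e f => pairProd z e f ω' β from
        this.zpow_mul _ fun z hz e f => pairProd_congr hz e f hwω hb
      have hsa := hs a hx hy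
      have hs' : ∀ a, IsShort ω' (β (a, true)) (β (a, false)) := fun a h1 h2 => by
        rw [← position_sub_congr (hwω a h1 h2)]
        exact hs a h1 h2
      rw [totalCost_congr hwω] at hN
      rw [← hpk, ← hpa, ← hpa] at hs1 hs2
      rw [← hpa, ← hpa] at hsa
      have hshort : ∀ d, IsShort ω' (β (a, d)) (β (b, !c)) := fun d _ _ => by
        cases d <;> linarith
      have hlast : ∀ i, IsShort ω' i (β (b, c)) := fun i _ h => absurd hb h
      have hcost : ∀ d, pairCost ω' (β (a, d)) (β (b, !c)) <
          pairCost ω' (β (a, true)) (β (a, false)) := fun d => by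
        rw [pairCost_of_ne (hne a hab d) hk', pairCost_of_ne hx hy]
        cases d
        · exact chordCost_lt hs2 hsa
        · exact chordCost_lt hs1 hsa
      have hcost0 : ∀ i, pairCost ω' i (β (b, c)) = 0 := fun i => by
        rw [hb, pairCost_last_right]
      have hcost1 : pairCost ω' (β (b, true)) (β (b, false)) = 0 := by
        cases c
        · exact hcost0 _
        · rw [pairCost_swap]; exact hcost0 _
      refine isCombination_of_exchange (fun β' hβ' hc' => ih _ β' hβ' hc') hab hs' hN
        (fun d => ?_) fun d => ?_
      · obtain rfl | rfl := Bool.eq_or_eq_not d c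
        · exact ⟨hlast _, hshort _⟩
        · rw [Bool.not_not]
          exact ⟨hshort _, hlast _⟩
      · rw [hcost1, add_zero]
        obtain rfl | rfl := Bool.eq_or_eq_not d c
        · rw [hcost0, zero_add]
          exact hcost _
        · rw [Bool.not_not, hcost0, add_zero]
          exact hcost _

end Spanning

/-! ### A noncrossing pairing is determined by its first nodes -/

section Independence

variable {m h : ℕ}

/-- A noncrossing involution of the line is determined by the points that it does not move to the
left. -/
theorem Int.involution_unique {τ τ' : ℤ → ℤ} (hτ : ∀ x, τ (τ x) = x) (hτ' : ∀ x, τ' (τ' x) = x)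
    (h : ∀ x u, x < u → u < τ x → x < τ u ∧ τ u < τ x ∧ τ u ≠ u)
    (h' : ∀ x u, x < u → u < τ' x → x < τ' u ∧ τ' u < τ' x ∧ τ' u ≠ u)
    (hR : ∀ x, x ≤ τ x ↔ x ≤ τ' x) : τ = τ' := by
  -- Induction on the length of a chord of `τ`: strictly inside it, the two involutions already
  -- agree.
  have key : ∀ n : ℕ, ∀ x, x < τ x → τ x - x < n → τ' x = τ x := by
    intro n
    induction n with
    | zero => intro x hx hn; simp only [Nat.cast_zero] at hn; omega
    | succ n ih =>
      intro x hx hn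
      push_cast at hn
      have hin : ∀ u, x < u → u < τ x → τ' u = τ u := by
        intro u hu1 hu2
        obtain ⟨g1, g2, g3⟩ := h x u hu1 hu2
        rcases lt_or_gt_of_ne g3 with g | g
        · have := ih (τ u) (by rwa [hτ]) (by rw [hτ]; omega)
          rw [hτ] at this
          rw [← this, hτ', this]
        · exact ih u g (by omega)
      have hy : τ' (τ x) < τ x := by
        have := hR (τ x)
        rw [hτ] at this
        omega
      -- `τ'` moves the right end to the left. If it did not land at `x`, `τ'` would join an end of
      -- the chord to a point strictly inside, where `τ'` agrees with `τ` and `τ` maps the inside to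
      -- itself.
      rcases lt_trichotomy (τ' (τ x)) x with hlt | heq | hgt
      · obtain ⟨g1, g2, g3⟩ := h' (τ' (τ x)) x hlt (by rwa [hτ'])
        rw [hτ'] at g2
        have g4 := (hR x).1 hx.le
        have g5 := hin (τ' x) (by omega) g2
        rw [hτ'] at g5
        have := (h x (τ' x) (by omega) g2).1
        omega
      · rw [← heq, hτ', heq]
      · have g := hin _ hgt hy
        rw [hτ'] at g
        have := (h x _ hgt hy).2.1
        omega
  have key' : ∀ x, x < τ x → τ' x = τ x := fun x hx => key (τ x - x + 1).toNat x hx (by omega)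
  have key'' : ∀ x, τ x < x → τ' x = τ x := fun x hx => by
    have := key' (τ x) (by rwa [hτ])
    rw [hτ] at this
    rw [← this, hτ', this]
  funext x
  rcases lt_trichotomy (τ x) x with hx | hx | hx
  · exact (key'' x hx).symm
  · have h1 := (hR x).1 hx.ge
    by_contra hne
    have h2 : τ' (τ' x) < τ' x := by rw [hτ']; omega
    have h3 : τ (τ' x) < τ' x := by
      have := hR (τ' x)
      omega
    have h4 := key'' _ h3
    rw [hτ'] at h4
    have h5 := hτ (τ' x)
    rw [← h4] at h5
    omega
  · exact (key' x hx).symm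

theorem IsPairing.mate_mate {ι : Type*} {σ : Setoid ι} (hσ : IsPairing σ) (i : ι) :
    σ.mate (σ.mate i) = i :=
  (hσ.eq_mate (hσ.mate_ne i).symm (σ.symm (hσ.rel_mate i))).symm

theorem IsPairing.ext_mate {ι : Type*} {σ σ' : Setoid ι} (hσ : IsPairing σ) (hσ' : IsPairing σ')
    (h : ∀ i, σ.mate i = σ'.mate i) : σ = σ' := by
  ext i j
  have : ∀ {σ : Setoid ι} (_ : IsPairing σ), σ i j ↔ i = j ∨ j = σ.mate i := by
    intro σ hσ
    refine ⟨fun hij => ?_, ?_⟩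
    · by_cases hij' : i = j
      · exact Or.inl hij'
      · exact Or.inr (hσ.eq_mate (Ne.symm hij') hij)
    · rintro (rfl | rfl)
      · exact σ.refl _
      · exact hσ.rel_mate i
  rw [this hσ, this hσ', h]

/-- The rank of a node: its position in the window, and the outer node last. -/
noncomputable def rank (σ : Setoid (Fin (m + 1))) (i : Fin (m + 1)) : ℤ :=
  open Classical in if i = Fin.last m then 2 * m else position (windowShift σ) i

theorem rank_of_ne {σ : Setoid (Fin (m + 1))} {i : Fin (m + 1)} (hi : i ≠ Fin.last m) :
    rank σ i = position (windowShift σ) i := if_neg hi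

theorem rank_lt_last {σ : Setoid (Fin (m + 1))} {i : Fin (m + 1)} (hi : i ≠ Fin.last m) :
    rank σ i < 2 * m := by
  rw [rank_of_ne hi]
  unfold position windowShift
  simp only [Fin.lt_def, ne_eq, Fin.ext_iff, Fin.val_last] at *
  split_ifs <;> omega

theorem rank_injective (σ : Setoid (Fin (m + 1))) : Function.Injective (rank σ) := by
  intro i j hij
  by_cases hi : i = Fin.last m <;> by_cases hj : j = Fin.last m
  · rw [hi, hj]
  · rw [hi, rank, if_pos rfl] at hij
    exact absurd hij (rank_lt_last hj).ne'
  · rw [hj, rank.eq_def σ (Fin.last m), if_pos rfl] at hij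
    exact absurd hij (rank_lt_last hi).ne
  · rw [rank_of_ne hi, rank_of_ne hj] at hij
    exact position_window_inj hi hj hij

open Classical in
/-- The other end of a chord; the mate of the outer node is left in place. -/
noncomputable def innerMate (σ : Setoid (Fin (m + 1))) (i : Fin (m + 1)) : Fin (m + 1) :=
  if σ.mate i = Fin.last m then i else σ.mate i

theorem innerMate_ne_last {σ : Setoid (Fin (m + 1))} {i : Fin (m + 1)} (hi : i ≠ Fin.last m) :
    innerMate σ i ≠ Fin.last m := by
  unfold innerMate
  split_ifs with h
  · exact hi
  · exact h

theorem innerMate_innerMate {σ : Setoid (Fin (m + 1))} (hσ : IsPairing σ) {i : Fin (m + 1)}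
    (hi : i ≠ Fin.last m) : innerMate σ (innerMate σ i) = i := by
  by_cases h : σ.mate i = Fin.last m
  · have : innerMate σ i = i := if_pos h
    rw [this, this]
  · have : innerMate σ i = σ.mate i := if_neg h
    rw [this, innerMate, hσ.mate_mate, if_neg hi]

/-- The residue of an integer, as a node of the circle. -/
def residue (hm : 0 < m) (x : ℤ) : Fin (m + 1) :=
  ⟨(x % m).toNat, by have := Int.emod_lt_of_pos x (Int.natCast_pos.2 hm); omega⟩

theorem residue_ne_last (hm : 0 < m) (x : ℤ) : residue hm x ≠ Fin.last m := by
  have h1 := Int.emod_lt_of_pos x (Int.natCast_pos.2 hm)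
  have h2 := Int.emod_nonneg x (Int.natCast_pos.2 hm).ne'
  simp only [residue, ne_eq, Fin.ext_iff, Fin.val_last]
  omega

theorem residue_position (hm : 0 < m) (ω : Fin (m + 1) → ℤ) (t : ℤ) {i : Fin (m + 1)}
    (hi : i ≠ Fin.last m) : residue hm (position ω i + m * t) = i := by
  have h1 : ((i : ℕ) : ℤ) < m := by
    simp only [ne_eq, Fin.ext_iff, Fin.val_last] at hi
    omega
  have h2 : (position ω i + m * t) % m = (i : ℕ) := by
    rw [position, add_assoc, ← mul_add, Int.add_mul_emod_self_left,
      Int.emod_eq_of_lt (by positivity) h1]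
  apply Fin.ext
  simp only [residue, h2]
  omega

theorem exists_position (hm : 0 < m) (ω : Fin (m + 1) → ℤ) (x : ℤ) :
    ∃ t, x = position ω (residue hm x) + m * t := by
  have h2 := Int.emod_nonneg x (Int.natCast_pos.2 hm).ne'
  refine ⟨x / m - ω (residue hm x), ?_⟩
  have h3 : ((residue hm x : ℕ) : ℤ) = x % m := by
    simp only [residue]; omega
  rw [position, h3, mul_sub]
  have := Int.emod_add_mul_ediv x m
  linarith

/-- The involution of the line which exchanges the ends of the lifts of the chords. -/
noncomputable def lineMate (hm : 0 < m) (σ : Setoid (Fin (m + 1))) (x : ℤ) : ℤ :=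
  x - position (windowShift σ) (residue hm x) +
    position (windowShift σ) (innerMate σ (residue hm x))

theorem lineMate_position (hm : 0 < m) (σ : Setoid (Fin (m + 1))) {i : Fin (m + 1)}
    (hi : i ≠ Fin.last m) (t : ℤ) : lineMate hm σ (position (windowShift σ) i + m * t) =
      position (windowShift σ) (innerMate σ i) + m * t := by
  rw [lineMate, residue_position hm _ _ hi]
  ring

theorem lineMate_lineMate (hm : 0 < m) {σ : Setoid (Fin (m + 1))} (hσ : IsPairing σ) (x : ℤ) :
    lineMate hm σ (lineMate hm σ x) = x := by
  obtain ⟨t, ht⟩ := exists_position hm (windowShift σ) x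
  rw [ht, lineMate_position hm σ (residue_ne_last hm x),
    lineMate_position hm σ (innerMate_ne_last (residue_ne_last hm x)),
    innerMate_innerMate hσ (residue_ne_last hm x)]

/-- Ranking the outer node last makes its mate the first of its pair, in accordance with the weak
inequality at the fixed points. -/
theorem le_lineMate_iff (hm : 0 < m) {σ : Setoid (Fin (m + 1))} (hσ : IsPairing σ) (x : ℤ) :
    x ≤ lineMate hm σ x ↔ rank σ (residue hm x) < rank σ (σ.mate (residue hm x)) := by
  have hi := residue_ne_last hm x
  set i := residue hm x with hid
  have : x ≤ lineMate hm σ x ↔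
      position (windowShift σ) i ≤ position (windowShift σ) (innerMate σ i) := by
    unfold lineMate
    rw [← hid]
    constructor <;> intro <;> linarith
  rw [this, innerMate]
  split_ifs with h
  · rw [h]
    simpa [rank.eq_def σ (Fin.last m)] using rank_lt_last hi
  · rw [← rank_of_ne hi, ← rank_of_ne h]
    exact ⟨fun h' => lt_of_le_of_ne h' fun h'' => hσ.mate_ne i (rank_injective σ h'').symm, le_of_lt⟩

/-- A chord lies in one turn of the window, so a point under it lies in the same turn, and
`NonCrossing` applies. The fixed points are the lifts of the mate of the outer node; they start the
turns, so no chord passes over them. -/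
theorem lineMate_nonCrossing (hm : 0 < m) {σ : Setoid (Fin (m + 1))} (hσ : IsPairing σ)
    (hnc : NonCrossing σ) (x u : ℤ) (hxu : x < u) (hu : u < lineMate hm σ x) :
    x < lineMate hm σ u ∧ lineMate hm σ u < lineMate hm σ x ∧ lineMate hm σ u ≠ u := by
  obtain ⟨t, ht⟩ := exists_position hm (windowShift σ) x
  obtain ⟨t', ht'⟩ := exists_position hm (windowShift σ) u
  have hi := residue_ne_last hm x
  have ha := residue_ne_last hm u
  generalize residue hm x = i at ht hi
  generalize residue hm u = a at ht' ha
  subst ht ht'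
  have hk := hσ.mate_ne (Fin.last m)
  have hj := innerMate_ne_last (σ := σ) hi
  rw [lineMate_position hm σ hi] at hu ⊢
  rw [lineMate_position hm σ ha]
  obtain ⟨i1, i2, i3⟩ := position_window hi hk
  obtain ⟨a1, a2, a3⟩ := position_window ha hk
  obtain ⟨j1, j2, j3⟩ := position_window hj hk
  obtain rfl : t' = t := by
    have hm' : (0 : ℤ) ≤ m := Int.natCast_nonneg m
    rcases lt_trichotomy t' t with h | h | h
    · have : (m : ℤ) * (t' + 1) ≤ m * t := mul_le_mul_of_nonneg_left h hm'
      linarith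
    · exact h
    · have : (m : ℤ) * (t + 1) ≤ m * t' := mul_le_mul_of_nonneg_left h hm'
      linarith
  have hia : position (windowShift σ) i < position (windowShift σ) a := by linarith
  have haj : position (windowShift σ) a < position (windowShift σ) (innerMate σ i) := by linarith
  have hmi : innerMate σ i = σ.mate i := by
    rw [innerMate, if_neg]
    intro h
    rw [innerMate, if_pos h] at haj
    exact lt_asymm hia haj
  have hma : innerMate σ a = σ.mate a := by
    rw [innerMate, if_neg]
    intro h
    have : a = σ.mate (Fin.last m) := by rw [← h, hσ.mate_mate]
    rw [this] at hia
    have h1 := position_window (σ := σ) hk hk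
    have h2 : position (windowShift σ) (σ.mate (Fin.last m)) = (σ.mate (Fin.last m) : ℕ) := by
      simp [position, windowShift]
    linarith
  have hb := innerMate_ne_last (σ := σ) ha
  rw [hmi] at haj hj ⊢
  rw [hma] at hb ⊢
  have := hnc i (σ.mate i) a (σ.mate a) hi hj ha hb (hσ.rel_mate i) (hσ.rel_mate a) hia haj
  refine ⟨by linarith, by linarith, fun h => hσ.mate_ne a (position_window_inj (σ := σ) hb ha ?_)⟩
  linarith

/-- A noncrossing pairing is determined by the set of the first nodes of its pairs. -/
theorem eq_of_rank_lt_iff {σ σ' : Setoid (Fin (m + 1))} (hσ : IsPairing σ) (hnc : NonCrossing σ)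
    (hσ' : IsPairing σ') (hnc' : NonCrossing σ')
    (h : ∀ i, rank σ i < rank σ (σ.mate i) ↔ rank σ' i < rank σ' (σ'.mate i)) : σ = σ' := by
  have hm : 0 < m := by
    rcases Nat.eq_zero_or_pos m with rfl | hm
    · exact absurd (Fin.ext (by omega)) (hσ.mate_ne 0)
    · exact hm
  have hτ := Int.involution_unique (lineMate_lineMate hm hσ) (lineMate_lineMate hm hσ')
    (lineMate_nonCrossing hm hσ hnc) (lineMate_nonCrossing hm hσ' hnc') fun x => by
      rw [le_lineMate_iff hm hσ, le_lineMate_iff hm hσ', h]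
  have hin : ∀ i, i ≠ Fin.last m → innerMate σ i = innerMate σ' i := by
    intro i hi
    have h1 := congrFun hτ (position (windowShift σ) i + m * 0)
    rw [lineMate_position hm σ hi, lineMate, residue_position hm _ _ hi] at h1
    have h2 : position (windowShift σ) i + m * 0 - position (windowShift σ') i +
        position (windowShift σ') (innerMate σ' i) = position (windowShift σ') (innerMate σ' i) +
          m * (windowShift σ i - windowShift σ' i) := by
      simp only [position]; ring
    rw [h2] at h1
    have h3 := congrArg (residue hm) h1
    rwa [residue_position hm _ _ (innerMate_ne_last hi),
      residue_position hm _ _ (innerMate_ne_last hi)] at h3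
  have hmate : ∀ i, i ≠ Fin.last m → σ.mate i = σ'.mate i := by
    intro i hi
    have := hin i hi
    unfold innerMate at this
    split_ifs at this with h1 h2 h2
    · rw [h1, h2]
    · exact absurd this.symm (hσ'.mate_ne i)
    · exact absurd this (hσ.mate_ne i)
    · exact this
  refine hσ.ext_mate hσ' fun i => ?_
  by_cases hi : i = Fin.last m
  · rw [hi]
    have h1 := hmate _ (hσ.mate_ne (Fin.last m))
    rw [hσ.mate_mate] at h1
    have h2 := hσ'.mate_mate (σ.mate (Fin.last m))
    rw [← h1] at h2
    exact h2.symm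
  · exact hmate i hi

/-- A pairing has an enumeration in which each pair starts with its element of lower rank. -/
theorem exists_enumeration (hm : m + 1 = 2 * h) {σ : Setoid (Fin (m + 1))} (hσ : IsPairing σ)
    {r : Fin (m + 1) → ℤ} (hr : Function.Injective r) :
    ∃ β : Fin h × Bool ≃ Fin (m + 1), pairSetoid β = σ ∧
      ∀ a, r (β (a, true)) < r (β (a, false)) := by
  let S := {i // r i < r (σ.mate i)}
  let g : S × Bool → Fin (m + 1) := fun x => if x.2 then x.1 else σ.mate x.1
  have hg : Function.Bijective g := by
    constructor
    · rintro ⟨⟨i, hi⟩, c⟩ ⟨⟨j, hj⟩, d⟩ hij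
      cases c <;> cases d <;> simp [g] at hij ⊢
      · exact Subtype.ext (show i = j by rw [← hσ.mate_mate i, hij, hσ.mate_mate])
      · rw [← hij, hσ.mate_mate] at hj
        exact absurd hi hj.not_gt
      · rw [hij, hσ.mate_mate] at hi
        exact absurd hi hj.not_gt
      · exact Subtype.ext hij
    · intro i
      rcases lt_or_gt_of_ne (hr.ne (hσ.mate_ne i).symm) with hi | hi
      · exact ⟨⟨⟨i, hi⟩, true⟩, rfl⟩
      · exact ⟨⟨⟨σ.mate i, by rwa [hσ.mate_mate]⟩, false⟩, hσ.mate_mate i⟩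
  have hcard : Nat.card S = h := by
    have := Nat.card_congr (Equiv.ofBijective g hg)
    rw [Nat.card_prod, Nat.card_eq_fintype_card (α := Bool), Fintype.card_bool, Nat.card_fin] at this
    omega
  let q : Fin h ≃ S := (Finite.equivFinOfCardEq hcard).symm
  let β : Fin h × Bool ≃ Fin (m + 1) :=
    (q.prodCongr (Equiv.refl Bool)).trans (Equiv.ofBijective g hg)
  have h1 : ∀ a, β (a, true) = (q a : Fin (m + 1)) := fun a => rfl
  have h2 : ∀ a, β (a, false) = σ.mate (q a) := fun a => rfl
  refine ⟨β, (isPairing_pairSetoid β).ext_mate hσ fun i => ?_, fun a => ?_⟩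
  · obtain ⟨⟨a, c⟩, rfl⟩ := β.surjective i
    rw [mate_pairSetoid]
    cases c
    · rw [Bool.not_false, h1, h2, hσ.mate_mate]
    · rw [Bool.not_true, h1, h2]
  · rw [h1, h2]
    exact (q a).2

end Independence

/-! ### Generic linear independence of the forms -/

section IndependenceOfForms

open Polynomial

variable {m h : ℕ}

/-- The first nodes of the pairs. -/
def IsFirst (σ : Setoid (Fin (m + 1))) (i : Fin (m + 1)) : Prop := rank σ i < rank σ (σ.mate i)

theorem not_isFirst_last {σ : Setoid (Fin (m + 1))} (hσ : IsPairing σ) :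
    ¬ IsFirst σ (Fin.last m) := by
  rw [IsFirst, rank.eq_def σ (Fin.last m), if_pos rfl]
  exact (rank_lt_last (hσ.mate_ne _)).not_gt

open Classical in
/-- Vectors adapted to a set of nodes. -/
noncomputable def testVector (R : Fin (m + 1) → Prop) (s : ℂ) (i : Fin (m + 1)) : ℂ :=
  if R i then s ^ ((i : ℕ) : ℤ) else 0

open Classical in
/-- Covectors adapted to a set of nodes. -/
noncomputable def testCovector (R : Fin (m + 1) → Prop) (s : ℂ) (i : Fin (m + 1)) : ℂ :=
  if R i then 0 else s ^ (-((i : ℕ) : ℤ))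

open Classical in
/-- The bracket at the test vectors, up to a power of the variable. -/
noncomputable def bracketPoly (R : Fin (m + 1) → Prop) (d : ℕ) (i j : Fin (m + 1)) : ℂ[X] :=
  C (if R i ∧ ¬ R j then 1 else 0) - X ^ (2 * d) * C (if R j ∧ ¬ R i then 1 else 0)

open Classical in
theorem bracketPoly_eval_zero (R : Fin (m + 1) → Prop) {d : ℕ} (hd : 0 < d) (i j : Fin (m + 1)) :
    (bracketPoly R d i j).eval 0 = if R i ∧ ¬ R j then 1 else 0 := by
  rw [bracketPoly, eval_sub, eval_mul, eval_pow, eval_X, zero_pow (by omega), zero_mul, eval_C,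
    sub_zero]

/-- The distance of two nodes in the window. -/
noncomputable def rankDist (σ : Setoid (Fin (m + 1))) (i j : Fin (m + 1)) : ℕ :=
  (rank σ j - rank σ i).toNat

open Classical in
/-- The exponent of the leading term of a bracket at the test vectors. -/
noncomputable def leadExponent (σ : Setoid (Fin (m + 1))) (i j : Fin (m + 1)) : ℤ :=
  if j = Fin.last m then position (windowShift σ) i
  else position (windowShift σ) i - position (windowShift σ) j

/-- The substitution `z = s ^ m` makes the test vectors powers of `s` with the positions on the line
as exponents. The two terms of the bracket then differ by `s` to twice the distance, and the term in
increasing order leads as `s` tends to `0`. -/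
theorem bracket_test {s : ℂ} (hs : s ≠ 0) (σ : Setoid (Fin (m + 1))) {R : Fin (m + 1) → Prop}
    (hR : ¬ R (Fin.last m)) {i j : Fin (m + 1)} (hij : rank σ i < rank σ j) :
    bracket (s ^ m) (testVector R s) (testCovector R s) (windowShift σ) i j =
      s ^ leadExponent σ i j * (bracketPoly R (rankDist σ i j) i j).eval s := by
  classical
  have hi : i ≠ Fin.last m := by
    rintro rfl
    by_cases hj : j = Fin.last m
    · exact hij.ne (by rw [hj])
    · rw [rank.eq_def σ (Fin.last m), if_pos rfl] at hij
      exact (rank_lt_last hj).not_gt hij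
  have he : ∀ i, (s ^ m) ^ windowShift σ i * testVector R s i =
      if R i then s ^ position (windowShift σ) i else 0 := by
    intro i
    unfold testVector position
    split_ifs
    · rw [← zpow_natCast, ← zpow_mul, ← zpow_add₀ hs, add_comm]
    · rw [mul_zero]
  have hf : ∀ i, (s ^ m) ^ (-windowShift σ i) * testCovector R s i =
      if R i then 0 else s ^ (-position (windowShift σ) i) := by
    intro i
    unfold testCovector position
    split_ifs
    · rw [mul_zero]
    · rw [← zpow_natCast, ← zpow_mul, ← zpow_add₀ hs]
      congr 1
      ring
  unfold bracket
  rw [he, he, hf, hf, if_neg hi, if_neg hi]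
  simp only [bracketPoly, eval_sub, eval_mul, eval_pow, eval_X, eval_C, leadExponent]
  by_cases hj : j = Fin.last m
  · subst hj
    simp only [if_true, hR, not_false_eq_true, and_true, false_and, if_false]
    split_ifs <;> ring
  · rw [if_neg hj, if_neg hj, if_neg hj]
    have hd : ((rankDist σ i j : ℕ) : ℤ) =
        position (windowShift σ) j - position (windowShift σ) i := by
      rw [rankDist, ← rank_of_ne hi, ← rank_of_ne hj]
      omega
    have h1 : s ^ (2 * rankDist σ i j) = s ^ (2 * (position (windowShift σ) j -
        position (windowShift σ) i)) := by
      rw [← hd, ← zpow_natCast]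
      push_cast
      rfl
    rw [h1, mul_sub, ← mul_assoc, ← zpow_add₀ hs]
    by_cases h2 : R i <;> by_cases h3 : R j <;>
      simp only [h2, h3, not_true, not_false_eq_true, and_true, and_false, if_true, if_false,
        mul_zero, zero_mul, mul_one, sub_zero, zero_sub] <;> rw [← zpow_add₀ hs] <;>
      ring_nf

/-- The forms of the noncrossing pairings are linearly independent for generic `z`. -/
theorem exists_polynomial_independent (hm : m + 1 = 2 * h) (β₀ : Fin h × Bool ≃ Fin (m + 1)) :
    ∃ p : ℂ[X], p ≠ 0 ∧ ∀ s : ℂ, s ≠ 0 → p.eval s ≠ 0 → ∀ c : NonCrossingPairing m → ℂ,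
      (∀ e f, ∑ σ, c σ * pairingForm β₀ σ (s ^ m) e f = 0) → c = 0 := by
  classical
  choose β hβ hrank using fun σ : NonCrossingPairing m =>
    exists_enumeration hm σ.2.1 (rank_injective σ.1)
  have hfirst : ∀ σ : NonCrossingPairing m, ∀ a,
      IsFirst σ.1 (β σ (a, true)) ∧ ¬ IsFirst σ.1 (β σ (a, false)) := by
    intro σ a
    have h1 : σ.1.mate (β σ (a, true)) = β σ (a, false) := by
      rw [← hβ σ, mate_pairSetoid]; rfl
    have h2 : σ.1.mate (β σ (a, false)) = β σ (a, true) := by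
      rw [← hβ σ, mate_pairSetoid]; rfl
    rw [IsFirst, IsFirst, h1, h2]
    exact ⟨hrank σ a, (hrank σ a).not_gt⟩
  let M : Matrix (NonCrossingPairing m) (NonCrossingPairing m) ℂ[X] := Matrix.of fun σ' σ =>
    ∏ a, bracketPoly (IsFirst σ'.1) (rankDist σ.1 (β σ (a, true)) (β σ (a, false)))
      (β σ (a, true)) (β σ (a, false))
  have hM : ∀ σ' σ, M σ' σ = ∏ a, bracketPoly (IsFirst σ'.1)
      (rankDist σ.1 (β σ (a, true)) (β σ (a, false))) (β σ (a, true)) (β σ (a, false)) :=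
    fun _ _ => rfl
  -- At `s = 0` an entry is `1` exactly when `σ` and `σ'` have the same first nodes, that is, when
  -- they are equal; so the determinant is a nonzero polynomial.
  have hM0 : M.map (Polynomial.evalRingHom 0) = 1 := by
    ext σ' σ
    rw [Matrix.map_apply, Matrix.one_apply, hM, map_prod]
    have : ∀ a, (evalRingHom 0) (bracketPoly (IsFirst σ'.1)
        (rankDist σ.1 (β σ (a, true)) (β σ (a, false))) (β σ (a, true)) (β σ (a, false))) =
        if IsFirst σ'.1 (β σ (a, true)) ∧ ¬ IsFirst σ'.1 (β σ (a, false)) then 1 else 0 := by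
      intro a
      rw [coe_evalRingHom, bracketPoly_eval_zero]
      rw [rankDist]
      have := hrank σ a
      omega
    simp only [this]
    split_ifs with hσ
    · subst hσ
      exact Finset.prod_eq_one fun a _ => if_pos (hfirst σ' a)
    · by_contra hne
      have h1 : ∀ a, IsFirst σ'.1 (β σ (a, true)) ∧ ¬ IsFirst σ'.1 (β σ (a, false)) := by
        intro a
        by_contra h2
        exact hne (Finset.prod_eq_zero (Finset.mem_univ a) (if_neg h2))
      refine hσ (Subtype.ext (eq_of_rank_lt_iff σ'.2.1 σ'.2.2 σ.2.1 σ.2.2 fun i => ?_))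
      obtain ⟨⟨a, c⟩, rfl⟩ := (β σ).surjective i
      change IsFirst σ'.1 _ ↔ IsFirst σ.1 _
      cases c
      · exact iff_of_false (h1 a).2 (hfirst σ a).2
      · exact iff_of_true (h1 a).1 (hfirst σ a).1
  refine ⟨M.det, fun h0 => ?_, fun s hs hdet c hc => ?_⟩
  · have h1 := (Polynomial.evalRingHom (0 : ℂ)).map_det M
    rw [RingHom.mapMatrix_apply, hM0, Matrix.det_one, h0, map_zero] at h1
    exact zero_ne_one h1
  · let n : NonCrossingPairing m → ℕ := fun σ => (Finset.univ.filter
      fun β' : Fin h × Bool ≃ Fin (m + 1) => pairSetoid β' = pairSetoid (β σ)).card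
    let u : NonCrossingPairing m → ℂ := fun σ => n σ * (((pairSign β₀ (β σ) : ℤˣ) : ℂ) *
      ∏ a, s ^ leadExponent σ.1 (β σ (a, true)) (β σ (a, false)))
    have hu : ∀ σ, u σ ≠ 0 := by
      intro σ
      refine mul_ne_zero ?_ (mul_ne_zero ?_ (Finset.prod_ne_zero_iff.2 fun a _ => zpow_ne_zero _ hs))
      · rw [Nat.cast_ne_zero, ← Nat.pos_iff_ne_zero, Finset.card_pos]
        exact ⟨β σ, by simp⟩
      · intro h1
        have := pairSign_mul_self β₀ (β σ)
        rw [h1, mul_zero] at this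
        exact zero_ne_one this
    have hform : ∀ σ' σ : NonCrossingPairing m, pairingForm β₀ σ.1 (s ^ m)
        (testVector (IsFirst σ'.1) s) (testCovector (IsFirst σ'.1) s) =
          (M.map (Polynomial.evalRingHom s)) σ' σ * u σ := by
      intro σ' σ
      conv_lhs => rw [← hβ σ]
      rw [pairingForm_eq, hβ σ, pairProd, Finset.prod_congr rfl fun a _ =>
        bracket_test hs σ.1 (not_isFirst_last σ'.2.1) (hrank σ a), Finset.prod_mul_distrib,
        Matrix.map_apply, hM, map_prod]
      simp only [coe_evalRingHom, u, n, hβ]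
      ring
    have hv : (M.map (Polynomial.evalRingHom s)).mulVec (fun σ => u σ * c σ) = 0 := by
      funext σ'
      rw [Matrix.mulVec, dotProduct, Pi.zero_apply, ← hc (testVector (IsFirst σ'.1) s)
        (testCovector (IsFirst σ'.1) s)]
      refine Finset.sum_congr rfl fun σ _ => ?_
      rw [hform]
      ring
    have hdet' : (M.map (Polynomial.evalRingHom s)).det ≠ 0 := by
      rw [← RingHom.mapMatrix_apply, ← RingHom.map_det]
      exact hdet
    have := Matrix.eq_zero_of_mulVec_eq_zero hdet' hv
    funext σ
    exact (mul_eq_zero.1 (congrFun this σ)).resolve_left (hu σ)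

end IndependenceOfForms

/-! ### Regularity and symmetry of the response matrix near `z = 1` -/

section ResponseMatrix

open Filter Topology

theorem Matrix.differentiableAt_det {n : Type*} [Fintype n] [DecidableEq n] {A : ℂ → Matrix n n ℂ}
    {z : ℂ} (hA : ∀ i j, DifferentiableAt ℂ (fun z => A z i j) z) :
    DifferentiableAt ℂ (fun z => (A z).det) z := by
  simp only [Matrix.det_apply']
  exact DifferentiableAt.fun_sum fun σ _ =>
    (differentiableAt_const _).mul (DifferentiableAt.fun_finsetProd fun i _ => hA _ _)

theorem Matrix.differentiableAt_inv {n : Type*} [Fintype n] [DecidableEq n] {A : ℂ → Matrix n n ℂ}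
    {z : ℂ} (hA : ∀ i j, DifferentiableAt ℂ (fun z => A z i j) z) (hz : (A z).det ≠ 0) (i j : n) :
    DifferentiableAt ℂ (fun z => (A z)⁻¹ i j) z := by
  simp only [Matrix.inv_def, Matrix.smul_apply, Ring.inverse_eq_inv', smul_eq_mul,
    Matrix.adjugate_apply]
  refine ((Matrix.differentiableAt_det hA).inv hz).mul (Matrix.differentiableAt_det fun k l => ?_)
  simp only [Matrix.updateRow_apply]
  split_ifs
  · exact differentiableAt_const _
  · exact hA _ _

theorem Matrix.differentiableAt_mul {l n k : Type*} [Fintype n] {A : ℂ → Matrix l n ℂ}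
    {B : ℂ → Matrix n k ℂ} {z : ℂ} (hA : ∀ i j, DifferentiableAt ℂ (fun z => A z i j) z)
    (hB : ∀ i j, DifferentiableAt ℂ (fun z => B z i j) z) (i : l) (j : k) :
    DifferentiableAt ℂ (fun z => (A z * B z) i j) z := by
  simp only [Matrix.mul_apply]
  exact DifferentiableAt.fun_sum fun x _ => (hA _ _).mul (hB _ _)

namespace AnnularOneGraph

open SurfaceMap

variable {m : ℕ} {V E : Type*} (G : AnnularOneGraph m V E) [Fintype E]

theorem differentiableAt_laplacian {z : ℂ} (hz : z ≠ 0) (v w : V) :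
    DifferentiableAt ℂ (fun z => G.laplacian z v w) z := by
  unfold laplacian
  refine DifferentiableAt.fun_sum fun d _ => (differentiableAt_const _).mul
    ((differentiableAt_const _).sub ?_)
  split_ifs
  · simp only [transport_eq]
    exact differentiableAt_zpow.2 (Or.inl hz)
  · exact differentiableAt_const _

/-- Reversal of darts exchanges source and target and inverts the transport. -/
theorem laplacian_inv (z : ℂ) : G.laplacian z⁻¹ = (G.laplacian z).transpose := by
  classical
  ext v w
  rw [Matrix.transpose_apply, laplacian, laplacian]
  simp only [mul_sub, Finset.sum_sub_distrib, mul_ite, mul_one, mul_zero]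
  congr 1
  · by_cases h : w = v
    · subst h; simp
    · simp [h, Ne.symm h]
  · rw [← Finset.sum_filter, ← Finset.sum_filter, Finset.filter_filter, Finset.filter_filter]
    refine Finset.sum_bij (fun d _ => Dart.rev d) ?_ (fun _ _ _ _ h => Dart.rev.injective h) ?_ ?_
    · intro d hd
      simp only [Finset.mem_filter, Finset.mem_univ, true_and] at hd ⊢
      exact ⟨hd.2.symm, by rw [G.tgt_rev]; exact hd.1.symm⟩
    · intro d hd
      simp only [Finset.mem_filter, Finset.mem_univ, true_and] at hd
      refine ⟨Dart.rev d, ?_, Dart.rev_rev d⟩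
      simp only [Finset.mem_filter, Finset.mem_univ, true_and]
      exact ⟨hd.2.symm, by rw [G.tgt_rev]; exact hd.1.symm⟩
    · intro d _
      rw [transport_eq, transport_eq, Dart.rev_rev, cross_rev, inv_zpow, zpow_neg, inv_inv]
      rfl

/-- There is a grove of every graph in which no two nodes are connected. -/
theorem Z_bot_pos [Fintype V] : 0 < G.Z ⊥ := by
  classical
  rw [Z_eq]
  have hpos : ∀ F : Finset E, 0 < ∏ e ∈ F, G.c e := fun F => Finset.prod_pos fun e _ => G.c_pos e
  obtain ⟨f, -, hch, hro, -⟩ := exists_isRooted_of_joined (S := Set.range G.node)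
    (F := Set.univ) (fun v => ⟨G.node 0, ⟨0, rfl⟩, G.connected v _⟩) G.zipHead
  refine Finset.sum_pos (fun F _ => hpos F) ⟨(chosenEdges (Set.range G.node) f).toFinset, ?_⟩
  rw [Finset.mem_filter, Set.coe_toFinset]
  refine ⟨Finset.mem_univ _, hro.isForest hch, fun v => ?_, fun i j => ⟨fun h => ?_, fun h => ?_⟩⟩
  · obtain ⟨s, ⟨⟨i, rfl⟩, hs⟩, -⟩ := hro.existsUnique hch v
    exact ⟨i, hs⟩
  · exact G.node_injective ((hro.existsUnique hch (G.node i)).unique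
      ⟨⟨i, rfl⟩, SurfaceMap.Joined.refl _⟩ ⟨⟨j, rfl⟩, h⟩)
  · obtain rfl : i = j := h
    exact SurfaceMap.Joined.refl _

variable [Fintype V]

theorem dirichletDet_one_ne_zero : G.dirichletDet 1 ≠ 0 := by
  rw [dirichletDet_one]
  exact Complex.ofReal_ne_zero.2 G.Z_bot_pos.ne'

theorem differentiableAt_dirichletDet {z : ℂ} (hz : z ≠ 0) :
    DifferentiableAt ℂ G.dirichletDet z := by
  classical
  exact Matrix.differentiableAt_det fun i j => G.differentiableAt_laplacian hz _ _

theorem eventually_dirichletDet_ne_zero : ∀ᶠ z in 𝓝 1, G.dirichletDet z ≠ 0 :=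
  (G.differentiableAt_dirichletDet one_ne_zero).continuousAt.eventually_ne
    G.dirichletDet_one_ne_zero

theorem differentiableAt_response (i j : Fin (m + 1)) :
    DifferentiableAt ℂ (fun z => G.response z i j) 1 := by
  classical
  unfold response
  simp only [Matrix.add_apply, Matrix.neg_apply]
  refine (G.differentiableAt_laplacian one_ne_zero _ _).neg.add
    (Matrix.differentiableAt_mul (Matrix.differentiableAt_mul
      (fun _ _ => G.differentiableAt_laplacian one_ne_zero _ _) (Matrix.differentiableAt_inv
        (fun _ _ => G.differentiableAt_laplacian one_ne_zero _ _) ?_))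
      (fun _ _ => G.differentiableAt_laplacian one_ne_zero _ _) i j)
  exact G.dirichletDet_one_ne_zero

theorem response_inv (z : ℂ) : G.response z⁻¹ = (G.response z).transpose := by
  classical
  rw [response, response, dirichletLaplacian, dirichletLaplacian, laplacian_inv]
  simp only [Matrix.transpose_add, Matrix.transpose_neg, Matrix.transpose_mul,
    Matrix.transpose_submatrix, Matrix.transpose_nonsing_inv, Matrix.mul_assoc]

theorem response_symm (z : ℂ) (i j : Fin (m + 1)) : G.response z j i = G.response z⁻¹ i j := by
  rw [response_inv]; rfl

/-- The odd part of the response matrix, divided by `z - z⁻¹`, tends to half the derivative. -/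
theorem tendsto_response_odd (i j : Fin (m + 1)) :
    Tendsto (fun z => (G.response z i j - G.response z j i) / (2 * (z - z⁻¹))) (𝓝[≠] 1)
      (𝓝 (deriv (fun z => G.response z i j) 1 / 2)) := by
  have hr := (G.differentiableAt_response i j).hasDerivAt
  have hinv : HasDerivAt (fun z : ℂ => z⁻¹) (-1) 1 := by
    simpa using hasDerivAt_inv (one_ne_zero (α := ℂ))
  -- The entry `j i` at `z` is the entry `i j` at `z⁻¹`. So numerator and denominator both vanish at
  -- `1`, with derivatives `2 * L'` and `4`.
  have h1 : HasDerivAt (fun z => G.response z i j - G.response z j i)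
      (2 * deriv (fun z => G.response z i j) 1) 1 := by
    simp only [G.response_symm _ i j]
    have h2 : HasDerivAt (fun z => G.response z⁻¹ i j)
        (deriv (fun z => G.response z i j) 1 * -1) 1 := by
      refine HasDerivAt.comp (h₂ := fun z => G.response z i j) (1 : ℂ) ?_ hinv
      rw [inv_one]
      exact hr
    exact (hr.sub h2).congr_deriv (by ring)
  have h3 : HasDerivAt (fun z : ℂ => 2 * (z - z⁻¹)) 4 1 := by
    exact (((hasDerivAt_id (1 : ℂ)).sub hinv).const_mul 2).congr_deriv (by norm_num)
  have h4 := h1.tendsto_slope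
  have h5 := h3.tendsto_slope
  have h6 := h4.div h5 (by norm_num)
  have h7 : 2 * deriv (fun z => G.response z i j) 1 / 4 =
      deriv (fun z => G.response z i j) 1 / 2 := by ring
  rw [h7] at h6
  refine h6.congr' ?_
  filter_upwards [self_mem_nhdsWithin] with z hz
  have hz' : z - 1 ≠ 0 := sub_ne_zero.2 hz
  have h8 : G.response 1 i j - G.response 1 j i = 0 := by
    rw [G.response_symm 1 i j, inv_one, sub_self]
  simp only [Pi.div_apply, slope_def_field, h8, inv_one, sub_self, mul_zero, sub_zero]
  rw [div_div_div_cancel_right₀ hz']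

end AnnularOneGraph

end ResponseMatrix

/-! ### Signed sums over enumerations of pairs -/

section PairingSums

variable {m h : ℕ}

theorem sum_trans {M : Type*} [AddCommMonoid M] (γ : Equiv.Perm (Fin h × Bool))
    (g : (Fin h × Bool ≃ Fin (m + 1)) → M) : ∑ β, g (γ.trans β) = ∑ β, g β :=
  Fintype.sum_bijective (fun β : Fin h × Bool ≃ Fin (m + 1) => γ.trans β)
    ⟨fun β β' hβ => by
      have : γ.symm.trans (γ.trans β) = γ.symm.trans (γ.trans β') := congrArg _ hβ
      rwa [← Equiv.trans_assoc, ← Equiv.trans_assoc, Equiv.symm_trans_self, Equiv.refl_trans,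
        Equiv.refl_trans] at this,
      fun β => ⟨γ.symm.trans β, by
        change γ.trans (γ.symm.trans β) = β
        rw [← Equiv.trans_assoc, Equiv.self_trans_symm, Equiv.refl_trans]⟩⟩ _ _ fun _ => rfl

/-- The signed sum over the enumerations of pairs may be antisymmetrized. -/
theorem sum_pairSign_antisymm (β₀ : Fin h × Bool ≃ Fin (m + 1))
    (x : Fin (m + 1) → Fin (m + 1) → ℂ) :
    ∑ β : Fin h × Bool ≃ Fin (m + 1), ((pairSign β₀ β : ℤˣ) : ℂ) *
      ∏ a, (x (β (a, true)) (β (a, false)) - x (β (a, false)) (β (a, true))) =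
    2 ^ h * ∑ β : Fin h × Bool ≃ Fin (m + 1), ((pairSign β₀ β : ℤˣ) : ℂ) *
      ∏ a, x (β (a, true)) (β (a, false)) := by
  have h1 : ∀ β : Fin h × Bool ≃ Fin (m + 1),
      ∏ a, (x (β (a, true)) (β (a, false)) - x (β (a, false)) (β (a, true))) =
      ∑ w : Fin h → Bool, ∏ a, (if w a then x (β (a, true)) (β (a, false))
        else -x (β (a, false)) (β (a, true))) := by
    intro β
    rw [← Fintype.piFinset_univ, ← Finset.prod_univ_sum (fun _ => Finset.univ)
      fun a (c : Bool) => if c then x (β (a, true)) (β (a, false))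
        else -x (β (a, false)) (β (a, true))]
    refine Finset.prod_congr rfl fun a _ => ?_
    simp [sub_eq_add_neg]
  simp only [h1, Finset.mul_sum]
  rw [Finset.sum_comm]
  have h2 : ∀ w : Fin h → Bool, ∑ β : Fin h × Bool ≃ Fin (m + 1), ((pairSign β₀ β : ℤˣ) : ℂ) *
      ∏ a, (if w a then x (β (a, true)) (β (a, false)) else -x (β (a, false)) (β (a, true))) =
      ∑ β : Fin h × Bool ≃ Fin (m + 1), ((pairSign β₀ β : ℤˣ) : ℂ) *
        ∏ a, x (β (a, true)) (β (a, false)) := by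
    intro w
    -- The flip of those pairs for which the second term was selected; reindexing by it absorbs the
    -- signs.
    let φ : Fin h → Equiv.Perm Bool := fun a => if w a then 1 else Equiv.swap true false
    refine Eq.trans ?_ (sum_trans (Equiv.prodCongrRight φ) fun β : Fin h × Bool ≃ Fin (m + 1) =>
      ((pairSign β₀ β : ℤˣ) : ℂ) * ∏ a, x (β (a, true)) (β (a, false)))
    refine Finset.sum_congr rfl fun β _ => ?_
    rw [pairSign_trans, Equiv.Perm.sign_prodCongrRight]
    have h3 : ∏ a, (if w a then x (β (a, true)) (β (a, false))
        else -x (β (a, false)) (β (a, true))) =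
        (∏ a, ((Equiv.Perm.sign (φ a) : ℤˣ) : ℂ)) *
          ∏ a, x (β (a, φ a true)) (β (a, φ a false)) := by
      rw [← Finset.prod_mul_distrib]
      refine Finset.prod_congr rfl fun a _ => ?_
      by_cases hw : w a
      · simp [φ, hw]
      · simp [φ, hw]
    rw [h3]
    simp only [Equiv.trans_apply, Equiv.prodCongrRight_apply]
    push_cast
    ring
  rw [Finset.sum_congr rfl fun w _ => h2 w, Finset.sum_const, Finset.card_univ, Fintype.card_fun,
    Fintype.card_bool, Fintype.card_fin, nsmul_eq_mul, Finset.mul_sum]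
  push_cast
  rfl

/-- The signed sum of determinants over the enumerations of pairs. -/
theorem sum_pairSign_det (β₀ : Fin h × Bool ≃ Fin (m + 1))
    (x : Fin (m + 1) → Fin (m + 1) → ℂ) (e f : Fin (m + 1) → ℂ) :
    ∑ β : Fin h × Bool ≃ Fin (m + 1), ((pairSign β₀ β : ℤˣ) : ℂ) *
      ((∏ a, e (β (a, true)) * f (β (a, false))) *
        (Matrix.of fun a b => x (β (a, true)) (β (b, false))).det) =
    h.factorial * ∑ β : Fin h × Bool ≃ Fin (m + 1), ((pairSign β₀ β : ℤˣ) : ℂ) *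
      ∏ a, x (β (a, true)) (β (a, false)) * (e (β (a, true)) * f (β (a, false))) := by
  simp only [Matrix.det_apply', Finset.mul_sum]
  rw [Finset.sum_comm]
  have h2 : ∀ π : Equiv.Perm (Fin h), ∑ β : Fin h × Bool ≃ Fin (m + 1),
      ((pairSign β₀ β : ℤˣ) : ℂ) * ((∏ a, e (β (a, true)) * f (β (a, false))) *
        (((Equiv.Perm.sign π : ℤˣ) : ℂ) *
          ∏ a, (Matrix.of fun a b => x (β (a, true)) (β (b, false))) (π a) a)) =
      ∑ β : Fin h × Bool ≃ Fin (m + 1), ((pairSign β₀ β : ℤˣ) : ℂ) *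
        ∏ a, x (β (a, true)) (β (a, false)) * (e (β (a, true)) * f (β (a, false))) := by
    intro π
    -- Permuting the tails alone by `π` changes the sign of the enumeration by the sign of `π`,
    -- which cancels the one in the determinant. So all permutations contribute equally.
    refine Eq.trans ?_ (sum_trans (Equiv.prodCongrLeft fun c : Bool => if c then π else 1)
      fun β : Fin h × Bool ≃ Fin (m + 1) => ((pairSign β₀ β : ℤˣ) : ℂ) *
        ∏ a, x (β (a, true)) (β (a, false)) * (e (β (a, true)) * f (β (a, false))))
    refine Finset.sum_congr rfl fun β _ => ?_
    rw [pairSign_trans, Equiv.Perm.sign_prodCongrLeft]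
    simp only [Equiv.trans_apply, Equiv.prodCongrLeft_apply, Matrix.of_apply, Fintype.prod_bool,
      if_true, Bool.false_eq_true, if_false, Equiv.Perm.sign_one, mul_one, Equiv.Perm.one_apply,
      Finset.prod_mul_distrib]
    rw [Equiv.prod_comp π fun a => e (β (a, true))]
    push_cast
    ring
  rw [Finset.sum_congr rfl fun π _ => h2 π, Finset.sum_const, Finset.card_univ, Fintype.card_perm,
    Fintype.card_fin, nsmul_eq_mul, Finset.mul_sum]

/-- The vector entry `e i`, or `0` at the outer node. -/
noncomputable def innerVector (e : Fin (m + 1) → ℂ) (i : Fin (m + 1)) : ℂ :=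
  if i = Fin.last m then 0 else e i

/-- The covector entry `f i`, or `1` at the outer node. -/
noncomputable def innerCovector (f : Fin (m + 1) → ℂ) (i : Fin (m + 1)) : ℂ :=
  if i = Fin.last m then 1 else f i

/-- The connections of a pairing give its form. -/
theorem sum_connection {σ : Setoid (Fin (m + 1))} (hσ : IsPairing σ)
    (β₀ : Fin h × Bool ≃ Fin (m + 1)) {z : ℂ} (hz : z ≠ 0) (T : ℂ) (e f : Fin (m + 1) → ℂ) :
    ∑ β : Fin h × Bool ≃ Fin (m + 1), ((pairSign β₀ β : ℤˣ) : ℂ) *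
      ∏ a, (connection σ z T (β (a, true)) (β (a, false)) *
          (innerVector e (β (a, true)) * innerCovector f (β (a, false))) -
        connection σ z T (β (a, false)) (β (a, true)) *
          (innerVector e (β (a, false)) * innerCovector f (β (a, true)))) =
    T * pairingForm β₀ σ z e f := by
  classical
  rw [pairingForm, Finset.mul_sum, Finset.sum_filter]
  refine Finset.sum_congr rfl fun β _ => ?_
  split_ifs with hβ
  · have hfac : ∀ i j, i ≠ j → σ i j → connection σ z T i j *
        (innerVector e i * innerCovector f j) - connection σ z T j i *
          (innerVector e j * innerCovector f i) =
        (if i = Fin.last m ∨ j = Fin.last m then T else 1) *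
          bracket z e f (windowShift σ) i j := by
      intro i j hij hr
      -- The mate of the outer node is not turned, so no power of `z` appears in its bracket with
      -- the outer vector.
      have hl : ∀ {i}, i ≠ Fin.last m → σ i (Fin.last m) → windowShift σ i = 0 := by
        intro i hi hr
        rw [windowShift, ← hσ.eq_mate hi (σ.symm hr), if_neg (lt_irrefl i)]
      unfold connection bracket innerVector innerCovector
      rw [if_pos (show σ i j ∧ i ≠ j from ⟨hr, hij⟩),
        if_pos (show σ j i ∧ j ≠ i from ⟨σ.symm hr, hij.symm⟩)]
      by_cases hi : i = Fin.last m
      · subst hi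
        have hj : j ≠ Fin.last m := hij.symm
        simp [hj, hl hj (σ.symm hr)]
      · by_cases hj : j = Fin.last m
        · subst hj
          simp [hi, hl hi hr]
        · simp only [hi, hj, if_false, or_self]
          unfold windowShift
          rw [zpow_sub₀ hz, zpow_sub₀ hz, zpow_neg, zpow_neg]
          simp only [div_eq_mul_inv]
          ring
    obtain ⟨⟨b, c⟩, hb⟩ := β.surjective (Fin.last m)
    have hslot : ∀ a, (β (a, true) = Fin.last m ∨ β (a, false) = Fin.last m) ↔ a = b := by
      intro a
      constructor
      · rintro (h | h) <;> exact congrArg Prod.fst (β.injective (h.trans hb.symm))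
      · rintro rfl
        cases c
        · exact Or.inr hb
        · exact Or.inl hb
    have : ∀ a, connection σ z T (β (a, true)) (β (a, false)) *
          (innerVector e (β (a, true)) * innerCovector f (β (a, false))) -
        connection σ z T (β (a, false)) (β (a, true)) *
          (innerVector e (β (a, false)) * innerCovector f (β (a, true))) =
        (if a = b then T else 1) *
          bracket z e f (windowShift σ) (β (a, true)) (β (a, false)) := by
      intro a
      rw [hfac _ _ (by simp) (hβ ▸ pairSetoid_apply.2 rfl)]
      simp only [hslot]
    rw [Finset.prod_congr rfl fun a _ => this a, Finset.prod_mul_distrib]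
    simp only [Finset.prod_ite_eq', Finset.mem_univ, if_true, pairProd]
    ring
  -- An enumeration of another pairing contains a pair that `σ` does not connect, and its product
  -- vanishes.
  · obtain ⟨a, ha⟩ : ∃ a, ¬ σ (β (a, true)) (β (a, false)) := by
      by_contra! hall
      refine hβ ((isPairing_pairSetoid β).ext_mate hσ fun i => ?_)
      obtain ⟨⟨a, c⟩, rfl⟩ := β.surjective i
      rw [mate_pairSetoid]
      refine hσ.eq_mate (by simp) ?_
      cases c
      · exact σ.symm (hall a)
      · exact hall a
    rw [Finset.prod_eq_zero (Finset.mem_univ a), mul_zero]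
    rw [connection, connection, if_neg fun h => ha h.1, if_neg fun h => ha (σ.symm h.1)]
    ring

end PairingSums

/-! ### Two expansions of one sum in the forms of noncrossing pairings -/

section ResponseExpansion

open Filter Topology

variable {m h : ℕ}

namespace AnnularOneGraph

variable {V E : Type*} (G : AnnularOneGraph m V E)

/-- Whether `a` and `b` lie on the same arc between `i` and `j` does not depend on where the circle
is cut, so the identity in the natural order carries over to the window. -/
theorem IsPairingGrove.nonCrossing [Fintype V] [Fintype E] {G : AnnularOneGraph m V E} {F : Set E}
    (hF : G.IsPairingGrove F) :
    NonCrossing (G.inducedPartition F) := by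
  intro i j a b hi hj ha hb hij hab h1 h2
  have hia : ¬ G.inducedPartition F i a := by
    intro hia
    by_cases hai : a = i
    · subst hai; exact lt_irrefl _ h1
    · have hji : j ≠ i := by
        rintro rfl
        exact lt_asymm h1 h2
      have := (hF.2.2.eq_mate hai hia).trans (hF.2.2.eq_mate hji hij).symm
      subst this
      exact lt_irrefl _ h2
  have hib : b ≠ i := fun h => hia ((G.inducedPartition F).symm (h ▸ hab))
  have hjb : b ≠ j := fun h =>
    hia ((G.inducedPartition F).trans hij ((G.inducedPartition F).symm (h ▸ hab)))
  obtain ⟨i, rfl⟩ := Fin.exists_castSucc_eq.2 hi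
  obtain ⟨j, rfl⟩ := Fin.exists_castSucc_eq.2 hj
  obtain ⟨a, rfl⟩ := Fin.exists_castSucc_eq.2 ha
  obtain ⟨b, rfl⟩ := Fin.exists_castSucc_eq.2 hb
  have key := hF.not_cross hij hab hia
  have key' : (if a < j then (1 : ℤ) else 0) - (if a < i then 1 else 0) =
      (if b < j then 1 else 0) - (if b < i then 1 else 0) := by exact_mod_cast key
  have i1 := i.2
  have j1 := j.2
  have a1 := a.2
  have b1 := b.2
  unfold position windowShift at *
  generalize (G.inducedPartition F).mate (Fin.last m) = k at *
  simp only [Fin.lt_def, ne_eq, Fin.ext_iff, Fin.val_castSucc] at *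
  clear key hij hab hia hF
  split_ifs at * <;> omega

variable [Fintype E]

open Classical in
/-- The generating function of the groves of type `σ`, by transport from the outer node. -/
noncomputable def transportSum (σ : Setoid (Fin (m + 1))) (z : ℂ) : ℂ :=
  ∑ F : Finset E with G.IsPairingGrove ((F : Finset E) : Set E) ∧
    G.inducedPartition (F : Set E) = σ, (∏ e ∈ F, (G.c e : ℂ)) * G.through F z

theorem transportSum_one {σ : Setoid (Fin (m + 1))} (hσ : IsPairing σ) :
    G.transportSum σ 1 = (G.Z σ : ℝ) := by
  classical
  rw [transportSum, Z_eq]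
  push_cast
  refine Finset.sum_congr ?_ fun F _ => by rw [through_one, mul_one]
  ext F
  rw [Finset.mem_filter, Finset.mem_filter, isGrove_iff, IsPairingGrove]
  refine and_congr_right fun _ => ?_
  constructor
  · rintro ⟨⟨h1, h2, -⟩, h3⟩
    exact ⟨h1, h2, h3⟩
  · rintro ⟨h1, h2, h3⟩
    exact ⟨⟨h1, h2, h3 ▸ hσ⟩, h3⟩

theorem continuousAt_transportSum (σ : Setoid (Fin (m + 1))) :
    ContinuousAt (G.transportSum σ) 1 :=
  tendsto_finsetSum _ fun F _ => continuousAt_const.mul (G.continuousAt_through F)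

variable [Fintype V]

theorem Z_eq_zero_of_not_nonCrossing {σ : Setoid (Fin (m + 1))} (hσ : IsPairing σ)
    (hnc : ¬ NonCrossing σ) : G.Z σ = 0 := by
  classical
  rw [Z_eq]
  refine Finset.sum_eq_zero fun F hF => ?_
  obtain ⟨h1, h2, h3⟩ := G.isGrove_iff.1 (Finset.mem_filter.1 hF).2
  have hF' : G.IsPairingGrove (F : Set E) := ⟨h1, h2, h3 ▸ hσ⟩
  exact absurd (h3 ▸ hF'.nonCrossing) hnc

/-- The antisymmetrized response matrix, contracted with vectors. -/
noncomputable def responseBracket (z : ℂ) (e f : Fin (m + 1) → ℂ) (i j : Fin (m + 1)) : ℂ :=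
  G.response z i j * (innerVector e i * innerCovector f j) -
    G.response z j i * (innerVector e j * innerCovector f i)

/-- The Pfaffian of the response brackets, expanded over noncrossing pairings. -/
theorem sum_responseBracket (β₀ : Fin h × Bool ≃ Fin (m + 1)) {z : ℂ} (hz : z ≠ 0)
    (hdet : G.dirichletDet z ≠ 0) (e f : Fin (m + 1) → ℂ) :
    G.dirichletDet z * ∑ β : Fin h × Bool ≃ Fin (m + 1), ((pairSign β₀ β : ℤˣ) : ℂ) *
      ∏ a, G.responseBracket z e f (β (a, true)) (β (a, false)) =
    ∑ σ : NonCrossingPairing m, G.transportSum σ z * pairingForm β₀ σ z e f := by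
  classical
  have h1 : ∀ β : Fin h × Bool ≃ Fin (m + 1), G.dirichletDet z * (((pairSign β₀ β : ℤˣ) : ℂ) *
      ((∏ a, innerVector e (β (a, true)) * innerCovector f (β (a, false))) *
        (Matrix.of fun a b => G.response z (β (a, true)) (β (b, false))).det)) =
      ∑ F : Finset E with G.IsPairingGrove ((F : Finset E) : Set E), (∏ e ∈ F, (G.c e : ℂ)) *
        (((pairSign β₀ β : ℤˣ) : ℂ) *
          ((∏ a, innerVector e (β (a, true)) * innerCovector f (β (a, false))) *
            (Matrix.of fun a b => connection (G.inducedPartition (F : Set E)) z (G.through F z)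
              (β (a, true)) (β (b, false))).det)) := by
    intro β
    obtain ⟨⟨b, c⟩, hb⟩ := β.surjective (Fin.last m)
    cases c
    · have := G.dirichletDet_mul_det_response (β := β) hz hdet hb
      rw [mul_left_comm, mul_left_comm (G.dirichletDet z), this, Finset.mul_sum, Finset.mul_sum]
      refine Finset.sum_congr ?_ fun F _ => by ring
      congr
    -- With the outer node as a tail the product contains its vanishing entry of `innerVector`, so
    -- only minors with the outer node as a head matter.
    · have : ∏ a, innerVector e (β (a, true)) * innerCovector f (β (a, false)) = 0 :=
        Finset.prod_eq_zero (Finset.mem_univ b) (by rw [hb, innerVector, if_pos rfl, zero_mul])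
      simp [this]
  have h2 := Finset.sum_congr rfl fun β (_ : β ∈ Finset.univ) => h1 β
  rw [← Finset.mul_sum, sum_pairSign_det β₀ (G.response z), Finset.sum_comm] at h2
  simp only [← Finset.mul_sum] at h2
  have h3 : ∀ F : Finset E, ∑ β : Fin h × Bool ≃ Fin (m + 1), (((pairSign β₀ β : ℤˣ) : ℂ) *
          ((∏ a, innerVector e (β (a, true)) * innerCovector f (β (a, false))) *
            (Matrix.of fun a b => connection (G.inducedPartition (F : Set E)) z (G.through F z)
              (β (a, true)) (β (b, false))).det)) = _ := fun F => sum_pairSign_det β₀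
    (connection (G.inducedPartition (F : Set E)) z (G.through F z)) (innerVector e)
    (innerCovector f)
  simp only [h3] at h2
  have h4 : G.dirichletDet z * ∑ β : Fin h × Bool ≃ Fin (m + 1), ((pairSign β₀ β : ℤˣ) : ℂ) *
      ∏ a, G.response z (β (a, true)) (β (a, false)) *
        (innerVector e (β (a, true)) * innerCovector f (β (a, false))) =
      ∑ F : Finset E with G.IsPairingGrove ((F : Finset E) : Set E), (∏ e ∈ F, (G.c e : ℂ)) *
        ∑ β : Fin h × Bool ≃ Fin (m + 1), ((pairSign β₀ β : ℤˣ) : ℂ) *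
      ∏ a, connection (G.inducedPartition (F : Set E)) z (G.through F z)
        (β (a, true)) (β (a, false)) *
        (innerVector e (β (a, true)) * innerCovector f (β (a, false))) := by
    have hh : (h.factorial : ℂ) ≠ 0 := Nat.cast_ne_zero.2 h.factorial_ne_zero
    refine mul_left_cancel₀ hh ?_
    rw [mul_left_comm, h2, Finset.mul_sum]
    exact Finset.sum_congr rfl fun F _ => by ring
  have h5 := sum_pairSign_antisymm β₀ fun i j =>
    G.response z i j * (innerVector e i * innerCovector f j)
  have h6 : ∀ F : Finset E, _ := fun F => sum_pairSign_antisymm β₀ fun i j =>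
    connection (G.inducedPartition (F : Set E)) z (G.through F z) i j *
      (innerVector e i * innerCovector f j)
  simp only [responseBracket]
  rw [h5, mul_left_comm, h4, Finset.mul_sum]
  have h7 : ∀ F ∈ Finset.univ.filter fun F : Finset E => G.IsPairingGrove (F : Set E),
      2 ^ h * ((∏ e ∈ F, (G.c e : ℂ)) *
        ∑ β : Fin h × Bool ≃ Fin (m + 1), ((pairSign β₀ β : ℤˣ) : ℂ) *
      ∏ a, connection (G.inducedPartition (F : Set E)) z (G.through F z)
        (β (a, true)) (β (a, false)) *
        (innerVector e (β (a, true)) * innerCovector f (β (a, false)))) =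
      ∑ σ : NonCrossingPairing m, if G.inducedPartition (F : Set E) = σ.1 then
        (∏ e ∈ F, (G.c e : ℂ)) * G.through F z * pairingForm β₀ σ z e f else 0 := by
    intro F hF
    have hF' := (Finset.mem_filter.1 hF).2
    rw [mul_left_comm, ← h6, sum_connection hF'.2.2 β₀ hz]
    let τ : NonCrossingPairing m :=
      ⟨G.inducedPartition (F : Set E), hF'.2.2, hF'.nonCrossing⟩
    rw [Finset.sum_eq_single τ, if_pos rfl, mul_assoc]
    · intro σ _ hσ
      exact if_neg fun h => hσ (Subtype.ext h.symm)
    · simp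
  rw [Finset.sum_congr rfl h7, Finset.sum_comm]
  refine Finset.sum_congr rfl fun σ _ => ?_
  rw [transportSum, Finset.sum_mul, ← Finset.sum_filter, Finset.filter_filter]

/-- The coefficients of the response brackets with respect to brackets shifted by `0`, `1` and
`-1` turns. -/
noncomputable def shiftCoeff (z : ℂ) (w : Fin 3) (i j : Fin (m + 1)) : ℂ :=
  ![if j = Fin.last m then G.response z i (Fin.last m) else if i = Fin.last m then
      G.response z j (Fin.last m) else (G.response z i j + G.response z j i) / 2,
    if i = Fin.last m ∨ j = Fin.last m then 0 else
      (G.response z i j - G.response z j i) / (2 * (z - z⁻¹)),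
    if i = Fin.last m ∨ j = Fin.last m then 0 else
      -((G.response z i j - G.response z j i) / (2 * (z - z⁻¹)))] w

end AnnularOneGraph

/-- The numbers of turns `0`, `1` and `-1`. -/
def turns (w : Fin 3) : ℤ := ![0, 1, -1] w

namespace AnnularOneGraph

variable {V E : Type*} (G : AnnularOneGraph m V E) [Fintype E] [Fintype V]

/-- The even part multiplies the plain bracket. The brackets turned by `1` and `-1` differ by `z -
z⁻¹` times the symmetric expression that belongs to the odd part. If one of the nodes is the outer
one, only the entry towards it survives, and no odd part is needed. -/
theorem responseBracket_eq {z : ℂ} (hz' : z - z⁻¹ ≠ 0) (e f : Fin (m + 1) → ℂ)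
    {i j : Fin (m + 1)} (hij : i ≠ j) (ω : Fin 3 → Fin (m + 1) → ℤ) (hi : ∀ w, ω w i = turns w)
    (hj : ∀ w, ω w j = 0) :
    G.responseBracket z e f i j = ∑ w, G.shiftCoeff z w i j * bracket z e f (ω w) i j := by
  simp only [Fin.sum_univ_three, shiftCoeff, bracket, hi, hj, turns, responseBracket, innerVector,
    innerCovector]
  by_cases hi : i = Fin.last m
  · subst hi
    have : j ≠ Fin.last m := hij.symm
    simp [this]
  · by_cases hj : j = Fin.last m
    · subst hj
      simp [hi]
    · obtain ⟨D, hD⟩ : ∃ D, (G.response z i j - G.response z j i) / (2 * (z - z⁻¹)) = D := ⟨_, rfl⟩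
      have hD' : G.response z i j - G.response z j i = D * (2 * (z - z⁻¹)) := by
        rw [← hD, div_mul_cancel₀ _ (mul_ne_zero two_ne_zero hz')]
      simp [hi, hj, hD]
      linear_combination (1 / 2) * (e i * f j + e j * f i) * hD'

end AnnularOneGraph

/-- The shifts of an enumeration by given numbers of turns. -/
def turnShift (β : Fin h × Bool ≃ Fin (m + 1)) (w : Fin h → Fin 3) (i : Fin (m + 1)) : ℤ :=
  if (β.symm i).2 then turns (w (β.symm i).1) else 0

/-- Two inner nodes are less than `m` apart and one turn adds at most `m`; this is the origin of the
bound `2 * m`. -/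
theorem isShort_turnShift (β : Fin h × Bool ≃ Fin (m + 1)) (w : Fin h → Fin 3) (a : Fin h) :
    IsShort (turnShift β w) (β (a, true)) (β (a, false)) := by
  intro hi hj
  have h1 : turnShift β w (β (a, true)) = turns (w a) := by simp [turnShift]
  have h2 : turnShift β w (β (a, false)) = 0 := by simp [turnShift]
  rw [position, position, h1, h2]
  generalize β (a, true) = i at *
  generalize β (a, false) = j at *
  have h3 : ∀ w, turns w = 0 ∨ turns w = 1 ∨ turns w = -1 := by decide
  simp only [ne_eq, Fin.ext_iff, Fin.val_last] at hi hj
  rw [abs_le]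
  rcases h3 (w a) with h | h | h <;> rw [h] <;> omega

/-- The coefficient of the form of a pairing in the expansion of a product of brackets. -/
noncomputable def expansionCoeff (β₀ β : Fin h × Bool ≃ Fin (m + 1)) (w : Fin h → Fin 3) :
    NonCrossingPairing m → ℂ → ℂ :=
  (isCombination_pairProd β₀ (turnShift β w) β (isShort_turnShift β w)).choose

theorem expansionCoeff_spec (β₀ β : Fin h × Bool ≃ Fin (m + 1)) (w : Fin h → Fin 3) :
    (∀ σ, ContinuousAt (expansionCoeff β₀ β w σ) 1 ∧ ∃ q : ℚ, expansionCoeff β₀ β w σ 1 = q) ∧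
    ∀ z, z ≠ 0 → ∀ e f, pairProd z e f (turnShift β w) β =
      ∑ σ, expansionCoeff β₀ β w σ z * pairingForm β₀ σ z e f :=
  (isCombination_pairProd β₀ (turnShift β w) β (isShort_turnShift β w)).choose_spec

namespace AnnularOneGraph

variable {V E : Type*} (G : AnnularOneGraph m V E) [Fintype E] [Fintype V]

/-- The expansion of the generating function of groves in terms of the response matrix. -/
noncomputable def responseSum (β₀ : Fin h × Bool ≃ Fin (m + 1)) (σ : NonCrossingPairing m)
    (z : ℂ) : ℂ :=
  ∑ β : Fin h × Bool ≃ Fin (m + 1), ∑ w : Fin h → Fin 3, ((pairSign β₀ β : ℤˣ) : ℂ) *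
    expansionCoeff β₀ β w σ z * ∏ a, G.shiftCoeff z (w a) (β (a, true)) (β (a, false))

theorem sum_responseBracket_eq (β₀ : Fin h × Bool ≃ Fin (m + 1)) {z : ℂ} (hz : z ≠ 0)
    (hz' : z - z⁻¹ ≠ 0) (e f : Fin (m + 1) → ℂ) :
    ∑ β : Fin h × Bool ≃ Fin (m + 1), ((pairSign β₀ β : ℤˣ) : ℂ) *
      ∏ a, G.responseBracket z e f (β (a, true)) (β (a, false)) =
    ∑ σ, G.responseSum β₀ σ z * pairingForm β₀ σ z e f := by
  have h1 : ∀ β : Fin h × Bool ≃ Fin (m + 1),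
      ∏ a, G.responseBracket z e f (β (a, true)) (β (a, false)) =
      ∑ w : Fin h → Fin 3, (∏ a, G.shiftCoeff z (w a) (β (a, true)) (β (a, false))) *
        ∑ σ, expansionCoeff β₀ β w σ z * pairingForm β₀ σ z e f := by
    intro β
    have h2 : ∀ a, G.responseBracket z e f (β (a, true)) (β (a, false)) =
        ∑ c : Fin 3, G.shiftCoeff z c (β (a, true)) (β (a, false)) *
          bracket z e f (turnShift β fun _ => c) (β (a, true)) (β (a, false)) := fun a =>
      G.responseBracket_eq hz' e f (by simp) _ (fun c => by simp [turnShift])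
        (fun c => by simp [turnShift])
    -- In the expanded product, `w` records the number of turns selected for each pair.
    rw [Finset.prod_congr rfl fun a _ => h2 a, Finset.prod_univ_sum, Fintype.piFinset_univ]
    refine Finset.sum_congr rfl fun w _ => ?_
    rw [Finset.prod_mul_distrib, ← (expansionCoeff_spec β₀ β w).2 z hz e f, pairProd]
    congr 1
    refine Finset.prod_congr rfl fun a _ => ?_
    simp only [bracket, turnShift, Equiv.symm_apply_apply, if_true, Bool.false_eq_true, if_false]
  simp only [h1, responseSum, Finset.sum_mul, Finset.mul_sum]
  rw [Finset.sum_comm (s := (Finset.univ : Finset (NonCrossingPairing m)))]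
  refine Finset.sum_congr rfl fun β _ => ?_
  rw [Finset.sum_comm (s := (Finset.univ : Finset (NonCrossingPairing m)))]
  exact Finset.sum_congr rfl fun w _ => Finset.sum_congr rfl fun σ _ => by ring

end AnnularOneGraph

end ResponseExpansion

/-! ### The polynomials and the limit `z → 1` -/

section PairingPolynomial

open Filter Topology MvPolynomial

variable {m h : ℕ}

/-- The variable `L_{i,j}`, symmetric in `i` and `j`. -/
noncomputable def evenVar (i j : Fin (m + 1)) : MvPolynomial (LVar m) ℚ :=
  if hij : i < j then X (Sum.inl ⟨(i, j), hij⟩)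
  else if hij : j < i then X (Sum.inl ⟨(j, i), hij⟩) else 0

open Classical in
/-- The variable `L'_{i,j}`, antisymmetric in `i` and `j`. -/
noncomputable def oddVar (i j : Fin (m + 1)) : MvPolynomial (LVar m) ℚ :=
  if hij : ∃ p : {p : Fin m × Fin m // p.1 < p.2}, p.1.1.castSucc = i ∧ p.1.2.castSucc = j then
    X (Sum.inr hij.choose)
  else if hij : ∃ p : {p : Fin m × Fin m // p.1 < p.2}, p.1.1.castSucc = j ∧ p.1.2.castSucc = i then
    -X (Sum.inr hij.choose) else 0

/-- The values at `z = 1` of the coefficients of the response brackets. -/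
noncomputable def shiftVar (w : Fin 3) (i j : Fin (m + 1)) : MvPolynomial (LVar m) ℚ :=
  ![evenVar i j, C (1 / 2) * oddVar i j, C (-1 / 2) * oddVar i j] w

theorem isHomogeneous_evenVar (i j : Fin (m + 1)) : (evenVar i j).IsHomogeneous 1 := by
  unfold evenVar
  split_ifs
  · exact isHomogeneous_X _ _
  · exact isHomogeneous_X _ _
  · exact isHomogeneous_zero _ _ _

theorem isHomogeneous_oddVar (i j : Fin (m + 1)) : (oddVar i j).IsHomogeneous 1 := by
  unfold oddVar
  split_ifs
  · exact isHomogeneous_X _ _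
  · exact (isHomogeneous_X _ _).neg
  · exact isHomogeneous_zero _ _ _

theorem isHomogeneous_shiftVar (w : Fin 3) (i j : Fin (m + 1)) :
    (shiftVar w i j).IsHomogeneous 1 := by
  fin_cases w
  · exact isHomogeneous_evenVar i j
  · exact (isHomogeneous_oddVar i j).C_mul _
  · exact (isHomogeneous_oddVar i j).C_mul _

/-- The value at `z = 1` of a coefficient in the expansion of a product of brackets. -/
noncomputable def rationalCoeff (β₀ β : Fin h × Bool ≃ Fin (m + 1)) (w : Fin h → Fin 3)
    (σ : NonCrossingPairing m) : ℚ :=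
  (((expansionCoeff_spec β₀ β w).1 σ).2).choose

theorem rationalCoeff_spec (β₀ β : Fin h × Bool ≃ Fin (m + 1)) (w : Fin h → Fin 3)
    (σ : NonCrossingPairing m) : expansionCoeff β₀ β w σ 1 = rationalCoeff β₀ β w σ :=
  (((expansionCoeff_spec β₀ β w).1 σ).2).choose_spec

/-- The polynomial of a noncrossing pairing. -/
noncomputable def pairingPolynomial (β₀ : Fin h × Bool ≃ Fin (m + 1)) (σ : NonCrossingPairing m) :
    MvPolynomial (LVar m) ℚ :=
  ∑ β : Fin h × Bool ≃ Fin (m + 1), ∑ w : Fin h → Fin 3,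
    C (((pairSign β₀ β : ℤˣ) : ℚ) * rationalCoeff β₀ β w σ) *
      ∏ a, shiftVar (w a) (β (a, true)) (β (a, false))

theorem isHomogeneous_pairingPolynomial (β₀ : Fin h × Bool ≃ Fin (m + 1))
    (σ : NonCrossingPairing m) : (pairingPolynomial β₀ σ).IsHomogeneous h := by
  refine IsHomogeneous.sum _ _ _ fun β _ => IsHomogeneous.sum _ _ _ fun w _ =>
    IsHomogeneous.C_mul ?_ _
  have := IsHomogeneous.prod Finset.univ
    (fun a => shiftVar (w a) (β (a, true)) (β (a, false))) (fun _ => 1)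
    fun a _ => isHomogeneous_shiftVar _ _ _
  simpa using this

/-- The derivative at `1` is `m ≠ 0`, so `z = s ^ m` stays away from `1`, where `z - z⁻¹` vanishes.
-/
theorem tendsto_pow_nhdsNE {m : ℕ} (hm : m ≠ 0) :
    Tendsto (fun s : ℂ => s ^ m) (𝓝[≠] 1) (𝓝[≠] 1) := by
  refine tendsto_nhdsWithin_iff.2 ⟨?_, ?_⟩
  · have : ContinuousAt (fun s : ℂ => s ^ m) 1 := (continuous_pow m).continuousAt
    rw [ContinuousAt, one_pow] at this
    exact this.mono_left nhdsWithin_le_nhds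
  · exact (hasDerivAt_pow m (1 : ℂ)).eventually_ne (by simpa using hm)

theorem Polynomial.eventually_eval_ne_zero {p : Polynomial ℂ} (hp : p ≠ 0) (x : ℂ) :
    ∀ᶠ s in 𝓝[≠] x, p.eval s ≠ 0 := by
  -- A root at `x` itself has to be allowed: the forms can be dependent at `z = 1`.
  have hfin : ({s | p.eval s = 0} \ {x}).Finite :=
    (Polynomial.finite_setOfPred_isRoot hp).subset Set.sdiff_subset
  filter_upwards [nhdsWithin_le_nhds (hfin.isClosed.isOpen_compl.mem_nhds (by simp)),
    self_mem_nhdsWithin] with s hs hs'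
  exact fun h0 => hs ⟨h0, hs'⟩

namespace AnnularOneGraph

variable {V E : Type*} [Fintype V] [Fintype E] (G : AnnularOneGraph m V E)

theorem aeval_evenVar {i j : Fin (m + 1)} (hij : i ≠ j) :
    aeval G.LVal (evenVar i j) = G.response 1 i j := by
  unfold evenVar
  split_ifs with h1 h2
  · rw [aeval_X]; rfl
  · rw [aeval_X, G.response_symm 1 j i, inv_one]; rfl
  · exact absurd (le_antisymm (not_lt.1 h2) (not_lt.1 h1)) hij

theorem aeval_X_inr (p : {p : Fin m × Fin m // p.1 < p.2}) {i j : Fin (m + 1)}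
    (hi : p.1.1.castSucc = i) (hj : p.1.2.castSucc = j) :
    aeval G.LVal (X (Sum.inr p) : MvPolynomial (LVar m) ℚ) =
      deriv (fun z => G.response z i j) 1 := by
  subst hi hj
  rw [aeval_X]
  rfl

theorem tendsto_oddVar {i j : Fin (m + 1)} (hij : i ≠ j) (hi : i ≠ Fin.last m)
    (hj : j ≠ Fin.last m) :
    Tendsto (fun z => (G.response z i j - G.response z j i) / (2 * (z - z⁻¹))) (𝓝[≠] 1)
      (𝓝 (aeval G.LVal (oddVar i j) / 2)) := by
  unfold oddVar
  split_ifs with h1 h2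
  · rw [G.aeval_X_inr _ h1.choose_spec.1 h1.choose_spec.2]
    exact G.tendsto_response_odd _ _
  · have := (G.tendsto_response_odd j i).neg
    rw [map_neg, G.aeval_X_inr _ h2.choose_spec.1 h2.choose_spec.2, neg_div]
    refine this.congr fun z => ?_
    rw [← neg_div, neg_sub]
  · obtain ⟨i, rfl⟩ := Fin.exists_castSucc_eq.2 hi
    obtain ⟨j, rfl⟩ := Fin.exists_castSucc_eq.2 hj
    rcases lt_or_gt_of_ne (fun h => hij (congrArg _ h) : i ≠ j) with h | h
    · exact absurd ⟨⟨(i, j), h⟩, rfl, rfl⟩ h1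
    · exact absurd ⟨⟨(j, i), h⟩, rfl, rfl⟩ h2

theorem oddVar_eq_zero {i j : Fin (m + 1)} (hij : i = Fin.last m ∨ j = Fin.last m) :
    oddVar i j = 0 := by
  unfold oddVar
  rw [dif_neg, dif_neg]
  · rintro ⟨p, rfl, rfl⟩
    exact hij.elim (Fin.castSucc_ne_last _) (Fin.castSucc_ne_last _)
  · rintro ⟨p, rfl, rfl⟩
    exact hij.elim (Fin.castSucc_ne_last _) (Fin.castSucc_ne_last _)

/-- Even parts tend to the values `L`, and the quotients of the odd parts to half of `L'` up to
sign. There are no quotients for pairs with the outer node, so the derivatives of `L` at such pairs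
never enter. -/
theorem tendsto_shiftCoeff (w : Fin 3) {i j : Fin (m + 1)} (hij : i ≠ j) :
    Tendsto (fun z => G.shiftCoeff z w i j) (𝓝[≠] 1) (𝓝 (aeval G.LVal (shiftVar w i j))) := by
  have hc : ∀ i j, Tendsto (fun z => G.response z i j) (𝓝[≠] 1) (𝓝 (G.response 1 i j)) :=
    fun i j => (G.differentiableAt_response i j).continuousAt.tendsto.mono_left nhdsWithin_le_nhds
  have hs : G.response 1 j i = G.response 1 i j := by rw [G.response_symm 1 i j, inv_one]
  fin_cases w
  · change Tendsto (fun z => if j = Fin.last m then G.response z i (Fin.last m) else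
      if i = Fin.last m then G.response z j (Fin.last m) else
        (G.response z i j + G.response z j i) / 2) _ (𝓝 (aeval G.LVal (evenVar i j)))
    rw [G.aeval_evenVar hij]
    split_ifs with h1 h2
    · subst h1
      exact hc _ _
    · subst h2
      rw [← hs]
      exact hc _ _
    · have := ((hc i j).add (hc j i)).div_const 2
      rwa [hs, add_self_div_two] at this
  · change Tendsto (fun z => if i = Fin.last m ∨ j = Fin.last m then 0 else
      (G.response z i j - G.response z j i) / (2 * (z - z⁻¹))) _
        (𝓝 (aeval G.LVal (C (1 / 2) * oddVar i j)))
    split_ifs with h1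
    · rw [oddVar_eq_zero h1]
      simp
    · push Not at h1
      convert G.tendsto_oddVar hij h1.1 h1.2 using 2
      rw [map_mul, aeval_C, div_eq_inv_mul]
      norm_num
      ring
  · change Tendsto (fun z => if i = Fin.last m ∨ j = Fin.last m then 0 else
      -((G.response z i j - G.response z j i) / (2 * (z - z⁻¹)))) _
        (𝓝 (aeval G.LVal (C (-1 / 2) * oddVar i j)))
    split_ifs with h1
    · rw [oddVar_eq_zero h1]
      simp
    · push Not at h1
      convert (G.tendsto_oddVar hij h1.1 h1.2).neg using 2
      rw [map_mul, aeval_C, div_eq_inv_mul]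
      norm_num
      ring

theorem tendsto_responseSum (β₀ : Fin h × Bool ≃ Fin (m + 1)) (σ : NonCrossingPairing m) :
    Tendsto (G.responseSum β₀ σ) (𝓝[≠] 1) (𝓝 (aeval G.LVal (pairingPolynomial β₀ σ))) := by
  unfold responseSum pairingPolynomial
  simp only [map_sum, map_mul, aeval_C, map_prod]
  refine tendsto_finsetSum _ fun β _ => tendsto_finsetSum _ fun w _ => Tendsto.mul ?_
    (tendsto_finsetProd _ fun a _ => G.tendsto_shiftCoeff _ (by simp))
  have := ((expansionCoeff_spec β₀ β w).1 σ).1.tendsto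
  rw [rationalCoeff_spec] at this
  have h2 := (this.mono_left (nhdsWithin_le_nhds (s := {1}ᶜ))).const_mul
    (((pairSign β₀ β : ℤˣ) : ℂ))
  convert h2 using 2
  simp

/-- The generating functions of the groves of noncrossing pairings in terms of the response
matrix. -/
theorem Z_eq_mul_aeval (hm : m + 1 = 2 * h) (β₀ : Fin h × Bool ≃ Fin (m + 1))
    (σ : NonCrossingPairing m) :
    ((G.Z σ : ℝ) : ℂ) = (G.Z ⊥ : ℝ) * aeval G.LVal (pairingPolynomial β₀ σ) := by
  obtain ⟨p, hp, hind⟩ := exists_polynomial_independent hm β₀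
  have hm0 : m ≠ 0 := by omega
  have htend := tendsto_pow_nhdsNE hm0
  have hinv : HasDerivAt (fun z : ℂ => z - z⁻¹) 2 1 := by
    have h1 := hasDerivAt_inv (one_ne_zero (α := ℂ))
    exact ((hasDerivAt_id (1 : ℂ)).sub h1).congr_deriv (by norm_num)
  have hev : ∀ᶠ z : ℂ in 𝓝[≠] 1, z - z⁻¹ ≠ 0 ∧ G.dirichletDet z ≠ 0 :=
    (hinv.eventually_ne two_ne_zero).and
      (nhdsWithin_le_nhds G.eventually_dirichletDet_ne_zero)
  have hs0 : ∀ᶠ s : ℂ in 𝓝[≠] 1, s ≠ 0 :=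
    nhdsWithin_le_nhds (isOpen_ne.mem_nhds one_ne_zero)
  have hEq : ∀ᶠ s : ℂ in 𝓝[≠] 1, G.transportSum σ (s ^ m) =
      G.dirichletDet (s ^ m) * G.responseSum β₀ σ (s ^ m) := by
    filter_upwards [hs0, htend.eventually hev, Polynomial.eventually_eval_ne_zero hp 1]
      with s hs hz hps
    have hz0 : s ^ m ≠ 0 := pow_ne_zero _ hs
    -- Groves and response matrix give two expansions of one function of `e` and `f`; independence
    -- of the forms at this `s` equates the coefficients.
    have := hind s hs hps (fun σ => G.transportSum σ (s ^ m) -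
      G.dirichletDet (s ^ m) * G.responseSum β₀ σ (s ^ m)) fun e f => by
        have h1 := G.sum_responseBracket β₀ hz0 hz.2 e f
        rw [G.sum_responseBracket_eq β₀ hz0 hz.1, Finset.mul_sum] at h1
        simp only [sub_mul, Finset.sum_sub_distrib]
        rw [← h1, sub_eq_zero]
        exact Finset.sum_congr rfl fun σ _ => by ring
    exact sub_eq_zero.1 (congrFun this σ)
  have h1 : Tendsto (fun s : ℂ => G.transportSum σ (s ^ m)) (𝓝[≠] 1) (𝓝 (G.Z σ : ℝ)) := by
    rw [← G.transportSum_one σ.2.1]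
    exact ((G.continuousAt_transportSum σ).tendsto.mono_left nhdsWithin_le_nhds).comp htend
  have h2 : Tendsto (fun s : ℂ => G.dirichletDet (s ^ m) * G.responseSum β₀ σ (s ^ m)) (𝓝[≠] 1)
      (𝓝 ((G.Z ⊥ : ℝ) * aeval G.LVal (pairingPolynomial β₀ σ))) := by
    rw [← G.dirichletDet_one]
    exact (((G.differentiableAt_dirichletDet one_ne_zero).continuousAt.tendsto.mono_left
      nhdsWithin_le_nhds).comp htend).mul ((G.tendsto_responseSum β₀ σ).comp htend)
  -- Both coefficients have limits at `1`, so their equality persists even if independence fails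
  -- there.
  exact tendsto_nhds_unique (h1.congr' hEq) h2

end AnnularOneGraph

end PairingPolynomial

theorem theoremL (m : ℕ) (hm : Even (m + 1)) (σ : Setoid (Fin (m + 1))) (hσ : IsPairing σ) :
    ∃ P : MvPolynomial (LVar m) ℚ, P.IsHomogeneous ((m + 1) / 2) ∧
      ∀ (V E : Type*) [Fintype V] [Fintype E] (G : AnnularOneGraph m V E),
        G.dirichletDet 1 ≠ 0 ∧
        (∀ i j, DifferentiableAt ℂ (fun z => G.response z i j) 1) ∧
        0 < G.Z ⊥ ∧
        (G.Z σ ≠ 0 → P.totalDegree = (m + 1) / 2) ∧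
        ((G.Z σ / G.Z ⊥ : ℝ) : ℂ) = MvPolynomial.aeval G.LVal P := by
  obtain ⟨h, hh⟩ := hm
  have hm2 : m + 1 = 2 * h := by omega
  have hdiv : (m + 1) / 2 = h := by omega
  rw [hdiv]
  -- A crossing pairing has no groves on any graph, so the zero polynomial serves and the clause on
  -- the degree is vacuous.
  by_cases hnc : NonCrossing σ
  · obtain ⟨β₀⟩ : Nonempty (Fin h × Bool ≃ Fin (m + 1)) :=
      Fintype.card_eq.1 (by simp; omega)
    let τ : NonCrossingPairing m := ⟨σ, hσ, hnc⟩
    have hP := isHomogeneous_pairingPolynomial β₀ τ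
    refine ⟨pairingPolynomial β₀ τ, hP, fun V E _ _ G => ?_⟩
    have hZ := G.Z_bot_pos
    have hZ' : ((G.Z ⊥ : ℝ) : ℂ) ≠ 0 := Complex.ofReal_ne_zero.2 hZ.ne'
    have key := G.Z_eq_mul_aeval hm2 β₀ τ
    refine ⟨G.dirichletDet_one_ne_zero, G.differentiableAt_response, hZ, fun hne => ?_, ?_⟩
    · refine hP.totalDegree fun h0 => hne ?_
      rw [h0, map_zero, mul_zero] at key
      exact_mod_cast key
    · rw [Complex.ofReal_div, div_eq_iff hZ', mul_comm]
      exact key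
  · refine ⟨0, MvPolynomial.isHomogeneous_zero _ _ _, fun V E _ _ G => ?_⟩
    have h0 := G.Z_eq_zero_of_not_nonCrossing hσ hnc
    refine ⟨G.dirichletDet_one_ne_zero, G.differentiableAt_response, G.Z_bot_pos,
      fun hne => absurd h0 hne, ?_⟩
    rw [h0, zero_div, map_zero, Complex.ofReal_zero]
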